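/- Let $M$ be a smooth $m$-dimensional manifold, $\tau:LM\to M$ its frame bundle and $\tau_1:J^1\tau\to M$ the bundle of $1$-jets of local sections of $\tau$, with fibered coordinates $(x^\mu,e^\nu_k,e^\nu_{k\sigma})$; let $(e^k_\mu)$ be the inverse matrix of $(e^\mu_k)$. Let $\eta=\mathrm{diag}(\pm1,\dots,\pm1)$ (any signature), and let $r\ge 1$ be an integer with $2r\le m$. Summation over repeated indices is understood. On $J^1\tau$ consider the canonical forms $\theta^k=e^k_\mu\,dx^\mu$, the universal connection $\omega^i_j=e^i_\mu(de^\mu_j-e^\mu_{j\sigma}dx^\sigma)$, its curvature $\Omega^i_j=d\omega^i_j+\omega^i_k\wedge\omega^k_j$, $\Omega^{ab}=\eta^{bq}\Omega^a_q$, the Sparling forms $$\theta_{i_1\dots i_p}=\frac1{(m-p)!}\,\varepsilon_{i_1\dots i_m}\,\theta^{i_{p+1}}\wedge\dots\wedge\theta^{i_m},$$ and the $m$-forms $$\Psi^{ab}=\Big(\Omega^{sa}\eta^{tb}+\Omega^{sb}\eta^{ta}-\frac1r\,\eta^{ab}\Omega^{st}\Big)\wedge\theta_{st\,i_2\dots i_r\,j_2\dots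 j_r}\wedge\Omega^{i_2j_2}\wedge\dots\wedge\Omega^{i_rj_r}.$$ Let $\sigma$ be a smooth local section of $\tau_1$ over an open set $U\subseteq M$ (not necessarily holonomic) which takes its values in the torsionless jets, $T_0=\{e^\mu_{i\nu}e^i_\sigma=e^\mu_{i\sigma}e^i_\nu\}$, and satisfies the metricity condition $\sigma^*\omega_{\mathfrak p}=0$, where $(\omega_{\mathfrak p})^i_j=\frac12(\omega^i_j+\eta_{jp}\,\omega^p_q\,\eta^{qi})$. Let $g_{\mu\nu}=e^a_\mu\eta_{ab}e^b_\nu$ be the metric and $\Gamma^\mu_{\nu\sigma}=-e^k_\nu e^\mu_{k\sigma}$ the linear connection on $U$ determined by $\sigma$, and let $R^{\kappa\tau}_{\mu\nu}=g^{\rho\tau}R^\kappa_{\rho\mu\nu}$, where $R(\partial_\mu,\partial_\nu)\partial_\rho=R^\kappa_{\rho\mu\nu}\partial_\kappa$ is the curvature tensor of this connection. Then the following are equivalent: 1. $\sigma^*\Psi^{ab}=0$ on $U$ for all $a,b$; 2. the Lovelock tensor vanishes on $U$: in all local coordinates and for all $\mu,\nu$, $$\Big(\delta^{\mu\alpha_1\beta_1\dots\alpha_r\beta_r}_{\rho\lambda_1\theta_1\dots\lambda_r\theta_r}\,g^{\rho\nu}+\delta^{\nu\alpha_1\beta_1\dots\alpha_r\beta_r}_{\rho\lambda_1\theta_1\dots\lambda_r\theta_r}\,g^{\rho\mu}\Big)R^{\lambda_1\theta_1}_{\alpha_1\beta_1}\cdots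 R^{\lambda_r\theta_r}_{\alpha_r\beta_r}=0,$$ where $\delta^{\cdots}_{\cdots}$ is the generalized Kronecker delta; 3. $g$ satisfies the Euler–Lagrange equations of the Lovelock Lagrangian of order $r$, $$\mathcal L_r(g)=\sqrt{|\det g|}\;\delta^{\alpha_1\beta_1\dots\alpha_r\beta_r}_{\lambda_1\theta_1\dots\lambda_r\theta_r}R^{\lambda_1\theta_1}_{\alpha_1\beta_1}\cdots R^{\lambda_r\theta_r}_{\alpha_r\beta_r},$$ with $R$ now the curvature of the Levi-Civita connection of the metric; that is, in every coordinate chart, for every compact set $K$ in the part of the chart domain lying in $U$ and every smooth symmetric $h_{\mu\nu}$ supported in $K$, the derivative $\frac{d}{dt}\big|_{t=0}\int_K\mathcal L_r(g+th)\,d^mx$ exists and equals $0$. -/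

import Mathlib

open scoped Manifold ContDiff

noncomputable section

namespace Lovelock

/-! ### Exterior algebra of differential forms on coordinate spaces -/

/-- The exterior algebra `Λ(E*)` of the cotangent space of `E` at a point; multiplication is the
wedge product.  A differential form on `E` is a map `E → Forms E`. -/
abbrev Forms (E : Type*) [NormedAddCommGroup E] [NormedSpace ℝ E] : Type _ :=
  ExteriorAlgebra ℝ (E →L[ℝ] ℝ)

/-- A covector regarded as an element of degree one of the exterior algebra. -/
def oneForm {E : Type*} [NormedAddCommGroup E] [NormedSpace ℝ E] (α : E →L[ℝ] ℝ) : Forms E :=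
  ExteriorAlgebra.ι ℝ α

/-- Exterior derivative `dα = ∑_A dz^A ∧ ∂α/∂z^A` of a one-form `α` on a coordinate space. -/
def dOne {κ : Type*} [Fintype κ] [DecidableEq κ] (α : (κ → ℝ) → ((κ → ℝ) →L[ℝ] ℝ)) (z : κ → ℝ) :
    Forms (κ → ℝ) :=
  ∑ A, oneForm (ContinuousLinearMap.proj A) * oneForm (fderiv ℝ α z (Pi.single A 1))

/-- Pullback `f^* Φ` of a differential form `Φ` along `f`, evaluated at the point `y`. -/
def pullback {E F : Type*} [NormedAddCommGroup E] [NormedSpace ℝ E] [NormedAddCommGroup F]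
    [NormedSpace ℝ F] (f : E → F) (Φ : F → Forms F) (y : E) : Forms E :=
  ExteriorAlgebra.map (ContinuousLinearMap.precomp ℝ (fderiv ℝ f y)).toLinearMap (Φ (f y))

/-! ### Levi-Civita symbol, generalized Kronecker delta, the matrix `η` -/

/-- The Levi-Civita symbol `ε_{f 0 … f (m-1)}`: the sign of `f` if `f` is a permutation,
and `0` otherwise. -/
def leviCivita {m : ℕ} (f : Fin m → Fin m) : ℝ :=
  (Matrix.of fun a b : Fin m => if f a = b then (1 : ℝ) else 0).det

/-- The generalized Kronecker delta `δ^{i}_{j}`, a determinant of Kronecker deltas. The positions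
of the indices are labelled by a finite type `κ`; the value does not depend on an ordering of `κ`,
as long as the same one is used for the upper and the lower indices. -/
def kronecker {m : ℕ} {κ : Type*} [Fintype κ] [DecidableEq κ] (i j : κ → Fin m) : ℝ :=
  (Matrix.of fun a b : κ => if i a = j b then (1 : ℝ) else 0).det

/-- The matrix `η = diag(±1, …, ±1)` with the given signs; it is its own inverse, so that
`η_{ab} = η^{ab}`. -/
def eta {m : ℕ} (s : Fin m → ℤˣ) : Matrix (Fin m) (Fin m) ℝ :=
  Matrix.diagonal fun a => ((s a : ℤ) : ℝ)

/-! ### Canonical forms on the bundle `J¹τ` of 1-jets of frames, in fibered coordinates -/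

/-- Labels of the fibered coordinates `(x^μ, e^ν_k, e^ν_{kσ})` of `J¹τ`. -/
abbrev JetIdx (m : ℕ) : Type := Fin m ⊕ (Fin m × Fin m) ⊕ (Fin m × Fin m × Fin m)

/-- The space of fibered coordinates of `J¹τ`; the coordinates of actual jets of frames are those
points at which the matrix `(e^ν_k)` is invertible. -/
abbrev JetCoord (m : ℕ) : Type := JetIdx m → ℝ

section Forms

variable {m : ℕ}

/-- The matrix `e^ν_k`. -/
def frameMat (z : JetCoord m) : Matrix (Fin m) (Fin m) ℝ :=
  Matrix.of fun ν k => z (.inr (.inl (ν, k)))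

/-- The inverse matrix `e^k_μ`. -/
def coframeMat (z : JetCoord m) : Matrix (Fin m) (Fin m) ℝ := (frameMat z)⁻¹

/-- The coordinate `e^ν_{kσ}`. -/
def frameDer (z : JetCoord m) (ν k σ : Fin m) : ℝ := z (.inr (.inr (ν, k, σ)))

/-- The differential `dx^μ`. -/
def dx (μ : Fin m) : JetCoord m →L[ℝ] ℝ := ContinuousLinearMap.proj (.inl μ)

/-- The differential `de^ν_k`. -/
def de (ν k : Fin m) : JetCoord m →L[ℝ] ℝ := ContinuousLinearMap.proj (.inr (.inl (ν, k)))

/-- The canonical form `θ^k = e^k_μ dx^μ`. -/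
def theta (k : Fin m) (z : JetCoord m) : JetCoord m →L[ℝ] ℝ :=
  ∑ μ, coframeMat z k μ • dx μ

/-- The universal connection `ω^i_j = e^i_μ (de^μ_j - e^μ_{jσ} dx^σ)`. -/
def omega (i j : Fin m) (z : JetCoord m) : JetCoord m →L[ℝ] ℝ :=
  ∑ μ, coframeMat z i μ • (de μ j - ∑ σ, frameDer z μ j σ • dx σ)

/-- The component `(ω_𝔭)^i_j = ½ (ω^i_j + η_{jp} ω^p_q η^{qi})`. -/
def omegaP (s : Fin m → ℤˣ) (i j : Fin m) (z : JetCoord m) : JetCoord m →L[ℝ] ℝ :=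
  (1 / 2 : ℝ) • (omega i j z + ∑ p, ∑ q, (eta s j p * eta s q i) • omega p q z)

/-- The universal curvature `Ω^i_j = dω^i_j + ω^i_k ∧ ω^k_j`. -/
def curvForm (i j : Fin m) (z : JetCoord m) : Forms (JetCoord m) :=
  dOne (omega i j) z + ∑ k, oneForm (omega i k z) * oneForm (omega k j z)

/-- `Ω^{ab} = η^{bq} Ω^a_q`. -/
def curvFormUp (s : Fin m → ℤˣ) (a b : Fin m) (z : JetCoord m) : Forms (JetCoord m) :=
  ∑ q, eta s b q • curvForm a q z

/-- The Sparling form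
`θ_{i_1 … i_p} = (1/(m-p)!) ε_{i_1 … i_p i_{p+1} … i_m} θ^{i_{p+1}} ∧ … ∧ θ^{i_m}`, for `p ≤ m`. -/
def sparling {p : ℕ} (I : Fin p → Fin m) (z : JetCoord m) : Forms (JetCoord m) :=
  ((m - p).factorial : ℝ)⁻¹ • ∑ L : Fin (m - p) → Fin m,
    leviCivita (fun a : Fin m =>
      if h : (a : ℕ) < p then I ⟨a, h⟩ else L ⟨(a : ℕ) - p, by have := a.isLt; omega⟩) •
    (List.ofFn fun c => oneForm (theta (L c) z)).prod

/-- `Ω^{IJ} = Ω^{i_1 j_1} ∧ … ∧ Ω^{i_n j_n}`. -/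
def curvFormProd (s : Fin m → ℤˣ) {n : ℕ} (I J : Fin n → Fin m) (z : JetCoord m) :
    Forms (JetCoord m) :=
  (List.ofFn fun c => curvFormUp s (I c) (J c) z).prod

/-- `Ψ^{ab} = (Ω^{sa} η^{tb} + Ω^{sb} η^{ta} - (1/r) η^{ab} Ω^{st}) ∧ θ_{stI'J'} ∧ Ω^{I'J'}`, with
`I' = (i_2, …, i_r)` and `J' = (j_2, …, j_r)`. -/
def Psi (s : Fin m → ℤˣ) (r : ℕ) (a b : Fin m) (z : JetCoord m) : Forms (JetCoord m) :=
  ∑ c, ∑ t, ∑ I : Fin (r - 1) → Fin m, ∑ J : Fin (r - 1) → Fin m,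
    (eta s t b • curvFormUp s c a z + eta s t a • curvFormUp s c b z
        - ((1 / (r : ℝ)) * eta s a b) • curvFormUp s c t z)
      * sparling (Fin.append ![c, t] (Fin.append I J)) z * curvFormProd s I J z

end Forms

/-! ### Local sections of `J¹τ` -/

/-- The components, in the chart `φ`, of the vector field `X`, as a function on the chart's
image. -/
def chartComp {m : ℕ} {M : Type*} [TopologicalSpace M] [ChartedSpace (Fin m → ℝ) M]
    (φ : OpenPartialHomeomorph M (Fin m → ℝ))
    (X : (x : M) → TangentSpace 𝓘(ℝ, Fin m → ℝ) x) (y : Fin m → ℝ) : Fin m → ℝ :=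
  mfderiv 𝓘(ℝ, Fin m → ℝ) 𝓘(ℝ, Fin m → ℝ) φ (φ.symm y) (X (φ.symm y))

/-- The fibered coordinates `(x^μ, e^ν_k, e^ν_{kσ})`, in the chart `φ`, of the 1-jet at `φ⁻¹ y` of
the field of frames `S`. -/
def jetCoord {m : ℕ} {M : Type*} [TopologicalSpace M] [ChartedSpace (Fin m → ℝ) M]
    (φ : OpenPartialHomeomorph M (Fin m → ℝ))
    (S : Fin m → (x : M) → TangentSpace 𝓘(ℝ, Fin m → ℝ) x) (y : Fin m → ℝ) : JetCoord m
  | .inl μ => y μ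
  | .inr (.inl (ν, k)) => chartComp φ (S k) y ν
  | .inr (.inr (ν, k, σ)) => fderiv ℝ (chartComp φ (S k)) y (Pi.single σ 1) ν

/-- A smooth local section `x ↦ j¹_x (S x)` over `U` of the bundle `τ₁ : J¹τ → M` of 1-jets of
local sections of the frame bundle `τ : LM → M`. The jet at each point `x` is given by a local
field of frames `S x` representing it (only its 1-jet at `x` enters in what follows); the section
need not be holonomic, that is, `S x` may vary with `x`. -/
structure JetSection (m : ℕ) (M : Type*) [TopologicalSpace M] [ChartedSpace (Fin m → ℝ) M]
    [IsManifold 𝓘(ℝ, Fin m → ℝ) ∞ M] (U : Set M) where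
  /-- the local field of frames whose 1-jet at `x` is the value of the section at `x` -/
  S : M → Fin m → (y : M) → TangentSpace 𝓘(ℝ, Fin m → ℝ) y
  contMDiffAt_S : ∀ x ∈ U, ∀ k, ContMDiffAt 𝓘(ℝ, Fin m → ℝ) 𝓘(ℝ, Fin m → ℝ).tangent ∞
    (fun y => (⟨y, S x k y⟩ : TangentBundle 𝓘(ℝ, Fin m → ℝ) M)) x
  linearIndependent_S : ∀ x ∈ U, LinearIndependent ℝ fun k => S x k x
  /-- smoothness: the fibered coordinates are smooth functions of the coordinates on `M` -/
  smooth : ∀ φ ∈ IsManifold.maximalAtlas 𝓘(ℝ, Fin m → ℝ) ∞ M,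
    ContDiffOn ℝ ∞ (fun y => jetCoord φ (S (φ.symm y)) y) (φ.target ∩ φ.symm ⁻¹' U)

namespace JetSection

variable {m : ℕ} {M : Type*} [TopologicalSpace M] [ChartedSpace (Fin m → ℝ) M]
  [IsManifold 𝓘(ℝ, Fin m → ℝ) ∞ M] {U : Set M}

/-- The image in the chart `φ` of the part of `U` covered by `φ`. -/
def dom (_σ : JetSection m M U) (φ : OpenPartialHomeomorph M (Fin m → ℝ)) : Set (Fin m → ℝ) :=
  φ.target ∩ φ.symm ⁻¹' U

/-- The section in fibered coordinates. -/
def coord (σ : JetSection m M U) (φ : OpenPartialHomeomorph M (Fin m → ℝ)) (y : Fin m → ℝ) :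
    JetCoord m :=
  jetCoord φ (σ.S (φ.symm y)) y

/-- The section takes its values in the submanifold `T₀` of torsionless jets, given in fibered
coordinates by `e^μ_{iν} e^i_σ = e^μ_{iσ} e^i_ν`. -/
def Torsionless (σ : JetSection m M U) : Prop :=
  ∀ φ ∈ IsManifold.maximalAtlas 𝓘(ℝ, Fin m → ℝ) ∞ M, ∀ y ∈ σ.dom φ, ∀ μ ν ρ : Fin m,
    ∑ i, frameDer (σ.coord φ y) μ i ν * coframeMat (σ.coord φ y) i ρ =
      ∑ i, frameDer (σ.coord φ y) μ i ρ * coframeMat (σ.coord φ y) i ν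

/-- The metricity condition `σ^* ω_𝔭 = 0`. -/
def Metricity (s : Fin m → ℤˣ) (σ : JetSection m M U) : Prop :=
  ∀ φ ∈ IsManifold.maximalAtlas 𝓘(ℝ, Fin m → ℝ) ∞ M, ∀ y ∈ σ.dom φ, ∀ i j : Fin m,
    pullback (σ.coord φ) (fun z => oneForm (omegaP s i j z)) y = 0

/-- The metric `g_{μν} = e^a_μ η_{ab} e^b_ν` determined by the section. -/
def metric (s : Fin m → ℤˣ) (σ : JetSection m M U) (φ : OpenPartialHomeomorph M (Fin m → ℝ))
    (y : Fin m → ℝ) : Matrix (Fin m) (Fin m) ℝ :=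
  Matrix.of fun μ ν =>
    ∑ a, ∑ b, coframeMat (σ.coord φ y) a μ * eta s a b * coframeMat (σ.coord φ y) b ν

/-- The coefficients `Γ^μ_{νσ} = - e^k_ν e^μ_{kσ}` of the linear connection determined by the
section. -/
def connection (σ : JetSection m M U) (φ : OpenPartialHomeomorph M (Fin m → ℝ))
    (μ ν ρ : Fin m) (y : Fin m → ℝ) : ℝ :=
  -∑ k, coframeMat (σ.coord φ y) k ν * frameDer (σ.coord φ y) μ k ρ

end JetSection

/-! ### Curvature, the Lovelock tensor and the Lovelock Lagrangian in coordinates -/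

section Tensors

variable {m : ℕ}

/-- The partial derivative `∂_μ f`. -/
def pderiv (μ : Fin m) (f : (Fin m → ℝ) → ℝ) (y : Fin m → ℝ) : ℝ :=
  fderiv ℝ f y (Pi.single μ 1)

/-- The curvature `R^κ_{ρμν}` of the linear connection with coefficients `Γ^μ_{νσ}`, where
`∇_{∂_σ} ∂_ν = Γ^μ_{νσ} ∂_μ` and `R(∂_μ, ∂_ν) ∂_ρ = R^κ_{ρμν} ∂_κ`. -/
def curvature (Γ : Fin m → Fin m → Fin m → (Fin m → ℝ) → ℝ) (κ ρ μ ν : Fin m)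
    (y : Fin m → ℝ) : ℝ :=
  pderiv μ (Γ κ ρ ν) y - pderiv ν (Γ κ ρ μ) y
    + ∑ l, (Γ κ l μ y * Γ l ρ ν y - Γ κ l ν y * Γ l ρ μ y)

/-- `R^{κτ}_{μν} = g^{ρτ} R^κ_{ρμν}`. -/
def curvatureUp (g : (Fin m → ℝ) → Matrix (Fin m) (Fin m) ℝ)
    (Γ : Fin m → Fin m → Fin m → (Fin m → ℝ) → ℝ) (κ τ μ ν : Fin m) (y : Fin m → ℝ) : ℝ :=
  ∑ ρ, (g y)⁻¹ ρ τ * curvature Γ κ ρ μ ν y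

/-- The Lovelock tensor
`A^{μν} = (δ^{μ α₁β₁…α_rβ_r}_{ρ λ₁θ₁…λ_rθ_r} g^{ρν} + δ^{ν α₁β₁…α_rβ_r}_{ρ λ₁θ₁…λ_rθ_r} g^{ρμ})
  R^{λ₁θ₁}_{α₁β₁} ⋯ R^{λ_rθ_r}_{α_rβ_r}`.
The indices are `(α_k, β_k) = (A (k, 0), A (k, 1))` and `(λ_k, θ_k) = (B (k, 0), B (k, 1))`. -/
def lovelockTensor (r : ℕ) (g : (Fin m → ℝ) → Matrix (Fin m) (Fin m) ℝ)
    (Γ : Fin m → Fin m → Fin m → (Fin m → ℝ) → ℝ) (μ ν : Fin m) (y : Fin m → ℝ) : ℝ :=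
  ∑ ρ, ∑ A : Fin r × Fin 2 → Fin m, ∑ B : Fin r × Fin 2 → Fin m,
    (kronecker (fun o : Option (Fin r × Fin 2) => o.elim μ A) (fun o => o.elim ρ B) * (g y)⁻¹ ρ ν
      + kronecker (fun o : Option (Fin r × Fin 2) => o.elim ν A) (fun o => o.elim ρ B)
          * (g y)⁻¹ ρ μ)
      * ∏ k, curvatureUp g Γ (B (k, 0)) (B (k, 1)) (A (k, 0)) (A (k, 1)) y

/-- The coefficients `Γ^μ_{νσ} = ½ g^{μλ} (∂_ν g_{λσ} + ∂_σ g_{λν} - ∂_λ g_{νσ})` of the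
Levi-Civita connection of the metric `g`. -/
def christoffel (g : (Fin m → ℝ) → Matrix (Fin m) (Fin m) ℝ) (μ ν σ : Fin m)
    (y : Fin m → ℝ) : ℝ :=
  (1 / 2 : ℝ) * ∑ l, (g y)⁻¹ μ l *
    (pderiv ν (fun x => g x l σ) y + pderiv σ (fun x => g x l ν) y - pderiv l (fun x => g x ν σ) y)

/-- The Lovelock Lagrangian density of order `r`,
`√|det g| δ^{α₁β₁…α_rβ_r}_{λ₁θ₁…λ_rθ_r} R^{λ₁θ₁}_{α₁β₁} ⋯ R^{λ_rθ_r}_{α_rβ_r}`, with the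
curvature of the Levi-Civita connection of `g`. -/
def lovelockDensity (r : ℕ) (g : (Fin m → ℝ) → Matrix (Fin m) (Fin m) ℝ) (y : Fin m → ℝ) : ℝ :=
  Real.sqrt |(g y).det| * ∑ A : Fin r × Fin 2 → Fin m, ∑ B : Fin r × Fin 2 → Fin m,
    kronecker A B *
      ∏ k, curvatureUp g (christoffel g) (B (k, 0)) (B (k, 1)) (A (k, 0)) (A (k, 1)) y

/-- The metric `g` satisfies on the open set `V` the Euler-Lagrange equations of the Lovelock
Lagrangian of order `r`: the first variation of the action vanishes for all smooth symmetric
variations `h` of the metric with compact support in `V`. -/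
def IsLovelockExtremal (r : ℕ) (g : (Fin m → ℝ) → Matrix (Fin m) (Fin m) ℝ)
    (V : Set (Fin m → ℝ)) : Prop :=
  ∀ K : Set (Fin m → ℝ), IsCompact K → K ⊆ V →
    ∀ h : (Fin m → ℝ) → Matrix (Fin m) (Fin m) ℝ, (∀ μ ν, ContDiff ℝ ∞ fun y => h y μ ν) →
      (∀ y, (h y).IsSymm) → tsupport h ⊆ K →
      HasDerivAt (fun t : ℝ => ∫ y in K, lovelockDensity r (fun x => g x + t • h x) y) 0 0

end Tensors

end Lovelock

end

/-!
Metricity and the absence of torsion make the connection of `σ` the Levi-Civita connection of its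
metric `g`. In the moving frame of `σ` the form `Ω^{ab}` pulls back to `½ R^{ab}_{αβ} dx^α ∧ dx^β`,
and expanding the product of these two-forms with the Sparling form shows that `σ^* Ψ^{ab}` is a
nonzero constant times the Lovelock tensor, expressed in the frame, times the volume form.

In the first variation of the Lovelock Lagrangian the variation of the curvature is the covariant
curl of the variation `δΓ` of the connection. By the Bianchi identity the covariant derivatives can
be moved onto the whole product, so these terms form a divergence, which integrates to zero. What
remains is the Lovelock tensor contracted with the variation of the metric.

Only the algebra of smooth functions on an open set, with the coordinate derivatives as commuting
derivations, enters these computations, which thereby become matrix algebra.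
-/

noncomputable section

namespace Lovelock

open scoped Matrix

/-! ### The generalized Kronecker delta -/

section Determinants

variable {R : Type*} [CommRing R] {κ : Type*} [Fintype κ] [DecidableEq κ]

theorem sum_det_updateRow (M N : Matrix κ κ R) :
    ∑ i, (M.updateRow i (N i)).det = (M.adjugate * N).trace := by
  rw [Matrix.trace_mul_comm, Matrix.trace]
  refine Finset.sum_congr rfl fun i _ => ?_
  rw [← Matrix.cramer_transpose_apply, Matrix.cramer_eq_adjugate_mulVec, Matrix.diag_apply,
    Matrix.mul_apply, Matrix.mulVec, dotProduct]
  refine Finset.sum_congr rfl fun j _ => ?_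
  rw [← Matrix.adjugate_transpose, Matrix.transpose_apply, mul_comm]

theorem sum_det_updateCol (M N : Matrix κ κ R) :
    ∑ j, (M.updateCol j fun i => N i j).det = (M.adjugate * N).trace := by
  rw [Matrix.trace]
  refine Finset.sum_congr rfl fun i _ => ?_
  rw [← Matrix.cramer_apply, Matrix.cramer_eq_adjugate_mulVec, Matrix.diag_apply,
    Matrix.mul_apply, Matrix.mulVec, dotProduct]

theorem det_option_column (M : Matrix (Option κ) (Option κ) R) :
    M.det = M none none * (M.submatrix some some).det
      - ∑ b, M (some b) none *
          ((M.submatrix some some).updateRow b fun a => M none (some a)).det := by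
  rw [Matrix.det_apply', ← Equiv.sum_comp Equiv.Perm.decomposeOption.symm,
    Fintype.sum_prod_type, Fintype.sum_option, sub_eq_add_neg]
  congr 1
  · rw [Matrix.det_apply', Finset.mul_sum]
    refine Finset.sum_congr rfl fun e _ => ?_
    simp [Fintype.prod_option, mul_left_comm]
  · rw [← Finset.sum_neg_distrib]
    refine Finset.sum_congr rfl fun b _ => ?_
    rw [Matrix.det_apply', Finset.mul_sum, ← Finset.sum_neg_distrib]
    refine Finset.sum_congr rfl fun e _ => ?_
    have entry_some : ∀ i, M (Equiv.Perm.decomposeOption.symm (some b, e) (some i)) (some i)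
        = ((M.submatrix some some).updateRow b fun a => M none (some a)) (e i) i := by
      intro i
      by_cases hb : e i = b
      · simp [Matrix.updateRow_apply, hb]
      · simp only [Equiv.Perm.decomposeOption_symm_apply, Equiv.Perm.coe_mul, Function.comp_apply,
          Equiv.optionCongr_apply, Option.map_some, Matrix.updateRow_apply, hb, if_false,
          Matrix.submatrix_apply]
        rw [Equiv.swap_apply_of_ne_of_ne] <;> simp [hb]
    rw [Fintype.prod_option]
    simp_rw [entry_some]
    simp [mul_left_comm]

theorem det_option_row (M : Matrix (Option κ) (Option κ) R) :
    M.det = M none none * (M.submatrix some some).det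
      - ∑ b, M none (some b) *
          ((M.submatrix some some).updateCol b fun a => M (some a) none).det := by
  rw [← Matrix.det_transpose, det_option_column]
  congr 1
  · rw [Matrix.transpose_apply, ← Matrix.det_transpose, Matrix.transpose_submatrix,
      Matrix.transpose_transpose]
  · refine Finset.sum_congr rfl fun b _ => ?_
    rw [Matrix.transpose_apply, ← Matrix.det_transpose]
    congr 2
    ext i j
    simp [Matrix.updateRow_apply, Matrix.updateCol_apply]

end Determinants

section DeltaMatrix

variable {R : Type*} [CommRing R] {m : ℕ} {κ : Type*}

/-- The matrix of Kronecker deltas whose determinant is the generalized Kronecker delta, with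
entries in an arbitrary commutative ring. -/
def deltaMat (R : Type*) [CommRing R] (A B : κ → Fin m) : Matrix κ κ R :=
  Matrix.of fun a b => if A a = B b then 1 else 0

theorem transpose_deltaMat (A B : κ → Fin m) : (deltaMat R A B)ᵀ = deltaMat R B A := by
  ext a b
  simp [deltaMat, eq_comm]

variable [DecidableEq κ]

theorem updateCol_deltaMat (A B : κ → Fin m) (b : κ) (x : Fin m) :
    ((deltaMat R A B).updateCol b fun a => if A a = x then 1 else 0)
      = deltaMat R A (Function.update B b x) := by
  ext i j
  by_cases hj : j = b
  · subst hj; simp [deltaMat]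
  · simp [deltaMat, hj]

end DeltaMatrix

section Kronecker

variable {R : Type*} [CommRing R] {m : ℕ} {κ : Type*} [Fintype κ] [DecidableEq κ]

theorem kronecker_comp_perm (e : Equiv.Perm κ) (A B : κ → Fin m) :
    kronecker (A ∘ e) B = ((Equiv.Perm.sign e : ℤ) : ℝ) * kronecker A B := by
  rw [kronecker, kronecker, ← Matrix.det_permute]
  rfl

theorem kronecker_comm (A B : κ → Fin m) : kronecker A B = kronecker B A := by
  rw [kronecker, ← Matrix.det_transpose]
  exact congrArg Matrix.det (transpose_deltaMat A B)

theorem kronecker_comp_equiv {κ' : Type*} [Fintype κ'] [DecidableEq κ'] (e : κ' ≃ κ)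
    (A B : κ → Fin m) : kronecker (A ∘ e) (B ∘ e) = kronecker A B := by
  rw [kronecker, kronecker, ← Matrix.det_submatrix_equiv_self e]
  rfl

theorem kronecker_comp_swap {a b : κ} (h : a ≠ b) (A B : κ → Fin m) :
    kronecker (A ∘ Equiv.swap a b) B = -kronecker A B := by
  simp [kronecker_comp_perm, Equiv.Perm.sign_swap h]

theorem det_updateCol_deltaMat (A B : κ → Fin m) (b : κ) (v : Fin m → R) :
    ((deltaMat R A B).updateCol b fun a => v (A a)).det
      = ∑ x, (deltaMat R A (Function.update B b x)).det * v x := by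
  have hv : (fun a => v (A a)) = ∑ x, v x • fun a => if A a = x then (1 : R) else 0 := by
    ext a
    simp [Finset.sum_apply]
  rw [hv, ← Matrix.cramer_apply, map_sum, Finset.sum_apply]
  simp_rw [map_smul, Pi.smul_apply, Matrix.cramer_apply, updateCol_deltaMat, smul_eq_mul, mul_comm]

theorem det_updateRow_deltaMat (A B : κ → Fin m) (a : κ) (v : Fin m → R) :
    ((deltaMat R A B).updateRow a fun b => v (B b)).det
      = ∑ x, (deltaMat R (Function.update A a x) B).det * v x := by
  rw [← Matrix.det_transpose, ← Matrix.updateCol_transpose, transpose_deltaMat,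
    det_updateCol_deltaMat]
  simp_rw [← transpose_deltaMat B, Matrix.det_transpose]

variable [Algebra ℝ R]

theorem algebraMap_kronecker (A B : κ → Fin m) :
    algebraMap ℝ R (kronecker A B) = (deltaMat R A B).det := by
  rw [kronecker, RingHom.map_det]
  congr 1
  ext a b
  simp [deltaMat, apply_ite (algebraMap ℝ R)]

/-- Infinitesimal invariance under the linear group: both sides are the trace of the product of
the adjugate of the matrix of deltas with the matrix of the `G (A a) (B b)`. -/
theorem sum_kronecker_update (G : Fin m → Fin m → R) (A B : κ → Fin m) :
    ∑ b, ∑ x, algebraMap ℝ R (kronecker A (Function.update B b x)) * G x (B b)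
      = ∑ a, ∑ x, algebraMap ℝ R (kronecker (Function.update A a x) B) * G (A a) x := by
  set N : Matrix κ κ R := Matrix.of fun a b => G (A a) (B b)
  simp_rw [algebraMap_kronecker]
  calc _ = ∑ b, ((deltaMat R A B).updateCol b fun a => N a b).det :=
        Finset.sum_congr rfl fun b _ => (det_updateCol_deltaMat A B b fun x => G x (B b)).symm
    _ = ∑ a, ((deltaMat R A B).updateRow a (N a)).det := by
        rw [sum_det_updateCol, sum_det_updateRow]
    _ = _ := Finset.sum_congr rfl fun a _ => det_updateRow_deltaMat A B a (G (A a))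

theorem kronecker_option (μ ρ : Fin m) (A B : κ → Fin m) :
    kronecker (fun o : Option κ => o.elim μ A) (fun o => o.elim ρ B)
      = (if μ = ρ then 1 else 0) * kronecker A B
        - ∑ b, (if μ = B b then 1 else 0) * kronecker A (Function.update B b ρ) := by
  rw [kronecker, det_option_row]
  congr 1
  refine Finset.sum_congr rfl fun b _ => ?_
  exact congrArg _ (congrArg Matrix.det (updateCol_deltaMat A B b ρ))

theorem sum_kronecker_option (A B : κ → Fin m) :
    ∑ x, kronecker (fun o : Option κ => o.elim x A) (fun o => o.elim x B)
      = ((m : ℝ) - Fintype.card κ) * kronecker A B := by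
  simp_rw [kronecker_option, Finset.sum_sub_distrib]
  rw [Finset.sum_comm]
  simp [Function.update_eq_self, sub_mul]

/-- Moves the distinguished element of `Option κ` to the head of the second summand. -/
def optionSumFinEquiv (κ : Type*) (q : ℕ) : Option κ ⊕ Fin q ≃ κ ⊕ Fin (q + 1) where
  toFun := Sum.elim (fun o => o.elim (Sum.inr 0) Sum.inl) fun i => Sum.inr i.succ
  invFun := Sum.elim (fun k => Sum.inl (some k)) (Fin.cases (Sum.inl none) fun i => Sum.inr i)
  left_inv := by rintro ((_ | _) | _) <;> simp
  right_inv := by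
    rintro (_ | i)
    · simp
    · cases i using Fin.cases <;> simp

theorem kronecker_sumElim_cons {q : ℕ} (A B : κ → Fin m) (x y : Fin m) (K L : Fin q → Fin m) :
    kronecker (Sum.elim A (Fin.cons x K : Fin (q + 1) → Fin m))
        (Sum.elim B (Fin.cons y L : Fin (q + 1) → Fin m))
      = kronecker (Sum.elim (fun o : Option κ => o.elim x A) K)
          (Sum.elim (fun o : Option κ => o.elim y B) L) := by
  rw [← kronecker_comp_equiv (optionSumFinEquiv κ q)]
  congr 1 <;> · ext i; rcases i with (_ | _) | _ <;> simp [optionSumFinEquiv]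

theorem sum_kronecker_sumElim (q : ℕ) (A B : κ → Fin m) (h : Fintype.card κ + q = m) :
    ∑ L : Fin q → Fin m, kronecker (Sum.elim A L) (Sum.elim B L)
      = (q.factorial : ℝ) * kronecker A B := by
  induction q generalizing κ with
  | zero =>
    rw [Fintype.sum_unique, ← kronecker_comp_equiv (Equiv.sumEmpty κ (Fin 0)).symm]
    simp only [Nat.factorial_zero, Nat.cast_one, one_mul]
    rfl
  | succ q ih =>
    have card_option : Fintype.card (Option κ) + q = m := by rw [Fintype.card_option]; omega
    have sub_card : (m : ℝ) - Fintype.card κ = q + 1 := by rw [← h]; push_cast; ring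
    calc ∑ L : Fin (q + 1) → Fin m, kronecker (Sum.elim A L) (Sum.elim B L)
        = ∑ x, ∑ L : Fin q → Fin m, kronecker (Sum.elim A (Fin.cons x L : Fin (q + 1) → Fin m))
            (Sum.elim B (Fin.cons x L : Fin (q + 1) → Fin m)) := by
          rw [← Equiv.sum_comp (Fin.consEquiv fun _ => Fin m), Fintype.sum_prod_type]
          rfl
      _ = (q.factorial : ℝ) * ∑ x, kronecker (fun o : Option κ => o.elim x A)
            (fun o => o.elim x B) := by
          simp_rw [kronecker_sumElim_cons, ih _ _ card_option, Finset.mul_sum]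
      _ = ((q + 1).factorial : ℝ) * kronecker A B := by
          rw [sum_kronecker_option, sub_card, Nat.factorial_succ]
          push_cast
          ring

end Kronecker

/-! ### Levi-Civita connections over a commutative algebra with commuting derivations -/

section Derivations

variable {k R : Type*} [CommRing k] [CommRing R] [Algebra k R] (D : Derivation k R R)

theorem derivation_prod {κ : Type*} [DecidableEq κ] (s : Finset κ) (f : κ → R) :
    D (∏ i ∈ s, f i) = ∑ j ∈ s, ∏ i ∈ s, if i = j then D (f j) else f i := by
  induction s using Finset.induction_on with
  | empty => simp
  | insert a s ha ih =>
    have prod_insert_of_mem : ∀ j ∈ s, (∏ i ∈ insert a s, if i = j then D (f j) else f i)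
        = f a * ∏ i ∈ s, if i = j then D (f j) else f i := by
      intro j hj
      rw [Finset.prod_insert ha, if_neg (fun h : a = j => ha (h ▸ hj))]
    have prod_of_notMem : (∏ i ∈ s, if i = a then D (f a) else f i) = ∏ i ∈ s, f i :=
      Finset.prod_congr rfl fun i hi => if_neg fun h : i = a => ha (h ▸ hi)
    rw [Finset.prod_insert ha, Derivation.leibniz, ih, Finset.sum_insert ha,
      Finset.sum_congr rfl prod_insert_of_mem, ← Finset.mul_sum, Finset.prod_insert ha, if_pos rfl,
      prod_of_notMem, smul_eq_mul, smul_eq_mul, add_comm, mul_comm (D (f a))]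

variable {κ : Type*}

/-- The matrix obtained by applying a derivation to every entry of a matrix. -/
def matDer (M : Matrix κ κ R) : Matrix κ κ R := M.map D

@[simp]
theorem matDer_apply (M : Matrix κ κ R) (i j : κ) :
    matDer D M i j = D (M i j) := rfl

theorem matDer_add (M N : Matrix κ κ R) :
    matDer D (M + N) = matDer D M + matDer D N := by ext; simp

theorem matDer_sub (M N : Matrix κ κ R) :
    matDer D (M - N) = matDer D M - matDer D N := by ext; simp

theorem matDer_neg (M : Matrix κ κ R) :
    matDer D (-M) = -matDer D M := by ext; simp

theorem matDer_one [DecidableEq κ] : matDer D (1 : Matrix κ κ R) = 0 := by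
  ext i j
  by_cases h : i = j <;> simp [h]

theorem matDer_transpose (M : Matrix κ κ R) :
    matDer D Mᵀ = (matDer D M)ᵀ := rfl

variable [Fintype κ]

theorem matDer_mul (M N : Matrix κ κ R) :
    matDer D (M * N) = matDer D M * N + M * matDer D N := by
  ext i j
  simp only [matDer_apply, Matrix.mul_apply, map_sum, Derivation.leibniz, smul_eq_mul,
    Matrix.add_apply]
  rw [← Finset.sum_add_distrib]
  exact Finset.sum_congr rfl fun k _ => by ring

variable [DecidableEq κ]

theorem matDer_inverse {M N : Matrix κ κ R} (h : M * N = 1) :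
    matDer D N = -(N * matDer D M * N) := by
  have inv_mul : N * M = 1 := mul_eq_one_comm.mp h
  have leibniz : matDer D M * N + M * matDer D N = 0 := by rw [← matDer_mul, h, matDer_one]
  calc matDer D N = N * (matDer D M * N + M * matDer D N) - N * matDer D M * N := by
        rw [mul_add, ← mul_assoc, ← mul_assoc, inv_mul, one_mul, add_sub_cancel_left]
    _ = -(N * matDer D M * N) := by rw [leibniz, mul_zero, zero_sub]

theorem derivation_det (M : Matrix κ κ R) :
    D M.det = (M.adjugate * matDer D M).trace := by
  rw [← sum_det_updateCol, Matrix.det_apply']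
  simp only [map_sum, Derivation.leibniz, Derivation.map_intCast, mul_zero, add_zero,
    derivation_prod, smul_eq_mul, Matrix.det_apply', Finset.mul_sum]
  refine Finset.sum_comm.trans ?_
  refine Finset.sum_congr rfl fun j _ => Finset.sum_congr rfl fun σ _ => ?_
  congr 1
  refine Finset.prod_congr rfl fun i _ => ?_
  by_cases h : i = j
  · subst h; simp
  · simp [h]

theorem smul_adjugate_of_mul_eq_one {g gi : Matrix κ κ R} (h : g * gi = 1) :
    gi.det • g.adjugate = gi := by
  have det_mul_det : gi.det * g.det = 1 := by
    rw [mul_comm, ← Matrix.det_mul, h, Matrix.det_one]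
  calc gi.det • g.adjugate = gi.det • (g.adjugate * (g * gi)) := by rw [h, mul_one]
    _ = gi := by
      rw [← mul_assoc, Matrix.adjugate_mul, Matrix.smul_mul, one_mul, smul_smul, det_mul_det,
        one_smul]

end Derivations

section Half

variable {R : Type*} [CommRing R] [Algebra ℝ R]

theorem algebraMap_half_add : algebraMap ℝ R (1 / 2) + algebraMap ℝ R (1 / 2) = 1 := by
  rw [← map_add]; norm_num

theorem eq_of_two_mul_eq {a b : R} (h : 2 * a = 2 * b) : a = b := by
  linear_combination algebraMap ℝ R (1 / 2) * h + (b - a) * algebraMap_half_add (R := R)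

/-- For a real matrix `g` of any signature the hypothesis on `w` holds for `w = √|det g|`. -/
theorem derivation_sqrt_det (D : Derivation ℝ R R) {κ : Type*} [Fintype κ] [DecidableEq κ]
    {g gi : Matrix κ κ R} (h : g * gi = 1) {w : R} (hw : w ^ 4 = g.det ^ 2) :
    2 * D w = w * (gi * matDer D g).trace := by
  have det_mul_det : g.det * gi.det = 1 := by rw [← Matrix.det_mul, h, Matrix.det_one]
  rw [← smul_adjugate_of_mul_eq_one h, Matrix.smul_mul, Matrix.trace_smul, ← derivation_det,
    smul_eq_mul]
  have deriv_hw : 2 * D w * w ^ 3 = g.det * D g.det := by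
    have hD := congrArg D hw
    simp only [Derivation.leibniz_pow, smul_eq_mul, nsmul_eq_mul] at hD
    norm_num at hD
    exact eq_of_two_mul_eq (by linear_combination hD)
  have w_unit : w ^ 4 * gi.det ^ 2 = 1 := by rw [hw, ← mul_pow, det_mul_det, one_pow]
  linear_combination w * gi.det ^ 2 * deriv_hw - 2 * D w * w_unit
    + w * gi.det * D g.det * det_mul_det

end Half

section LeviCivita

variable {k R : Type*} [CommRing k] [CommRing R] [Algebra k R] {ι : Type*}

/-- The curvature `R_{μν} = ∂_μ Γ_ν - ∂_ν Γ_μ + [Γ_μ, Γ_ν]` of the connection with matrices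
`Γ_μ = (Γ^κ_{ρμ})_{κρ}`, as a matrix in the upper and the first lower index. -/
def curvatureMat [Fintype ι] (d : ι → Derivation k R R) (Γ : ι → Matrix ι ι R) (μ ν : ι) :
    Matrix ι ι R :=
  matDer (d μ) (Γ ν) - matDer (d ν) (Γ μ) + (Γ μ * Γ ν - Γ ν * Γ μ)

/-- `R^{κτ}_{μν}` as a matrix in `κ` and `τ`. -/
def curvatureUpMat [Fintype ι] (d : ι → Derivation k R R) (gi : Matrix ι ι R)
    (Γ : ι → Matrix ι ι R) (μ ν : ι) : Matrix ι ι R :=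
  curvatureMat d Γ μ ν * gi

/-- The covariant derivative `∇_μ X^{κτ}` of a tensor with two upper indices. -/
def covDer [Fintype ι] (d : ι → Derivation k R R) (Γ : ι → Matrix ι ι R) (μ : ι)
    (X : Matrix ι ι R) : Matrix ι ι R :=
  matDer (d μ) X + (Γ μ * X + X * (Γ μ)ᵀ)

variable [Fintype ι] [DecidableEq ι]

/-- The matrices `Γ μ = (Γ^κ_{ρμ})_{κρ}` are those of the Levi-Civita connection of the metric `g`
with inverse `gi`, for the commuting derivations `d μ` in the role of the partial derivatives. -/
structure IsLeviCivita (d : ι → Derivation k R R) (g gi : Matrix ι ι R)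
    (Γ : ι → Matrix ι ι R) : Prop where
  comm : ∀ i j f, d i (d j f) = d j (d i f)
  symm : g.IsSymm
  mul_inv : g * gi = 1
  torsion : ∀ μ κ ρ, Γ μ κ ρ = Γ ρ κ μ
  compat : ∀ μ, matDer (d μ) g = (Γ μ)ᵀ * g + g * Γ μ

namespace IsLeviCivita

variable {d : ι → Derivation k R R} {g gi : Matrix ι ι R} {Γ : ι → Matrix ι ι R}

theorem inv_mul (H : IsLeviCivita d g gi Γ) : gi * g = 1 := mul_eq_one_comm.mp H.mul_inv

theorem inv_symm (H : IsLeviCivita d g gi Γ) : gi.IsSymm := by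
  rw [← Matrix.inv_eq_right_inv H.mul_inv]
  exact H.symm.inv

theorem matDer_inv (H : IsLeviCivita d g gi Γ) (μ : ι) :
    matDer (d μ) gi = -(Γ μ * gi + gi * (Γ μ)ᵀ) := by
  rw [matDer_inverse _ H.mul_inv, H.compat, mul_add, add_mul, mul_assoc, mul_assoc, H.mul_inv,
    mul_one, ← mul_assoc, H.inv_mul, one_mul, add_comm]

theorem covDer_mul_inv (H : IsLeviCivita d g gi Γ) (μ : ι)
    (M : Matrix ι ι R) :
    covDer d Γ μ (M * gi) = (matDer (d μ) M + Γ μ * M - M * Γ μ) * gi := by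
  rw [covDer, matDer_mul, H.matDer_inv]
  noncomm_ring

theorem matDer_comm (H : IsLeviCivita d g gi Γ) (μ ν : ι) (M : Matrix ι ι R) :
    matDer (d μ) (matDer (d ν) M) = matDer (d ν) (matDer (d μ) M) := by
  ext i j
  exact H.comm _ _ _

theorem transpose_curvatureUpMat (H : IsLeviCivita d g gi Γ) (μ ν : ι) :
    (curvatureUpMat d gi Γ μ ν)ᵀ = -curvatureUpMat d gi Γ μ ν := by
  have second_derivs := H.matDer_comm μ ν gi
  rw [H.matDer_inv ν, H.matDer_inv μ] at second_derivs
  simp only [matDer_neg, matDer_add, matDer_mul, matDer_transpose, H.matDer_inv] at second_derivs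
  rw [curvatureUpMat, Matrix.transpose_mul, H.inv_symm.eq, eq_neg_iff_add_eq_zero]
  simp only [curvatureMat, Matrix.transpose_add, Matrix.transpose_sub, Matrix.transpose_mul]
  rw [← sub_eq_zero] at second_derivs
  rw [← neg_eq_zero, ← second_derivs]
  noncomm_ring

theorem bianchi (H : IsLeviCivita d g gi Γ) (α β γ : ι) :
    covDer d Γ α (curvatureUpMat d gi Γ β γ) + covDer d Γ β (curvatureUpMat d gi Γ γ α)
      + covDer d Γ γ (curvatureUpMat d gi Γ α β) = 0 := by
  simp only [curvatureUpMat]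
  rw [H.covDer_mul_inv, H.covDer_mul_inv, H.covDer_mul_inv, ← add_mul, ← add_mul]
  convert zero_mul gi
  simp only [curvatureMat, matDer_add, matDer_sub, matDer_mul]
  rw [H.matDer_comm β α, H.matDer_comm γ β, H.matDer_comm γ α]
  noncomm_ring

theorem derivation_curvatureUpMat (H : IsLeviCivita d g gi Γ) (D : Derivation k R R)
    (hD : ∀ i f, D (d i f) = d i (D f)) (μ ν : ι) :
    matDer D (curvatureUpMat d gi Γ μ ν) = covDer d Γ μ (matDer D (Γ ν) * gi)
      - covDer d Γ ν (matDer D (Γ μ) * gi) - curvatureUpMat d gi Γ μ ν * (matDer D g * gi) := by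
  have commute : ∀ i (M : Matrix ι ι R),
      matDer D (matDer (d i) M) = matDer (d i) (matDer D M) := by
    intro i M
    ext
    exact hD _ _
  simp only [curvatureUpMat]
  rw [H.covDer_mul_inv, H.covDer_mul_inv, matDer_mul, matDer_inverse D H.mul_inv]
  simp only [curvatureMat, matDer_add, matDer_sub, matDer_mul, commute]
  noncomm_ring

end IsLeviCivita

end LeviCivita

section Christoffel

variable {R : Type*} [CommRing R] [Algebra ℝ R] {ι : Type*} [Fintype ι]

/-- The matrix in `κ` and `ρ` of the Christoffel symbols
`Γ^κ_{ρσ} = ½ g^{κλ} (∂_ρ g_{λσ} + ∂_σ g_{λρ} - ∂_λ g_{ρσ})`. -/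
def christoffelMat (d : ι → Derivation ℝ R R) (g gi : Matrix ι ι R) (σ : ι) : Matrix ι ι R :=
  Matrix.of fun κ ρ => algebraMap ℝ R (1 / 2) *
    ∑ l, gi κ l * (d ρ (g l σ) + d σ (g l ρ) - d l (g ρ σ))

/-- The Christoffel symbols of the first kind,
`Γ_{λρσ} = ½ (∂_ρ g_{λσ} + ∂_σ g_{λρ} - ∂_λ g_{ρσ})`, as a matrix in `λ` and `ρ`. -/
def christoffelFirstMat (d : ι → Derivation ℝ R R) (g : Matrix ι ι R) (σ : ι) : Matrix ι ι R :=
  Matrix.of fun l ρ => algebraMap ℝ R (1 / 2) * (d ρ (g l σ) + d σ (g l ρ) - d l (g ρ σ))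

theorem christoffelMat_eq_mul (d : ι → Derivation ℝ R R) (g gi : Matrix ι ι R) (σ : ι) :
    christoffelMat d g gi σ = gi * christoffelFirstMat d g σ := by
  ext κ ρ
  simp only [christoffelMat, christoffelFirstMat, Matrix.of_apply, Matrix.mul_apply,
    Finset.mul_sum]
  exact Finset.sum_congr rfl fun l _ => by ring

variable [DecidableEq ι] {d : ι → Derivation ℝ R R} {g gi : Matrix ι ι R}

theorem isLeviCivita_christoffelMat (hd : ∀ i j f, d i (d j f) = d j (d i f)) (hg : g.IsSymm)
    (h : g * gi = 1) : IsLeviCivita d g gi (christoffelMat d g gi) where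
  comm := hd
  symm := hg
  mul_inv := h
  torsion μ κ ρ := by
    simp only [christoffelMat, Matrix.of_apply]
    congr 1
    refine Finset.sum_congr rfl fun l _ => ?_
    rw [hg.apply ρ μ]
    ring
  compat μ := by
    have lower : g * christoffelMat d g gi μ = christoffelFirstMat d g μ := by
      rw [christoffelMat_eq_mul, ← mul_assoc, h, one_mul]
    have lower_transpose : (christoffelMat d g gi μ)ᵀ * g = (christoffelFirstMat d g μ)ᵀ := by
      rw [← lower, Matrix.transpose_mul, hg.eq]
    rw [lower, lower_transpose]
    ext i j
    simp only [matDer_apply, Matrix.add_apply, Matrix.transpose_apply, christoffelFirstMat,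
      Matrix.of_apply, hg.apply i j]
    linear_combination (-d μ (g i j)) * algebraMap_half_add (R := R)

namespace IsLeviCivita

variable {Γ : ι → Matrix ι ι R}

theorem mul_eq_christoffelFirstMat (H : IsLeviCivita d g gi Γ) (σ : ι) :
    g * Γ σ = christoffelFirstMat d g σ := by
  have symm_lower : ∀ σ l ρ, (g * Γ σ) l ρ = (g * Γ ρ) l σ := by
    intro σ l ρ
    simp only [Matrix.mul_apply]
    exact Finset.sum_congr rfl fun κ _ => by rw [H.torsion]
  have compat_lower : ∀ σ l ρ, d σ (g l ρ) = (g * Γ σ) ρ l + (g * Γ σ) l ρ := by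
    intro σ l ρ
    have transpose_lower : (Γ σ)ᵀ * g = (g * Γ σ)ᵀ := by rw [Matrix.transpose_mul, H.symm.eq]
    have compat_apply := congrFun (congrFun (H.compat σ) l) ρ
    rwa [transpose_lower] at compat_apply
  ext l ρ
  rw [christoffelFirstMat, Matrix.of_apply, compat_lower, compat_lower, compat_lower,
    symm_lower ρ σ l, symm_lower ρ l σ, symm_lower l ρ σ]
  linear_combination (-((g * Γ σ) l ρ)) * algebraMap_half_add (R := R)

theorem eq_christoffelMat (H : IsLeviCivita d g gi Γ) : Γ = christoffelMat d g gi := by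
  funext σ
  rw [christoffelMat_eq_mul, ← H.mul_eq_christoffelFirstMat, ← mul_assoc, H.inv_mul, one_mul]

theorem derivation_sqrt_det (H : IsLeviCivita d g gi Γ) {w : R} (hw : w ^ 4 = g.det ^ 2)
    (μ : ι) : d μ w = w * (Γ μ).trace := by
  have trace_log_deriv : (gi * matDer (d μ) g).trace = 2 * (Γ μ).trace := by
    rw [H.compat, mul_add, Matrix.trace_add, Matrix.trace_mul_comm, mul_assoc, H.mul_inv, mul_one,
      Matrix.trace_transpose, ← mul_assoc, H.inv_mul, one_mul, two_mul]
  have two_mul_deriv := Lovelock.derivation_sqrt_det (d μ) H.mul_inv hw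
  rw [trace_log_deriv] at two_mul_deriv
  exact eq_of_two_mul_eq (by linear_combination two_mul_deriv)

end IsLeviCivita

end Christoffel

/-! ### Contraction with the generalized Kronecker delta -/

theorem update_update_eq_update_comp_swap {κ ι : Type*} [DecidableEq κ] (A : κ → ι) {a o : κ}
    (h : a ≠ o) (x : ι) :
    Function.update (Function.update A o x) a (A o) = Function.update A a x ∘ Equiv.swap a o := by
  ext i
  by_cases hia : i = a
  · subst hia; simp [Function.update_of_ne (Ne.symm h)]
  · by_cases hio : i = o
    · subst hio; simp [Function.update_of_ne hia]
    · simp [Function.update_of_ne hia, Function.update_of_ne hio,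
        Equiv.swap_apply_of_ne_of_ne hia hio]

section Contraction

variable {R : Type*} [CommRing R] [Algebra ℝ R] {m : ℕ} {κ : Type*} [Fintype κ] [DecidableEq κ]

theorem eq_zero_of_eq_neg {a : R} (h : a = -a) : a = 0 := by
  linear_combination algebraMap ℝ R (1 / 2) * h - a * algebraMap_half_add (R := R)

theorem sum_update_swap {ι S : Type*} [Fintype ι] [AddCommMonoid S] (b : κ)
    (f : (κ → ι) → ι → S) :
    ∑ B, ∑ x, f B x = ∑ B, ∑ x, f (Function.update B b x) (B b) := by
  let e : (κ → ι) × ι ≃ (κ → ι) × ι :=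
    { toFun := fun p => (Function.update p.1 b p.2, p.1 b)
      invFun := fun p => (Function.update p.1 b p.2, p.1 b)
      left_inv := fun p => by simp
      right_inv := fun p => by simp }
  rw [← Fintype.sum_prod_type', ← Fintype.sum_prod_type', ← Equiv.sum_comp e]
  rfl

/-- The full contraction of `Z` with the generalized Kronecker delta. -/
def krSum (Z : (κ → Fin m) → (κ → Fin m) → R) : R :=
  ∑ A, ∑ B, algebraMap ℝ R (kronecker A B) * Z A B

theorem krSum_add (Z Z' : (κ → Fin m) → (κ → Fin m) → R) :
    krSum (fun A B => Z A B + Z' A B) = krSum Z + krSum Z' := by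
  simp only [krSum, mul_add, Finset.sum_add_distrib]

theorem krSum_sub (Z Z' : (κ → Fin m) → (κ → Fin m) → R) :
    krSum (fun A B => Z A B - Z' A B) = krSum Z - krSum Z' := by
  simp only [krSum, mul_sub, Finset.sum_sub_distrib]

theorem krSum_neg (Z : (κ → Fin m) → (κ → Fin m) → R) :
    krSum (fun A B => -Z A B) = -krSum Z := by
  simp only [krSum, mul_neg, Finset.sum_neg_distrib]

theorem krSum_mul_left (c : R) (Z : (κ → Fin m) → (κ → Fin m) → R) :
    krSum (fun A B => c * Z A B) = c * krSum Z := by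
  simp only [krSum, Finset.mul_sum]
  exact Finset.sum_congr rfl fun A _ => Finset.sum_congr rfl fun B _ => by ring

theorem krSum_sum {ι : Type*} (s : Finset ι) (Z : ι → (κ → Fin m) → (κ → Fin m) → R) :
    krSum (fun A B => ∑ i ∈ s, Z i A B) = ∑ i ∈ s, krSum (Z i) := by
  simp only [krSum, Finset.mul_sum]
  rw [Finset.sum_comm]
  rw [Finset.sum_congr rfl fun A _ => Finset.sum_comm]
  rw [Finset.sum_comm]
  exact Finset.sum_congr rfl fun i _ => Finset.sum_comm

theorem krSum_comp_perm (e : Equiv.Perm κ) (Z : (κ → Fin m) → (κ → Fin m) → R) :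
    krSum (fun A B => Z (A ∘ e) B) = ((Equiv.Perm.sign e : ℤ) : R) * krSum Z := by
  have sign_mul_self : ((Equiv.Perm.sign e : ℤ) : R) * ((Equiv.Perm.sign e : ℤ) : R) = 1 := by
    rw [← Int.cast_mul, ← Units.val_mul, Int.units_mul_self, Units.val_one, Int.cast_one]
  have kronecker_eq : ∀ A B : κ → Fin m, algebraMap ℝ R (kronecker A B)
      = ((Equiv.Perm.sign e : ℤ) : R) * algebraMap ℝ R (kronecker (A ∘ e) B) := by
    intro A B
    rw [kronecker_comp_perm, map_mul, map_intCast, ← mul_assoc, sign_mul_self, one_mul]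
  rw [krSum, krSum, Finset.mul_sum]
  conv_rhs => rw [← Equiv.sum_comp (e.symm.arrowCongr (Equiv.refl (Fin m)))]
  refine Finset.sum_congr rfl fun A _ => ?_
  rw [Finset.mul_sum]
  refine Finset.sum_congr rfl fun B _ => ?_
  rw [kronecker_eq, mul_assoc]
  rfl

theorem krSum_flip (Z : (κ → Fin m) → (κ → Fin m) → R) :
    krSum (fun A B => Z B A) = krSum Z := by
  rw [krSum, krSum, Finset.sum_comm]
  simp_rw [kronecker_comm]

theorem krSum_comp_perm_right (e : Equiv.Perm κ) (Z : (κ → Fin m) → (κ → Fin m) → R) :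
    krSum (fun A B => Z A (B ∘ e)) = ((Equiv.Perm.sign e : ℤ) : R) * krSum Z := by
  rw [← krSum_flip, krSum_comp_perm e fun A B => Z B A, krSum_flip]

theorem krSum_comp_swap {a b : κ} (h : a ≠ b) (Z : (κ → Fin m) → (κ → Fin m) → R) :
    krSum (fun A B => Z (A ∘ Equiv.swap a b) B) = -krSum Z := by
  rw [krSum_comp_perm, Equiv.Perm.sign_swap h]; simp

theorem krSum_comp_swap_right {a b : κ} (h : a ≠ b) (Z : (κ → Fin m) → (κ → Fin m) → R) :
    krSum (fun A B => Z A (B ∘ Equiv.swap a b)) = -krSum Z := by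
  rw [krSum_comp_perm_right, Equiv.Perm.sign_swap h]; simp

theorem krSum_comp_equiv {κ' : Type*} [Fintype κ'] [DecidableEq κ'] (e : κ' ≃ κ)
    (Z : (κ' → Fin m) → (κ' → Fin m) → R) :
    krSum (fun A B : κ → Fin m => Z (A ∘ e) (B ∘ e)) = krSum Z := by
  rw [krSum, krSum, ← Equiv.sum_comp (e.symm.arrowCongr (Equiv.refl (Fin m)))]
  refine Finset.sum_congr rfl fun A _ => ?_
  rw [← Equiv.sum_comp (e.symm.arrowCongr (Equiv.refl (Fin m)))]
  refine Finset.sum_congr rfl fun B _ => ?_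
  rw [← kronecker_comp_equiv e]
  rfl

theorem krSum_eq_zero_of_cyclic {c : Equiv.Perm κ} (hc : Equiv.Perm.sign c = 1)
    (Z : (κ → Fin m) → (κ → Fin m) → R)
    (hZ : ∀ A B, Z A B + Z (A ∘ c) B + Z (A ∘ c ∘ c) B = 0) :
    krSum Z = 0 := by
  have rotate : ∀ Y : (κ → Fin m) → (κ → Fin m) → R,
      krSum (fun A B => Y (A ∘ c) B) = krSum Y := by
    intro Y
    simp [krSum_comp_perm, hc]
  have rotate_twice : krSum (fun A B => Z (A ∘ c ∘ c) B) = krSum Z :=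
    (rotate fun A B => Z (A ∘ c) B).trans (rotate Z)
  have sum_rotations : krSum Z + krSum Z + krSum Z = 0 := by
    calc krSum Z + krSum Z + krSum Z
        = krSum fun A B => Z A B + Z (A ∘ c) B + Z (A ∘ c ∘ c) B := by
          rw [krSum_add, krSum_add, rotate, rotate_twice]
      _ = 0 := Finset.sum_eq_zero fun A _ => Finset.sum_eq_zero fun B _ => by
          simp only [hZ, mul_zero]
  have third_mul_three : algebraMap ℝ R (1 / 3) * 3 = 1 := by
    rw [← map_ofNat (algebraMap ℝ R) 3, ← map_mul]; norm_num
  linear_combination algebraMap ℝ R (1 / 3) * sum_rotations - krSum Z * third_mul_three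

theorem sum_kronecker_mul_sum_update (G : Fin m → Fin m → R) (A : κ → Fin m)
    (z : (κ → Fin m) → R) :
    ∑ B, algebraMap ℝ R (kronecker A B) * ∑ b, ∑ l, G (B b) l * z (Function.update B b l)
      = ∑ B, ∑ a, ∑ x, algebraMap ℝ R (kronecker (Function.update A a x) B) * (G (A a) x * z B)
      := by
  calc _ = ∑ B, ∑ b, ∑ x,
        algebraMap ℝ R (kronecker A (Function.update B b x)) * G x (B b) * z B := by
        simp only [Finset.mul_sum]
        rw [Finset.sum_comm, Finset.sum_congr rfl fun b _ => sum_update_swap b _, Finset.sum_comm]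
        simp only [Function.update_self, Function.update_idem, Function.update_eq_self, mul_assoc]
    _ = _ := by
        refine Finset.sum_congr rfl fun B _ => ?_
        simp only [← mul_assoc, ← Finset.sum_mul]
        rw [sum_kronecker_update G A B]

section SymmetricConnection

variable {Γ : Fin m → Matrix (Fin m) (Fin m) R} (hΓ : ∀ μ κ ρ, Γ μ κ ρ = Γ ρ κ μ) {o : κ}
  {z : (κ → Fin m) → R} (hz : ∀ A x, z (Function.update A o x) = z A) (B : κ → Fin m)

include hΓ hz

theorem sum_kronecker_update_mul_connection_self :
    ∑ A : κ → Fin m, ∑ x,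
        algebraMap ℝ R (kronecker (Function.update A o x) B) * (Γ (A o) (A o) x * z A)
      = ∑ A, algebraMap ℝ R (kronecker A B) * ((Γ (A o)).trace * z A) := by
  rw [sum_update_swap o]
  refine Finset.sum_congr rfl fun A _ => ?_
  rw [Matrix.trace, Finset.sum_mul, Finset.mul_sum]
  refine Finset.sum_congr rfl fun x _ => ?_
  simp only [hz, Function.update_idem, Function.update_eq_self, Function.update_self,
    Matrix.diag_apply]
  rw [hΓ x]

/-- The deltas are antisymmetric in the positions `a` and `o`, the connection is symmetric. -/
theorem sum_kronecker_update_mul_connection_of_ne {a : κ} (h : a ≠ o) :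
    ∑ A : κ → Fin m, ∑ x,
        algebraMap ℝ R (kronecker (Function.update A a x) B) * (Γ (A o) (A a) x * z A) = 0 := by
  refine eq_zero_of_eq_neg ?_
  conv_lhs => rw [sum_update_swap o]
  simp only [← Finset.sum_neg_distrib]
  refine Finset.sum_congr rfl fun A _ => Finset.sum_congr rfl fun x _ => ?_
  simp only [hz, Function.update_self, Function.update_of_ne h]
  rw [hΓ x, update_update_eq_update_comp_swap A h, kronecker_comp_swap h, map_neg, neg_mul]

end SymmetricConnection

/-- The position `o` is that of a differentiation index: only its term survives in the sum of the
terms which the connection contributes to the upper indices of `Z`. -/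
theorem krSum_connection {Γ : Fin m → Matrix (Fin m) (Fin m) R}
    (hΓ : ∀ μ κ ρ, Γ μ κ ρ = Γ ρ κ μ) (o : κ) (Z : (κ → Fin m) → (κ → Fin m) → R)
    (hZ : ∀ A x B, Z (Function.update A o x) B = Z A B) :
    krSum (fun A B => ∑ b, ∑ l, Γ (A o) (B b) l * Z A (Function.update B b l))
      = krSum fun A B => (Γ (A o)).trace * Z A B := by
  calc _ = ∑ B, ∑ a, ∑ A : κ → Fin m, ∑ x,
        algebraMap ℝ R (kronecker (Function.update A a x) B) * (Γ (A o) (A a) x * Z A B) := by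
        rw [krSum, Finset.sum_congr rfl fun A _ =>
          sum_kronecker_mul_sum_update (Γ (A o)) A (Z A), Finset.sum_comm]
        exact Finset.sum_congr rfl fun B _ => Finset.sum_comm
    _ = ∑ B, ∑ A : κ → Fin m, algebraMap ℝ R (kronecker A B) * ((Γ (A o)).trace * Z A B) := by
        refine Finset.sum_congr rfl fun B _ => ?_
        rw [Fintype.sum_eq_single o fun a ha =>
            sum_kronecker_update_mul_connection_of_ne hΓ (fun A x => hZ A x B) B ha,
          sum_kronecker_update_mul_connection_self hΓ (fun A x => hZ A x B) B]
    _ = _ := Finset.sum_comm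

end Contraction

/-! ### Contractions of products of curvatures and the first variation -/

section Blocks

variable {R : Type*} {m r : ℕ}

/-- The family of matrices `X_{αβ}` with the pairs of indices given by `A`. -/
def blocks (X : Fin m → Fin m → Matrix (Fin m) (Fin m) R) (A : Fin r × Fin 2 → Fin m) :
    Fin r → Matrix (Fin m) (Fin m) R :=
  fun j => X (A (j, 0)) (A (j, 1))

theorem blocks_swap (X : Fin m → Fin m → Matrix (Fin m) (Fin m) R) (k : Fin r)
    (A : Fin r × Fin 2 → Fin m) (M : Matrix (Fin m) (Fin m) R) :
    Function.update (blocks X (A ∘ Equiv.swap (k, 0) (k, 1))) k M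
      = Function.update (blocks X A) k M := by
  ext i : 1
  by_cases h : i = k
  · subst h; simp
  · rw [Function.update_of_ne h, Function.update_of_ne h]
    simp [blocks, Equiv.swap_apply_of_ne_of_ne, h]

variable [CommRing R]

/-- The product of the entries of the matrices `Q j` at the pairs of indices given by `B`. -/
def blockProd (Q : Fin r → Matrix (Fin m) (Fin m) R) (B : Fin r × Fin 2 → Fin m) : R :=
  ∏ j, Q j (B (j, 0)) (B (j, 1))

theorem blockProd_update (Q : Fin r → Matrix (Fin m) (Fin m) R) (j : Fin r)
    (M : Matrix (Fin m) (Fin m) R) (B : Fin r × Fin 2 → Fin m) :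
    blockProd (Function.update Q j M) B
      = M (B (j, 0)) (B (j, 1)) * ∏ i ∈ Finset.univ.erase j, Q i (B (i, 0)) (B (i, 1)) := by
  rw [blockProd, ← Finset.mul_prod_erase _ _ (Finset.mem_univ j)]
  congr 1
  · rw [Function.update_self]
  · refine Finset.prod_congr rfl fun i hi => ?_
    rw [Function.update_of_ne (Finset.ne_of_mem_erase hi)]

theorem blockProd_eq (Q : Fin r → Matrix (Fin m) (Fin m) R) (j : Fin r)
    (B : Fin r × Fin 2 → Fin m) :
    blockProd Q B
      = Q j (B (j, 0)) (B (j, 1)) * ∏ i ∈ Finset.univ.erase j, Q i (B (i, 0)) (B (i, 1)) := by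
  rw [← blockProd_update, Function.update_eq_self]

theorem blockProd_update_sub (Q : Fin r → Matrix (Fin m) (Fin m) R) (j : Fin r)
    (M N : Matrix (Fin m) (Fin m) R) (B : Fin r × Fin 2 → Fin m) :
    blockProd (Function.update Q j (M - N)) B
      = blockProd (Function.update Q j M) B - blockProd (Function.update Q j N) B := by
  simp only [blockProd_update, Matrix.sub_apply]
  ring

theorem prod_erase_update (Q : Fin r → Matrix (Fin m) (Fin m) R) (j : Fin r) (c : Fin 2)
    (B : Fin r × Fin 2 → Fin m) (x : Fin m) :
    ∏ i ∈ Finset.univ.erase j, Q i (Function.update B (j, c) x (i, 0))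
        (Function.update B (j, c) x (i, 1))
      = ∏ i ∈ Finset.univ.erase j, Q i (B (i, 0)) (B (i, 1)) := by
  refine Finset.prod_congr rfl fun i hi => ?_
  have ne : ∀ c', (i, c') ≠ (j, c) := fun c' h => Finset.ne_of_mem_erase hi (congrArg Prod.fst h)
  rw [Function.update_of_ne (ne 0), Function.update_of_ne (ne 1)]

theorem blockProd_update_fst (Q : Fin r → Matrix (Fin m) (Fin m) R) (j : Fin r)
    (B : Fin r × Fin 2 → Fin m) (x : Fin m) :
    blockProd Q (Function.update B (j, 0) x)
      = Q j x (B (j, 1)) * ∏ i ∈ Finset.univ.erase j, Q i (B (i, 0)) (B (i, 1)) := by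
  rw [blockProd_eq Q j, prod_erase_update, Function.update_self,
    Function.update_of_ne (by simp : (j, (1 : Fin 2)) ≠ (j, 0))]

theorem blockProd_update_snd (Q : Fin r → Matrix (Fin m) (Fin m) R) (j : Fin r)
    (B : Fin r × Fin 2 → Fin m) (x : Fin m) :
    blockProd Q (Function.update B (j, 1) x)
      = Q j (B (j, 0)) x * ∏ i ∈ Finset.univ.erase j, Q i (B (i, 0)) (B (i, 1)) := by
  rw [blockProd_eq Q j, prod_erase_update, Function.update_self,
    Function.update_of_ne (by simp : (j, (0 : Fin 2)) ≠ (j, 1))]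

section Derivation

variable {k : Type*} [CommRing k] [Algebra k R]

theorem derivation_blockProd (D : Derivation k R R) (Q : Fin r → Matrix (Fin m) (Fin m) R)
    (B : Fin r × Fin 2 → Fin m) :
    D (blockProd Q B) = ∑ j, blockProd (Function.update Q j (matDer D (Q j))) B := by
  rw [blockProd, derivation_prod]
  refine Finset.sum_congr rfl fun j _ => Finset.prod_congr rfl fun i _ => ?_
  by_cases h : i = j
  · subst h; simp
  · simp [h]

theorem covDer_blockProd (d : Fin m → Derivation k R R)
    (Γ : Fin m → Matrix (Fin m) (Fin m) R) (μ : Fin m) (Q : Fin r → Matrix (Fin m) (Fin m) R)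
    (B : Fin r × Fin 2 → Fin m) :
    d μ (blockProd Q B) + ∑ b, ∑ l, Γ μ (B b) l * blockProd Q (Function.update B b l)
      = ∑ j, blockProd (Function.update Q j (covDer d Γ μ (Q j))) B := by
  rw [derivation_blockProd, Fintype.sum_prod_type, ← Finset.sum_add_distrib]
  refine Finset.sum_congr rfl fun j _ => ?_
  simp only [Fin.sum_univ_two, blockProd_update_fst, blockProd_update_snd, blockProd_update,
    covDer, Matrix.add_apply, Matrix.mul_apply, Matrix.transpose_apply, add_mul, Finset.sum_mul]
  congr 1
  congr 1
  · exact Finset.sum_congr rfl fun l _ => by ring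
  · exact Finset.sum_congr rfl fun l _ => by ring

end Derivation

variable [Algebra ℝ R]

/-- The contraction `δ^{α₁β₁…}_{λ₁θ₁…} X^{λ₁θ₁}_{α₁β₁} ⋯`. -/
def lovScalar (r : ℕ) (X : Fin m → Fin m → Matrix (Fin m) (Fin m) R) : R :=
  krSum fun A B : Fin r × Fin 2 → Fin m => blockProd (blocks X A) B

/-- The contraction `δ^{μ α₁β₁…}_{ρ λ₁θ₁…} X^{λ₁θ₁}_{α₁β₁} ⋯`. -/
def lovMixed (r : ℕ) (X : Fin m → Fin m → Matrix (Fin m) (Fin m) R) :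
    Matrix (Fin m) (Fin m) R :=
  Matrix.of fun μ ρ => ∑ A : Fin r × Fin 2 → Fin m, ∑ B : Fin r × Fin 2 → Fin m,
    algebraMap ℝ R (kronecker (fun o : Option (Fin r × Fin 2) => o.elim μ A) fun o => o.elim ρ B)
      * blockProd (blocks X A) B

/-- The Lovelock tensor of the curvature `X`, with its first index raised by `gi`. -/
def lovTensor (r : ℕ) (X : Fin m → Fin m → Matrix (Fin m) (Fin m) R)
    (gi : Matrix (Fin m) (Fin m) R) : Matrix (Fin m) (Fin m) R :=
  lovMixed r X * gi + (lovMixed r X * gi)ᵀ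

/-- The contraction in which, at the position `b`, the index of the curvature is `μ` and that of the
generalized Kronecker delta is `ρ`. -/
def lovPartial (X : Fin m → Fin m → Matrix (Fin m) (Fin m) R) (b : Fin r × Fin 2) :
    Matrix (Fin m) (Fin m) R :=
  Matrix.of fun μ ρ => krSum fun A B : Fin r × Fin 2 → Fin m =>
    if B b = ρ then blockProd (blocks X A) (Function.update B b μ) else 0

theorem lovPartial_eq_sum (X : Fin m → Fin m → Matrix (Fin m) (Fin m) R) (b : Fin r × Fin 2)
    (μ ρ : Fin m) :
    lovPartial X b μ ρ = ∑ A, ∑ B,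
      algebraMap ℝ R ((if μ = B b then 1 else 0) * kronecker A (Function.update B b ρ))
        * blockProd (blocks X A) B := by
  refine Finset.sum_congr rfl fun A _ => ?_
  calc _ = ∑ B : Fin r × Fin 2 → Fin m, ∑ x, if B b = ρ ∧ x = μ then
        algebraMap ℝ R (kronecker A B) * blockProd (blocks X A) (Function.update B b x) else 0 := by
        refine Finset.sum_congr rfl fun B _ => ?_
        by_cases h : B b = ρ <;> simp [h]
    _ = _ := by
        rw [sum_update_swap b]
        refine Finset.sum_congr rfl fun B _ => ?_
        by_cases h : μ = B b
        · simp [h]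
        · simp [h, Ne.symm h]

theorem lovMixed_eq_sub (X : Fin m → Fin m → Matrix (Fin m) (Fin m) R) :
    lovMixed r X = lovScalar r X • 1 - ∑ b : Fin r × Fin 2, lovPartial X b := by
  ext μ ρ
  have diagonal : (lovScalar r X • (1 : Matrix (Fin m) (Fin m) R)) μ ρ
      = ∑ A : Fin r × Fin 2 → Fin m, ∑ B, algebraMap ℝ R ((if μ = ρ then 1 else 0) * kronecker A B)
        * blockProd (blocks X A) B := by
    rw [Matrix.smul_apply, Matrix.one_apply]
    split_ifs <;> simp [lovScalar, krSum]
  rw [Matrix.sub_apply, Matrix.sum_apply, diagonal]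
  simp only [lovPartial_eq_sum]
  rw [lovMixed, Matrix.of_apply, Finset.sum_comm (s := (Finset.univ : Finset (Fin r × Fin 2))),
    ← Finset.sum_sub_distrib]
  refine Finset.sum_congr rfl fun A _ => ?_
  rw [Finset.sum_comm (s := (Finset.univ : Finset (Fin r × Fin 2))), ← Finset.sum_sub_distrib]
  refine Finset.sum_congr rfl fun B _ => ?_
  rw [kronecker_option, map_sub, map_sum, sub_mul, Finset.sum_mul]

theorem lovPartial_fst (X : Fin m → Fin m → Matrix (Fin m) (Fin m) R)
    (hX : ∀ α β, (X α β)ᵀ = -X α β) (k : Fin r) :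
    lovPartial X (k, 0) = lovPartial X (k, 1) := by
  ext μ ρ
  have hne : ((k, 0) : Fin r × Fin 2) ≠ (k, 1) := by simp
  rw [← neg_inj, lovPartial, lovPartial, Matrix.of_apply, Matrix.of_apply,
    ← krSum_comp_swap_right hne, ← krSum_neg]
  congr 1
  ext A B
  simp only [Function.comp_apply, Equiv.swap_apply_left]
  split_ifs with h
  · have antisymm : blocks X A k (B (k, 0)) μ = -blocks X A k μ (B (k, 0)) :=
      congrFun (congrFun (hX (A (k, 0)) (A (k, 1))) μ) (B (k, 0))
    rw [blockProd_update_fst, blockProd_update_snd, antisymm, neg_mul, neg_neg,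
      Function.comp_apply, Equiv.swap_apply_right]
    congr 1
    refine Finset.prod_congr rfl fun i hi => ?_
    simp [Equiv.swap_apply_of_ne_of_ne, Finset.ne_of_mem_erase hi]
  · simp

theorem lovMixed_eq (X : Fin m → Fin m → Matrix (Fin m) (Fin m) R)
    (hX : ∀ α β, (X α β)ᵀ = -X α β) :
    lovMixed r X = lovScalar r X • 1 - (2 : R) • ∑ k : Fin r, lovPartial X (k, 1) := by
  simp only [lovMixed_eq_sub, Fintype.sum_prod_type, Fin.sum_univ_two, lovPartial_fst X hX,
    two_smul, Finset.sum_add_distrib]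

theorem trace_mul_lovMixed (X : Fin m → Fin m → Matrix (Fin m) (Fin m) R)
    (hX : ∀ α β, (X α β)ᵀ = -X α β) (N : Matrix (Fin m) (Fin m) R) :
    (N * (lovMixed r X)ᵀ).trace
      = lovScalar r X * N.trace - 2 * ∑ k : Fin r, (N * (lovPartial X (k, 1))ᵀ).trace := by
  simp only [lovMixed_eq X hX, Matrix.transpose_sub, Matrix.transpose_smul, Matrix.transpose_one,
    Matrix.transpose_sum, mul_sub, Matrix.mul_smul, mul_one, Finset.mul_sum, Matrix.trace_sub,
    Matrix.trace_smul, Matrix.trace_sum, smul_eq_mul]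

theorem krSum_blockProd_update_mul (X : Fin m → Fin m → Matrix (Fin m) (Fin m) R)
    (N : Matrix (Fin m) (Fin m) R) (k : Fin r) :
    krSum (fun A B : Fin r × Fin 2 → Fin m =>
        blockProd (Function.update (blocks X A) k (X (A (k, 0)) (A (k, 1)) * N)) B)
      = (N * (lovPartial X (k, 1))ᵀ).trace := by
  simp only [Matrix.trace, Matrix.diag_apply, Matrix.mul_apply, Matrix.transpose_apply, lovPartial,
    Matrix.of_apply, ← krSum_mul_left, ← krSum_sum]
  congr 1
  ext A B
  rw [blockProd_update, Matrix.mul_apply, Finset.sum_mul]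
  refine Finset.sum_congr rfl fun σ _ => ?_
  simp only [blockProd_update_snd, mul_ite, mul_zero, Finset.sum_ite_eq, Finset.mem_univ, if_true]
  simp only [blocks]
  ring

end Blocks


theorem derivation_krSum {R : Type*} [CommRing R] [Algebra ℝ R] (D : Derivation ℝ R R) {m : ℕ}
    {κ : Type*} [Fintype κ] [DecidableEq κ] (Z : (κ → Fin m) → (κ → Fin m) → R) :
    D (krSum Z) = krSum fun A B => D (Z A B) := by
  simp only [krSum, map_sum, Derivation.leibniz, Derivation.map_algebraMap, mul_zero, add_zero,
    smul_eq_mul]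

section BianchiPermutation

variable {r : ℕ}

/-- The cyclic permutation `(k, 0) ↦ (j, 0) ↦ (j, 1) ↦ (k, 0)` of the positions of the
differentiation index and of the two form indices in the Bianchi identity for the `j`-th
curvature. -/
def bianchiPerm (j k : Fin r) : Equiv.Perm (Fin r × Fin 2) :=
  Equiv.swap (k, 0) (j, 0) * Equiv.swap (j, 0) (j, 1)

variable {j k : Fin r}

theorem bianchiPerm_apply_zero : bianchiPerm j k (j, 0) = (j, 1) := by
  rw [bianchiPerm, Equiv.Perm.mul_apply, Equiv.swap_apply_left,
    Equiv.swap_apply_of_ne_of_ne (by simp) (by simp)]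

theorem bianchiPerm_apply_one : bianchiPerm j k (j, 1) = (k, 0) := by
  rw [bianchiPerm, Equiv.Perm.mul_apply, Equiv.swap_apply_right, Equiv.swap_apply_right]

theorem bianchiPerm_apply_of_ne {p : Fin r × Fin 2} (hk : p ≠ (k, 0)) (hj : p.1 ≠ j) :
    bianchiPerm j k p = p := by
  have ne : ∀ c, p ≠ (j, c) := fun c h => hj (congrArg Prod.fst h)
  rw [bianchiPerm, Equiv.Perm.mul_apply, Equiv.swap_apply_of_ne_of_ne (ne 0) (ne 1),
    Equiv.swap_apply_of_ne_of_ne hk (ne 0)]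

variable (hjk : j ≠ k)

include hjk

theorem sign_bianchiPerm : Equiv.Perm.sign (bianchiPerm j k) = 1 := by
  rw [bianchiPerm, map_mul, Equiv.Perm.sign_swap (by simp [hjk.symm]),
    Equiv.Perm.sign_swap (by simp)]
  rfl

theorem bianchiPerm_apply_differentiation : bianchiPerm j k (k, 0) = (j, 0) := by
  rw [bianchiPerm, Equiv.Perm.mul_apply, Equiv.swap_apply_of_ne_of_ne (a := (j, 0))
    (by simp [hjk.symm]) (by simp), Equiv.swap_apply_left]

theorem update_blocks_bianchiPerm {R : Type*} {m : ℕ}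
    (X : Fin m → Fin m → Matrix (Fin m) (Fin m) R) (Y : Fin m → Matrix (Fin m) (Fin m) R)
    (A : Fin r × Fin 2 → Fin m) {i : Fin r} (hi : i ≠ j) :
    Function.update (blocks X (A ∘ bianchiPerm j k)) k (Y (A (bianchiPerm j k (k, 1)))) i
      = Function.update (blocks X A) k (Y (A (k, 1))) i := by
  rw [bianchiPerm_apply_of_ne (p := (k, 1)) (by simp) hjk.symm]
  by_cases hik : i = k
  · subst hik
    rw [Function.update_self, Function.update_self]
  · rw [Function.update_of_ne hik, Function.update_of_ne hik, blocks, blocks,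
      Function.comp_apply, Function.comp_apply,
      bianchiPerm_apply_of_ne (p := (i, 0)) (by simp [hik]) hi,
      bianchiPerm_apply_of_ne (p := (i, 1)) (by simp) hi]

end BianchiPermutation

section Variation

variable {R : Type*} [CommRing R] [Algebra ℝ R] {m : ℕ} {d : Fin m → Derivation ℝ R R}
  {g gi : Matrix (Fin m) (Fin m) R} {Γ : Fin m → Matrix (Fin m) (Fin m) R} {r : ℕ}

/-- The contraction of `R^{λ₁θ₁}_{α₁β₁} ⋯ R^{λ_rθ_r}_{α_rβ_r}` with the generalized Kronecker delta,
the `k`-th curvature being replaced by the covariant derivative `∇_{α_k} (Y_{β_k})^{λ_kθ_k}`. -/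
def lovCovDer (d : Fin m → Derivation ℝ R R) (gi : Matrix (Fin m) (Fin m) R)
    (Γ : Fin m → Matrix (Fin m) (Fin m) R) (Y : Fin m → Matrix (Fin m) (Fin m) R) (k : Fin r) : R :=
  krSum fun A B : Fin r × Fin 2 → Fin m => blockProd (Function.update
    (blocks (curvatureUpMat d gi Γ) A) k (covDer d Γ (A (k, 0)) (Y (A (k, 1))))) B

/-- The vector field whose divergence appears in the first variation of the Lovelock Lagrangian,
when `w` is the density `√|det g|` and the matrices `C μ` are the variation of the connection. -/
def boundaryField (r : ℕ) (d : Fin m → Derivation ℝ R R) (gi : Matrix (Fin m) (Fin m) R)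
    (Γ : Fin m → Matrix (Fin m) (Fin m) R) (w : R) (C : Fin m → Matrix (Fin m) (Fin m) R)
    (μ : Fin m) : R :=
  ∑ k : Fin r, krSum fun A B : Fin r × Fin 2 → Fin m => if μ = A (k, 0) then
    w * blockProd (Function.update (blocks (curvatureUpMat d gi Γ) A) k (C (A (k, 1)) * gi)) B
  else 0

namespace IsLeviCivita

theorem krSum_bianchi (H : IsLeviCivita d g gi Γ)
    (Y : Fin m → Matrix (Fin m) (Fin m) R) {j k : Fin r} (hjk : j ≠ k) :
    krSum (fun A B : Fin r × Fin 2 → Fin m => blockProd (Function.update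
      (Function.update (blocks (curvatureUpMat d gi Γ) A) k (Y (A (k, 1)))) j
        (covDer d Γ (A (k, 0)) (curvatureUpMat d gi Γ (A (j, 0)) (A (j, 1))))) B) = 0 := by
  refine krSum_eq_zero_of_cyclic (sign_bianchiPerm hjk) _ fun A B => ?_
  have others_invariant : ∀ A' : Fin r × Fin 2 → Fin m,
      ∏ i ∈ Finset.univ.erase j, Function.update (blocks (curvatureUpMat d gi Γ)
          (A' ∘ bianchiPerm j k)) k (Y (A' (bianchiPerm j k (k, 1)))) i (B (i, 0)) (B (i, 1))
        = ∏ i ∈ Finset.univ.erase j, Function.update (blocks (curvatureUpMat d gi Γ) A') k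
          (Y (A' (k, 1))) i (B (i, 0)) (B (i, 1)) := fun A' =>
    Finset.prod_congr rfl fun i hi => by
      rw [update_blocks_bianchiPerm hjk _ Y A' (Finset.ne_of_mem_erase hi)]
  rw [← Function.comp_assoc]
  simp only [blockProd_update]
  have invariant_twice := others_invariant (A ∘ bianchiPerm j k)
  simp only [Function.comp_apply] at invariant_twice ⊢
  rw [invariant_twice, others_invariant A]
  simp only [bianchiPerm_apply_differentiation hjk, bianchiPerm_apply_zero,
    bianchiPerm_apply_one]
  rw [← add_mul, ← add_mul]
  have bianchi_apply := congrFun (congrFun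
    (H.bianchi (A (k, 0)) (A (j, 0)) (A (j, 1))) (B (j, 0))) (B (j, 1))
  simp only [Matrix.add_apply, Matrix.zero_apply] at bianchi_apply
  rw [bianchi_apply, zero_mul]

theorem krSum_divergence (H : IsLeviCivita d g gi Γ) {w : R}
    (hw : ∀ μ, d μ w = w * (Γ μ).trace) (Y : Fin m → Matrix (Fin m) (Fin m) R) (k : Fin r) :
    krSum (fun A B : Fin r × Fin 2 → Fin m => d (A (k, 0)) (w * blockProd
        (Function.update (blocks (curvatureUpMat d gi Γ) A) k (Y (A (k, 1)))) B))
      = w * lovCovDer d gi Γ Y k := by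
  set Q : (Fin r × Fin 2 → Fin m) → Fin r → Matrix (Fin m) (Fin m) R := fun A =>
    Function.update (blocks (curvatureUpMat d gi Γ) A) k (Y (A (k, 1))) with hQ
  have Q_update : ∀ A x, Q (Function.update A (k, 0) x) = Q A := by
    intro A x
    ext i : 1
    by_cases h : i = k
    · subst h; simp [hQ]
    · simp [hQ, h, blocks]
  have contraction := krSum_connection H.torsion (k, 0) (fun A B => blockProd (Q A) B)
    fun A x B => by rw [Q_update]
  have leibniz : krSum (fun A B : Fin r × Fin 2 → Fin m => d (A (k, 0)) (w * blockProd (Q A) B))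
      = w * (krSum (fun A B => d (A (k, 0)) (blockProd (Q A) B))
        + krSum fun A B => (Γ (A (k, 0))).trace * blockProd (Q A) B) := by
    rw [← krSum_add, ← krSum_mul_left]
    congr 1
    ext A B
    rw [Derivation.leibniz, hw, smul_eq_mul, smul_eq_mul]
    ring
  rw [leibniz, ← contraction, ← krSum_add]
  simp only [covDer_blockProd]
  rw [krSum_sum, Fintype.sum_eq_single k]
  · simp [hQ, lovCovDer]
  · intro j hjk
    rw [← H.krSum_bianchi Y hjk]
    simp only [hQ, Function.update_of_ne hjk]
    rfl

theorem sum_derivation_boundaryField (H : IsLeviCivita d g gi Γ) {w : R}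
    (hw : ∀ μ, d μ w = w * (Γ μ).trace) (C : Fin m → Matrix (Fin m) (Fin m) R) :
    ∑ μ, d μ (boundaryField r d gi Γ w C μ)
      = w * ∑ k : Fin r, lovCovDer d gi Γ (fun ν => C ν * gi) k := by
  simp only [Finset.mul_sum, ← H.krSum_divergence hw, boundaryField, map_sum, derivation_krSum]
  rw [Finset.sum_comm]
  refine Finset.sum_congr rfl fun k _ => ?_
  rw [← krSum_sum]
  congr 1
  ext A B
  rw [Fintype.sum_eq_single (A (k, 0)) fun b hb => by rw [if_neg hb, map_zero], if_pos rfl]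

theorem derivation_lovScalar (H : IsLeviCivita d g gi Γ) (D : Derivation ℝ R R)
    (hD : ∀ i f, D (d i f) = d i (D f)) :
    D (lovScalar r (curvatureUpMat d gi Γ)) = ∑ k : Fin r,
      (2 * lovCovDer d gi Γ (fun ν => matDer D (Γ ν) * gi) k
        - (matDer D g * gi * (lovPartial (curvatureUpMat d gi Γ) (k, 1))ᵀ).trace) := by
  simp only [lovScalar, derivation_krSum, derivation_blockProd]
  rw [krSum_sum]
  refine Finset.sum_congr rfl fun k _ => ?_
  set V : (Fin r × Fin 2 → Fin m) → (Fin r × Fin 2 → Fin m) → R := fun A B =>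
    blockProd (Function.update (blocks (curvatureUpMat d gi Γ) A) k
      (covDer d Γ (A (k, 0)) (matDer D (Γ (A (k, 1))) * gi))) B with hV
  have swap_V := krSum_comp_swap (by simp : ((k, 0) : Fin r × Fin 2) ≠ (k, 1)) V
  simp only [hV, blocks_swap, Function.comp_apply, Equiv.swap_apply_left,
    Equiv.swap_apply_right] at swap_V
  calc _ = krSum fun A B : Fin r × Fin 2 → Fin m => V A B
          - blockProd (Function.update (blocks (curvatureUpMat d gi Γ) A) k
              (covDer d Γ (A (k, 1)) (matDer D (Γ (A (k, 0))) * gi))) B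
          - blockProd (Function.update (blocks (curvatureUpMat d gi Γ) A) k
              (curvatureUpMat d gi Γ (A (k, 0)) (A (k, 1)) * (matDer D g * gi))) B := by
        congr 1
        ext A B
        have derivation_block : matDer D (blocks (curvatureUpMat d gi Γ) A k) = _ :=
          H.derivation_curvatureUpMat D hD (A (k, 0)) (A (k, 1))
        rw [derivation_block, blockProd_update_sub, blockProd_update_sub]
    _ = _ := by
        rw [krSum_sub, krSum_sub, swap_V, krSum_blockProd_update_mul, two_mul, sub_neg_eq_add]
        rfl

theorem trace_matDer_mul_lovTensor (H : IsLeviCivita d g gi Γ) (D : Derivation ℝ R R) (r : ℕ)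
    (X : Fin m → Fin m → Matrix (Fin m) (Fin m) R) :
    (matDer D g * lovTensor r X gi).trace
      = 2 * (matDer D g * gi * (lovMixed r X)ᵀ).trace := by
  have matDer_symm : (matDer D g)ᵀ = matDer D g := by
    rw [← matDer_transpose, H.symm.eq]
  have trace_transpose : (matDer D g * (lovMixed r X * gi)).trace
      = (matDer D g * (lovMixed r X * gi)ᵀ).trace := by
    rw [← Matrix.trace_transpose, Matrix.transpose_mul, matDer_symm, Matrix.trace_mul_comm]
  rw [lovTensor, mul_add, Matrix.trace_add, trace_transpose, Matrix.transpose_mul,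
    H.inv_symm.eq, mul_assoc, two_mul]

theorem first_variation (H : IsLeviCivita d g gi Γ) {w : R}
    (hw : w ^ 4 = g.det ^ 2) (D : Derivation ℝ R R) (hD : ∀ i f, D (d i f) = d i (D f)) (r : ℕ) :
    4 * D (w * lovScalar r (curvatureUpMat d gi Γ))
      = w * (matDer D g * lovTensor r (curvatureUpMat d gi Γ) gi).trace
        + 8 * ∑ μ, d μ (boundaryField r d gi Γ w (fun ν => matDer D (Γ ν)) μ) := by
  have two_mul_deriv := Lovelock.derivation_sqrt_det D H.mul_inv hw
  have contraction := trace_mul_lovMixed (r := r) _ H.transpose_curvatureUpMat (matDer D g * gi)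
  rw [Derivation.leibniz, smul_eq_mul, smul_eq_mul, H.derivation_lovScalar D hD,
    H.trace_matDer_mul_lovTensor, contraction,
    H.sum_derivation_boundaryField (H.derivation_sqrt_det hw), Finset.sum_sub_distrib,
    ← Finset.mul_sum, Matrix.trace_mul_comm (matDer D g) gi]
  linear_combination 2 * lovScalar r (curvatureUpMat d gi Γ) * two_mul_deriv

end IsLeviCivita

end Variation

/-! ### The algebra of smooth functions on an open set -/

section SmoothFun

variable {P : Type*} {O : Set P}

/-- Extension by zero of a function on `O`. -/
def extZero (f : O → ℝ) : P → ℝ := Function.extend Subtype.val f 0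

@[simp]
theorem extZero_apply (f : O → ℝ) (p : O) : extZero f p = f p :=
  Subtype.val_injective.extend_apply f 0 p

theorem extZero_of_notMem (f : O → ℝ) {p : P} (hp : p ∉ O) : extZero f p = 0 :=
  Function.extend_apply' _ _ _ fun ⟨q, hq⟩ => hp (hq ▸ q.2)

variable [NormedAddCommGroup P] [NormedSpace ℝ P]

variable (O) in
/-- The algebra of smooth functions on `O`. -/
def smoothFun : Subalgebra ℝ (O → ℝ) where
  carrier := {f | ContDiffOn ℝ ∞ (extZero f) O}
  mul_mem' {f g} hf hg := (ContDiffOn.mul hf hg).congr fun p hp => by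
    rw [extZero_apply _ ⟨p, hp⟩, Pi.mul_apply, ← extZero_apply f, ← extZero_apply g]
  add_mem' {f g} hf hg := (ContDiffOn.add hf hg).congr fun p hp => by
    rw [extZero_apply _ ⟨p, hp⟩, Pi.add_apply, ← extZero_apply f, ← extZero_apply g]
  algebraMap_mem' c := (contDiffOn_const (c := c)).congr fun p hp => by
    rw [extZero_apply _ ⟨p, hp⟩]
    rfl

theorem smoothFun.contDiffOn (f : smoothFun O) : ContDiffOn ℝ ∞ (extZero (f : O → ℝ)) O := f.2

/-- The restriction to `O` of a function which is smooth there. -/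
def smoothFun.ofFun (F : P → ℝ) (hF : ContDiffOn ℝ ∞ F O) : smoothFun O :=
  ⟨fun p => F p, hF.congr fun p hp => extZero_apply _ ⟨p, hp⟩⟩

/-- Evaluation at `p`, as a homomorphism of algebras. -/
def evalAt (p : O) : smoothFun O →ₐ[ℝ] ℝ :=
  (Pi.evalAlgHom ℝ (fun _ : O => ℝ) p).comp (smoothFun O).val

theorem extZero_eq_evalAt (f : smoothFun O) {p : P} (hp : p ∈ O) :
    extZero (f : O → ℝ) p = evalAt ⟨p, hp⟩ f :=
  extZero_apply _ ⟨p, hp⟩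

theorem smoothFun.ext_eval {f g : smoothFun O} (h : ∀ p, evalAt p f = evalAt p g) : f = g :=
  Subtype.ext (funext h)

@[simp]
theorem evalAt_ofFun (F : P → ℝ) (hF : ContDiffOn ℝ ∞ F O) (p : O) :
    evalAt p (smoothFun.ofFun F hF) = F p := rfl

theorem smoothFun.contDiffOn_of_eq (f : smoothFun O) {F : P → ℝ} (h : ∀ p : O, F p = evalAt p f) :
    ContDiffOn ℝ ∞ F O :=
  (smoothFun.contDiffOn f).congr fun p hp =>
    (h ⟨p, hp⟩).trans (extZero_apply (f : O → ℝ) ⟨p, hp⟩).symm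

theorem contDiffOn_fderiv_apply {F : P → ℝ} (hO : IsOpen O) (hF : ContDiffOn ℝ ∞ F O) (v : P) :
    ContDiffOn ℝ ∞ (fun p => fderiv ℝ F p v) O :=
  (hF.fderiv_of_isOpen hO (m := ∞) (by simp)).clm_apply contDiffOn_const

theorem smoothFun.differentiableAt (hO : IsOpen O) (f : smoothFun O) (p : O) :
    DifferentiableAt ℝ (extZero (f : O → ℝ)) p :=
  ((smoothFun.contDiffOn f).contDiffAt (hO.mem_nhds p.2)).differentiableAt (by simp)

theorem fderiv_extZero {f : O → ℝ} {F : P → ℝ} (hO : IsOpen O) (p : O)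
    (h : ∀ q : O, f q = F q) : fderiv ℝ (extZero f) p = fderiv ℝ F p := by
  refine Filter.EventuallyEq.fderiv_eq ?_
  filter_upwards [hO.mem_nhds p.2] with q hq
  rw [extZero_apply f ⟨q, hq⟩, h]

/-- The derivative in the direction `v`, as a derivation of the algebra of smooth functions. -/
def dirDer (hO : IsOpen O) (v : P) : Derivation ℝ (smoothFun O) (smoothFun O) :=
  Derivation.mk'
    { toFun := fun f => smoothFun.ofFun (fun p => fderiv ℝ (extZero (f : O → ℝ)) p v)
        (contDiffOn_fderiv_apply hO (smoothFun.contDiffOn f) v)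
      map_add' := fun f g => smoothFun.ext_eval fun p => by
        rw [map_add, evalAt_ofFun, evalAt_ofFun, evalAt_ofFun, ← add_apply,
          ← fderiv_add (smoothFun.differentiableAt hO f p) (smoothFun.differentiableAt hO g p),
          fderiv_extZero hO p fun q => ?_]
        rw [Pi.add_apply, extZero_apply, extZero_apply]
        rfl
      map_smul' := fun c f => smoothFun.ext_eval fun p => by
        rw [RingHom.id_apply, map_smul, evalAt_ofFun, evalAt_ofFun, smul_eq_mul,
          ← smul_eq_mul, ← smul_apply, ← fderiv_const_smul (smoothFun.differentiableAt hO f p),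
          fderiv_extZero hO p fun q => ?_]
        rw [Pi.smul_apply, extZero_apply]
        rfl }
    fun f g => smoothFun.ext_eval fun p => by
      simp only [LinearMap.coe_mk, AddHom.coe_mk, evalAt_ofFun, map_add, smul_eq_mul, map_mul]
      rw [fderiv_extZero (F := fun q => extZero (f : O → ℝ) q * extZero (g : O → ℝ) q) hO p
          fun q => ?_, fderiv_fun_mul (smoothFun.differentiableAt hO f p)
          (smoothFun.differentiableAt hO g p)]
      · simp only [add_apply, smul_apply, smul_eq_mul, extZero_apply]
        rfl
      · simp only [extZero_apply]
        rfl

theorem evalAt_dirDer (hO : IsOpen O) (v : P) (f : smoothFun O) (p : O) :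
    evalAt p (dirDer hO v f) = fderiv ℝ (extZero (f : O → ℝ)) p v := rfl

theorem evalAt_dirDer_of_eq (hO : IsOpen O) (v : P) (f : smoothFun O) {F : P → ℝ}
    (h : ∀ q : O, evalAt q f = F q) (p : O) : evalAt p (dirDer hO v f) = fderiv ℝ F p v := by
  rw [evalAt_dirDer, fderiv_extZero (f := (f : O → ℝ)) hO p h]

theorem dirDer_comm (hO : IsOpen O) (v w : P) (f : smoothFun O) :
    dirDer hO v (dirDer hO w f) = dirDer hO w (dirDer hO v f) := by
  refine smoothFun.ext_eval fun p => ?_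
  set F := extZero (f : O → ℝ)
  have hF : ContDiffAt ℝ ∞ F p := (smoothFun.contDiffOn f).contDiffAt (hO.mem_nhds p.2)
  have differentiable_fderiv : DifferentiableAt ℝ (fderiv ℝ F) p :=
    (hF.fderiv_right (m := ∞) (by simp)).differentiableAt (by simp)
  have second_derivative (a b : P) :
      evalAt p (dirDer hO a (dirDer hO b f)) = fderiv ℝ (fderiv ℝ F) p a b := by
    rw [evalAt_dirDer_of_eq hO a (dirDer hO b f) (F := fun q => fderiv ℝ F q b)
      (fun q => evalAt_dirDer hO b f q),
      fderiv_clm_apply differentiable_fderiv (differentiableAt_const b)]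
    simp
  rw [second_derivative, second_derivative]
  exact (hF.isSymmSndFDerivAt (by simpa using ENat.LEInfty.out)) v w

end SmoothFun

/-! ### Curvature and Lovelock tensor in coordinates -/

section Comparison

variable {P : Type*} [NormedAddCommGroup P] [NormedSpace ℝ P] {O : Set P} {m : ℕ}

/-- The partial derivatives along the directions `j (∂_μ)`. Here `P` is either the coordinate space
itself or, for a family of metrics, its product with the line of the parameter, and `j` is the
linear part of the inclusion `T` of the coordinate space. -/
def coordDer (hO : IsOpen O) (j : (Fin m → ℝ) →L[ℝ] P) (μ : Fin m) :
    Derivation ℝ (smoothFun O) (smoothFun O) :=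
  dirDer hO (j (Pi.single μ 1))

variable (hO : IsOpen O) {j : (Fin m → ℝ) →L[ℝ] P} {T : (Fin m → ℝ) → P}

theorem pderiv_eq_evalAt (hT : ∀ x, HasFDerivAt T j x)
    (μ : Fin m) {F : (Fin m → ℝ) → ℝ} {f : smoothFun O}
    (hF : ∀ x (hx : T x ∈ O), F x = evalAt ⟨T x, hx⟩ f) {y : Fin m → ℝ} (hy : T y ∈ O) :
    pderiv μ F y = evalAt ⟨T y, hy⟩ (coordDer hO j μ f) := by
  have eventually_eq : F =ᶠ[nhds y] extZero (f : O → ℝ) ∘ T := by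
    filter_upwards [(hT y).continuousAt.preimage_mem_nhds (hO.mem_nhds hy)] with x hx
    rw [hF x hx, Function.comp_apply, extZero_apply (f : O → ℝ) ⟨T x, hx⟩]
    rfl
  have chain_rule := (smoothFun.differentiableAt hO f ⟨T y, hy⟩).hasFDerivAt.comp y (hT y)
  rw [pderiv, eventually_eq.fderiv_eq, chain_rule.fderiv, coordDer, evalAt_dirDer]
  rfl

variable {g : (Fin m → ℝ) → Matrix (Fin m) (Fin m) ℝ}
  {G Gi : Matrix (Fin m) (Fin m) (smoothFun O)}

theorem christoffel_eq_evalAt (hT : ∀ x, HasFDerivAt T j x)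
    (hg : ∀ x (hx : T x ∈ O), g x = G.map (evalAt ⟨T x, hx⟩))
    (hgi : ∀ x (hx : T x ∈ O), (g x)⁻¹ = Gi.map (evalAt ⟨T x, hx⟩)) (μ ν σ : Fin m)
    {y : Fin m → ℝ} (hy : T y ∈ O) :
    christoffel g μ ν σ y
      = evalAt ⟨T y, hy⟩ (christoffelMat (coordDer hO j) G Gi σ μ ν) := by
  have pderiv_metric (μ a b) :
      pderiv μ (fun x => g x a b) y = evalAt ⟨T y, hy⟩ (coordDer hO j μ (G a b)) :=
    pderiv_eq_evalAt hO hT μ (fun x hx => by rw [hg x hx]; rfl) hy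
  simp only [christoffel, christoffelMat, Matrix.of_apply, map_mul, map_sum, map_sub, map_add,
    AlgHom.commutes, pderiv_metric, hgi y hy, Matrix.map_apply]
  rfl

variable {Γ : Fin m → Fin m → Fin m → (Fin m → ℝ) → ℝ}
  {ΓM : Fin m → Matrix (Fin m) (Fin m) (smoothFun O)}

theorem curvatureUp_eq_evalAt (hT : ∀ x, HasFDerivAt T j x)
    (hgi : ∀ x (hx : T x ∈ O), (g x)⁻¹ = Gi.map (evalAt ⟨T x, hx⟩))
    (hΓ : ∀ μ ν σ x (hx : T x ∈ O), Γ μ ν σ x = evalAt ⟨T x, hx⟩ (ΓM σ μ ν)) (κ τ μ ν : Fin m)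
    {y : Fin m → ℝ} (hy : T y ∈ O) :
    curvatureUp g Γ κ τ μ ν y
      = evalAt ⟨T y, hy⟩ (curvatureUpMat (coordDer hO j) Gi ΓM μ ν κ τ) := by
  have pderiv_connection (α a b c) :
      pderiv α (Γ a b c) y = evalAt ⟨T y, hy⟩ (coordDer hO j α (ΓM c a b)) :=
    pderiv_eq_evalAt hO hT α (fun x hx => hΓ a b c x hx) hy
  simp only [curvatureUp, curvature, curvatureUpMat, curvatureMat, Matrix.mul_apply,
    Matrix.add_apply, Matrix.sub_apply, matDer_apply, map_sum, map_mul, map_add, map_sub,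
    pderiv_connection, hgi y hy, Matrix.map_apply, hΓ _ _ _ y hy, Finset.sum_sub_distrib]
  exact Finset.sum_congr rfl fun ρ _ => by ring

theorem lovelockTensor_eq_evalAt (hT : ∀ x, HasFDerivAt T j x)
    (hgi : ∀ x (hx : T x ∈ O), (g x)⁻¹ = Gi.map (evalAt ⟨T x, hx⟩))
    (hΓ : ∀ μ ν σ x (hx : T x ∈ O), Γ μ ν σ x = evalAt ⟨T x, hx⟩ (ΓM σ μ ν)) (r : ℕ)
    (μ ν : Fin m) {y : Fin m → ℝ} (hy : T y ∈ O) :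
    lovelockTensor r g Γ μ ν y
      = evalAt ⟨T y, hy⟩ (lovTensor r (curvatureUpMat (coordDer hO j) Gi ΓM) Gi μ ν) := by
  simp only [lovelockTensor, lovTensor, lovMixed, Matrix.add_apply, Matrix.transpose_apply,
    Matrix.mul_apply, Matrix.of_apply, map_sum, map_add, map_mul, AlgHom.commutes, blockProd,
    map_prod, blocks, curvatureUp_eq_evalAt hO hT hgi hΓ _ _ _ _ hy, hgi y hy, Matrix.map_apply,
    Finset.sum_mul, ← Finset.sum_add_distrib]
  refine Finset.sum_congr rfl fun ρ _ => Finset.sum_congr rfl fun A _ =>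
    Finset.sum_congr rfl fun B _ => ?_
  simp only [Algebra.algebraMap_self, RingHom.id_apply]
  ring

end Comparison

/-! ### Smooth metrics -/

section SmoothMatrix

variable {P : Type*} [NormedAddCommGroup P] [NormedSpace ℝ P] {O : Set P} {ι : Type*}

theorem evalAt_matrix_ext {M N : Matrix ι ι (smoothFun O)}
    (h : ∀ p : O, M.map (evalAt p) = N.map (evalAt p)) : M = N := by
  ext1 i j
  exact smoothFun.ext_eval fun p => congrFun (congrFun (h p) i) j

theorem map_evalAt_mul [Fintype ι] (M N : Matrix ι ι (smoothFun O)) (p : O) :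
    (M * N).map (evalAt p) = M.map (evalAt p) * N.map (evalAt p) :=
  Matrix.map_mul (f := (evalAt p).toRingHom)

/-- A matrix whose entries are smooth, as a matrix over the algebra of smooth functions. -/
def smoothMat (Gf : P → Matrix ι ι ℝ)
    (h : ∀ i j, ContDiffOn ℝ ∞ (fun p => Gf p i j) O) : Matrix ι ι (smoothFun O) :=
  Matrix.of fun i j => smoothFun.ofFun (fun p => Gf p i j) (h i j)

theorem smoothMat_eval (Gf : P → Matrix ι ι ℝ)
    (h : ∀ i j, ContDiffOn ℝ ∞ (fun p => Gf p i j) O) (p : O) :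
    (smoothMat Gf h).map (evalAt p) = Gf p := rfl

variable [Fintype ι] [DecidableEq ι]

theorem contDiffOn_det {Gf : P → Matrix ι ι ℝ}
    (h : ∀ i j, ContDiffOn ℝ ∞ (fun p => Gf p i j) O) : ContDiffOn ℝ ∞ (fun p => (Gf p).det) O :=
  smoothFun.contDiffOn_of_eq (smoothMat Gf h).det fun p => by
    rw [AlgHom.map_det, AlgHom.mapMatrix_apply, smoothMat_eval]

theorem contDiffOn_matrix_inv {Gf : P → Matrix ι ι ℝ}
    (h : ∀ i j, ContDiffOn ℝ ∞ (fun p => Gf p i j) O) (hd : ∀ p ∈ O, (Gf p).det ≠ 0)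
    (i j : ι) : ContDiffOn ℝ ∞ (fun p => (Gf p)⁻¹ i j) O := by
  have adjugate_smooth : ContDiffOn ℝ ∞ (fun p => (Gf p).adjugate i j) O :=
    smoothFun.contDiffOn_of_eq ((smoothMat Gf h).adjugate i j) fun p => by
      have map_adjugate := AlgHom.map_adjugate (evalAt p) (smoothMat Gf h)
      rw [AlgHom.mapMatrix_apply, AlgHom.mapMatrix_apply, smoothMat_eval] at map_adjugate
      rw [← map_adjugate, Matrix.map_apply]
  refine (((contDiffOn_det h).inv hd).mul adjugate_smooth).congr fun p _ => ?_
  rw [Matrix.inv_def, Matrix.smul_apply, Ring.inverse_eq_inv', smul_eq_mul]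
  rfl

end SmoothMatrix

section SmoothMetric

variable {P : Type*} [NormedAddCommGroup P] [NormedSpace ℝ P] {O : Set P} {m : ℕ}

/-- A smooth metric `Gf` on `O` over the algebra of smooth functions: its matrix `G`, the inverse
matrix `Gi` and the volume density `w`. -/
structure SmoothMetric (O : Set P) (Gf : P → Matrix (Fin m) (Fin m) ℝ) where
  G : Matrix (Fin m) (Fin m) (smoothFun O)
  Gi : Matrix (Fin m) (Fin m) (smoothFun O)
  w : smoothFun O
  G_eval : ∀ p : O, Gf p = G.map (evalAt p)
  Gi_eval : ∀ p : O, (Gf p)⁻¹ = Gi.map (evalAt p)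
  w_eval : ∀ p : O, Real.sqrt |(Gf p).det| = evalAt p w
  mul_inv : G * Gi = 1
  pow_w : w ^ 4 = G.det ^ 2
  symm : G.IsSymm

/-- The data attached to a smooth field of nondegenerate symmetric matrices. -/
def SmoothMetric.of (Gf : P → Matrix (Fin m) (Fin m) ℝ)
    (h : ∀ i j, ContDiffOn ℝ ∞ (fun p => Gf p i j) O) (hd : ∀ p ∈ O, (Gf p).det ≠ 0)
    (hs : ∀ p ∈ O, (Gf p).IsSymm) : SmoothMetric O Gf :=
  have hw : ContDiffOn ℝ ∞ (fun p => Real.sqrt |(Gf p).det|) O :=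
    ((contDiffOn_det h).norm ℝ hd).sqrt fun p hp => norm_ne_zero_iff.mpr (hd p hp)
  { G := smoothMat Gf h
    Gi := smoothMat (fun p => (Gf p)⁻¹) (contDiffOn_matrix_inv h hd)
    w := smoothFun.ofFun _ hw
    G_eval := fun p => rfl
    Gi_eval := fun p => rfl
    w_eval := fun p => rfl
    mul_inv := evalAt_matrix_ext fun p => by
      rw [map_evalAt_mul, smoothMat_eval, smoothMat_eval,
        Matrix.mul_nonsing_inv _ (isUnit_iff_ne_zero.mpr (hd p p.2)),
        Matrix.map_one _ (map_zero _) (map_one _)]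
    pow_w := smoothFun.ext_eval fun p => by
      rw [map_pow, map_pow, AlgHom.map_det, AlgHom.mapMatrix_apply, smoothMat_eval, evalAt_ofFun,
        show 4 = 2 * 2 from rfl, pow_mul, Real.sq_sqrt (abs_nonneg _), sq_abs]
    symm := evalAt_matrix_ext fun p => by
      rw [Matrix.transpose_map, smoothMat_eval, (hs p p.2).eq] }

namespace SmoothMetric

variable {Gf : P → Matrix (Fin m) (Fin m) ℝ} (S : SmoothMetric O Gf) (hO : IsOpen O)
  (j : (Fin m → ℝ) →L[ℝ] P)

/-- The matrices of the Levi-Civita connection. -/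
def connection : Fin m → Matrix (Fin m) (Fin m) (smoothFun O) :=
  christoffelMat (coordDer hO j) S.G S.Gi

/-- The matrices of the curvature of the Levi-Civita connection, with one index raised. -/
def curvature : Fin m → Fin m → Matrix (Fin m) (Fin m) (smoothFun O) :=
  curvatureUpMat (coordDer hO j) S.Gi (S.connection hO j)

/-- The Lovelock Lagrangian of order `r` as a smooth function. -/
def lagrangian (r : ℕ) : smoothFun O :=
  S.w * lovScalar r (S.curvature hO j)

theorem isLeviCivita : IsLeviCivita (coordDer hO j) S.G S.Gi (S.connection hO j) :=
  isLeviCivita_christoffelMat (fun _ _ _ => dirDer_comm hO _ _ _) S.symm S.mul_inv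

variable {j} {T : (Fin m → ℝ) → P}

theorem christoffel_eq_evalAt (hT : ∀ x, HasFDerivAt T j x) (μ ν σ : Fin m) {y : Fin m → ℝ}
    (hy : T y ∈ O) :
    christoffel (fun x => Gf (T x)) μ ν σ y = evalAt ⟨T y, hy⟩ (S.connection hO j σ μ ν) :=
  Lovelock.christoffel_eq_evalAt hO hT (fun x hx => S.G_eval ⟨T x, hx⟩)
    (fun x hx => S.Gi_eval ⟨T x, hx⟩) μ ν σ hy

theorem lovelockTensor_eq_evalAt (hT : ∀ x, HasFDerivAt T j x) (r : ℕ) (μ ν : Fin m)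
    {y : Fin m → ℝ} (hy : T y ∈ O) :
    lovelockTensor r (fun x => Gf (T x)) (christoffel fun x => Gf (T x)) μ ν y
      = evalAt ⟨T y, hy⟩ (lovTensor r (S.curvature hO j) S.Gi μ ν) :=
  Lovelock.lovelockTensor_eq_evalAt hO hT (fun x hx => S.Gi_eval ⟨T x, hx⟩)
    (fun μ ν σ _ hx => S.christoffel_eq_evalAt hO hT μ ν σ hx) r μ ν hy

theorem lovelockDensity_eq_evalAt (hT : ∀ x, HasFDerivAt T j x) (r : ℕ)
    {y : Fin m → ℝ} (hy : T y ∈ O) :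
    lovelockDensity r (fun x => Gf (T x)) y = evalAt ⟨T y, hy⟩ (S.lagrangian hO j r) := by
  have curvature_eq (κ τ μ ν) :=
    curvatureUp_eq_evalAt (g := fun x => Gf (T x)) hO hT (fun x hx => S.Gi_eval ⟨T x, hx⟩)
      (fun μ ν σ _ hx => S.christoffel_eq_evalAt hO hT μ ν σ hx) κ τ μ ν hy
  simp only [lovelockDensity, lagrangian, lovScalar, krSum, map_sum, map_mul, AlgHom.commutes,
    blockProd, map_prod, blocks, S.w_eval ⟨T y, hy⟩, curvature_eq]
  rfl

end SmoothMetric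

end SmoothMetric

/-! ### The Euler-Lagrange equations of the Lovelock Lagrangian -/

section Integration

variable {E : Type*} [NormedAddCommGroup E] [NormedSpace ℝ E] [MeasurableSpace E] [BorelSpace E]
  {V K : Set E}

theorem hasDerivAt_setIntegral {O : Set (ℝ × E)} (hO : IsOpen O) (f : smoothFun O)
    {μ : MeasureTheory.Measure E} [MeasureTheory.IsFiniteMeasureOnCompacts μ] (hK : IsCompact K)
    {ε : ℝ} (hε : 0 < ε) (hεK : Metric.closedBall (0 : ℝ) ε ×ˢ K ⊆ O) :
    MeasureTheory.IntegrableOn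
        (fun y => extZero (dirDer hO (1, 0) f : O → ℝ) (0, y)) K μ ∧
      HasDerivAt (fun t => ∫ y in K, extZero (f : O → ℝ) (t, y) ∂μ)
        (∫ y in K, extZero (dirDer hO (1, 0) f : O → ℝ) (0, y) ∂μ) 0 := by
  set F' := extZero (dirDer hO (1, 0) f : O → ℝ)
  have hasDerivAt_slice (t : ℝ) (y : E) (hy : (t, y) ∈ O) :
      HasDerivAt (fun t => extZero (f : O → ℝ) (t, y)) (F' (t, y)) t := by
    have chain_rule := (smoothFun.differentiableAt hO f ⟨(t, y), hy⟩).hasFDerivAt.comp_hasDerivAt t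
      ((hasDerivAt_id t).prodMk (hasDerivAt_const t y))
    rwa [← evalAt_dirDer hO, ← extZero_eq_evalAt] at chain_rule
  have continuousOn_slice (f : smoothFun O) (t : ℝ) (ht : t ∈ Metric.closedBall (0 : ℝ) ε) :
      ContinuousOn (fun y => extZero (f : O → ℝ) (t, y)) K :=
    (smoothFun.contDiffOn f).continuousOn.comp (by fun_prop) fun y hy => hεK ⟨ht, hy⟩
  obtain ⟨b, norm_le⟩ := ((isCompact_closedBall (0 : ℝ) ε).prod hK).exists_bound_of_continuousOn
    ((smoothFun.contDiffOn (dirDer hO (1, 0) f)).continuousOn.mono hεK)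
  have ball_mem : Metric.closedBall (0 : ℝ) ε ∈ nhds (0 : ℝ) := Metric.closedBall_mem_nhds 0 hε
  have zero_mem : (0 : ℝ) ∈ Metric.closedBall (0 : ℝ) ε := Metric.mem_closedBall_self hε.le
  have ae_mem_K : ∀ᵐ y ∂μ.restrict K, y ∈ K :=
    MeasureTheory.ae_restrict_mem hK.measurableSet
  refine hasDerivAt_integral_of_dominated_loc_of_deriv_le (μ := μ.restrict K)
    (F' := fun t y => F' (t, y)) (bound := fun _ => b) ball_mem ?_
    ((continuousOn_slice f 0 zero_mem).integrableOn_compact hK)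
    ((continuousOn_slice _ 0 zero_mem).aestronglyMeasurable hK.measurableSet) ?_
    (MeasureTheory.integrableOn_const hK.measure_lt_top.ne) ?_
  · filter_upwards [ball_mem] with t ht
    exact (continuousOn_slice f t ht).aestronglyMeasurable hK.measurableSet
  · filter_upwards [ae_mem_K] with y hy t ht using norm_le (t, y) ⟨ht, hy⟩
  · filter_upwards [ae_mem_K] with y hy t ht using hasDerivAt_slice t y (hεK ⟨ht, hy⟩)

variable [FiniteDimensional ℝ E] (μ : MeasureTheory.Measure E) [μ.IsAddHaarMeasure]

theorem integral_fderiv_eq_zero {F : E → ℝ} (hF : ContDiff ℝ 1 F) (hc : HasCompactSupport F)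
    (v : E) : ∫ y, fderiv ℝ F y v ∂μ = 0 := by
  have continuous_deriv : Continuous fun y => fderiv ℝ F y v :=
    (hF.continuous_fderiv one_ne_zero).clm_apply continuous_const
  have integrable_deriv : MeasureTheory.Integrable (fun y => fderiv ℝ F y v) μ :=
    continuous_deriv.integrable_of_hasCompactSupport (hc.fderiv_apply (𝕜 := ℝ) v)
  simpa using integral_mul_fderiv_eq_neg_fderiv_mul_of_integrable (μ := μ)
    (f := fun _ : E => (1 : ℝ)) (g := F) (v := v) (by simp) (by simpa using integrable_deriv)
    (by simpa using hF.continuous.integrable_of_hasCompactSupport hc)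
    (fun x _ => differentiableAt_const _) (fun x _ => hF.differentiable one_ne_zero x)

theorem setIntegral_fderiv_eq_zero {F : E → ℝ} (hV : IsOpen V) (hF : ContDiffOn ℝ 1 F V)
    (hK : IsCompact K) (hKV : K ⊆ V) {C : Set E} (hC : IsClosed C) (hCK : C ⊆ K)
    (h0 : ∀ y ∉ C, F y = 0) (v : E) :
    MeasureTheory.IntegrableOn (fun y => fderiv ℝ F y v) K μ ∧
      ∫ y in K, fderiv ℝ F y v ∂μ = 0 := by
  have eventually_zero : ∀ y ∉ C, F =ᶠ[nhds y] fun _ => 0 := fun y hy => by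
    filter_upwards [hC.isOpen_compl.mem_nhds hy] with x hx using h0 x hx
  have smooth : ContDiff ℝ 1 F := by
    refine contDiff_iff_contDiffAt.mpr fun y => ?_
    by_cases hy : y ∈ C
    · exact hF.contDiffAt (hV.mem_nhds (hKV (hCK hy)))
    · exact contDiffAt_const.congr_of_eventuallyEq (eventually_zero y hy)
  have compact_support : HasCompactSupport F :=
    HasCompactSupport.intro hK fun y hy => h0 y fun hyC => hy (hCK hyC)
  have continuous_deriv : Continuous fun y => fderiv ℝ F y v :=
    (smooth.continuous_fderiv one_ne_zero).clm_apply continuous_const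
  refine ⟨continuous_deriv.continuousOn.integrableOn_compact hK, ?_⟩
  rw [MeasureTheory.setIntegral_eq_integral_of_forall_compl_eq_zero]
  · exact integral_fderiv_eq_zero μ smooth compact_support v
  · intro y hy
    rw [(eventually_zero y fun hyC => hy (hCK hyC)).fderiv_eq]
    simp

theorem eq_zero_of_integral_contDiff_mul_eq_zero {F : E → ℝ} (hV : IsOpen V)
    (hF : ContinuousOn F V)
    (h : ∀ b : E → ℝ, ContDiff ℝ ∞ b → HasCompactSupport b → tsupport b ⊆ V →
      ∫ y, b y * F y ∂μ = 0) : ∀ y ∈ V, F y = 0 := by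
  refine MeasureTheory.Measure.eqOn_open_of_ae_eq (μ := μ) (g := fun _ => 0) ?_ hV hF
    continuousOn_const
  rw [Filter.EventuallyEq, MeasureTheory.ae_restrict_iff' hV.measurableSet]
  exact hV.ae_eq_zero_of_integral_contDiff_smul_eq_zero
    (hF.locallyIntegrableOn hV.measurableSet) h

end Integration

section Variation

variable {m : ℕ}

theorem lovelockTensor_symm (r : ℕ) (g : (Fin m → ℝ) → Matrix (Fin m) (Fin m) ℝ)
    (Γ : Fin m → Fin m → Fin m → (Fin m → ℝ) → ℝ) (μ ν : Fin m) (y : Fin m → ℝ) :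
    lovelockTensor r g Γ μ ν y = lovelockTensor r g Γ ν μ y := by
  simp only [lovelockTensor, add_comm]

/-- The boundary term of the first variation, for a family of metrics on the coordinate space
depending on a parameter. -/
def SmoothMetric.boundaryTerm {O : Set (ℝ × (Fin m → ℝ))}
    {Gf : ℝ × (Fin m → ℝ) → Matrix (Fin m) (Fin m) ℝ} (S : SmoothMetric O Gf) (hO : IsOpen O)
    (r : ℕ) : Fin m → smoothFun O :=
  boundaryField r (coordDer hO (.inr ℝ ℝ (Fin m → ℝ))) S.Gi
    (S.connection hO (.inr ℝ ℝ (Fin m → ℝ))) S.w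
    fun ν => matDer (dirDer hO (1, 0)) (S.connection hO (.inr ℝ ℝ (Fin m → ℝ)) ν)

variable {g h : (Fin m → ℝ) → Matrix (Fin m) (Fin m) ℝ} {V K : Set (Fin m → ℝ)}

/-- The variation `g + t h` of the metric as a function of `(t, y)`. -/
def varied (g h : (Fin m → ℝ) → Matrix (Fin m) (Fin m) ℝ) (p : ℝ × (Fin m → ℝ)) :
    Matrix (Fin m) (Fin m) ℝ :=
  g p.2 + p.1 • h p.2

/-- The set of the pairs `(t, y)` for which `g + t h` is nondegenerate at `y ∈ V`. -/
def variedDom (g h : (Fin m → ℝ) → Matrix (Fin m) (Fin m) ℝ) (V : Set (Fin m → ℝ)) :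
    Set (ℝ × (Fin m → ℝ)) :=
  {p | p.2 ∈ V ∧ (varied g h p).det ≠ 0}

theorem varied_zero (y : Fin m → ℝ) : varied g h (0, y) = g y := by simp [varied]

theorem mem_variedDom_zero (hd : ∀ y ∈ V, (g y).det ≠ 0) {y : Fin m → ℝ} (hy : y ∈ V) :
    ((0 : ℝ), y) ∈ variedDom g h V := ⟨hy, by rw [varied_zero]; exact hd y hy⟩

theorem contDiffOn_varied (hg : ∀ i j, ContDiffOn ℝ ∞ (fun y => g y i j) V)
    (hh : ∀ i j, ContDiff ℝ ∞ fun y => h y i j) (i j : Fin m) :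
    ContDiffOn ℝ ∞ (fun p => varied g h p i j) (Prod.snd ⁻¹' V) := by
  simp only [varied, Matrix.add_apply, Matrix.smul_apply, smul_eq_mul]
  exact ((hg i j).comp contDiffOn_snd fun p hp => hp).add
    (contDiffOn_fst.mul ((hh i j).contDiffOn.comp contDiffOn_snd fun p _ => Set.mem_univ _))

theorem isOpen_variedDom (hV : IsOpen V) (hg : ∀ i j, ContDiffOn ℝ ∞ (fun y => g y i j) V)
    (hh : ∀ i j, ContDiff ℝ ∞ fun y => h y i j) : IsOpen (variedDom g h V) :=
  (contDiffOn_det (contDiffOn_varied hg hh)).continuousOn.isOpen_inter_preimage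
    (hV.preimage continuous_snd) isOpen_ne

theorem exists_closedBall_prod_subset (hV : IsOpen V)
    (hg : ∀ i j, ContDiffOn ℝ ∞ (fun y => g y i j) V) (hd : ∀ y ∈ V, (g y).det ≠ 0)
    (hK : IsCompact K) (hKV : K ⊆ V) (hh : ∀ i j, ContDiff ℝ ∞ fun y => h y i j) :
    ∃ ε > 0, Metric.closedBall (0 : ℝ) ε ×ˢ K ⊆ variedDom g h V := by
  obtain ⟨u, v, hu, _, zero_subset_u, hKv, huv⟩ :=
    generalized_tube_lemma (isCompact_singleton (x := (0 : ℝ))) hK (isOpen_variedDom hV hg hh) (by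
      rintro ⟨_, y⟩ ⟨rfl, hy⟩
      exact mem_variedDom_zero hd (hKV hy))
  obtain ⟨ε, hε, hεu⟩ := Metric.nhds_basis_closedBall.mem_iff.mp
    (hu.mem_nhds (zero_subset_u (Set.mem_singleton 0)))
  exact ⟨ε, hε, (Set.prod_mono hεu hKv).trans huv⟩

section EvalAt

variable (S : SmoothMetric (variedDom g h V) (varied g h)) (hO : IsOpen (variedDom g h V))

theorem evalAt_derivation_varied (p : variedDom g h V) (i j : Fin m) :
    evalAt p (dirDer hO (1, 0) (S.G i j)) = h p.1.2 i j := by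
  have line_deriv : HasDerivAt (fun t : ℝ => g p.1.2 i j + (p.1.1 + t) * h p.1.2 i j)
      (h p.1.2 i j) 0 := by
    simpa using (((hasDerivAt_id (0 : ℝ)).const_add p.1.1).mul_const (h p.1.2 i j)).const_add
      (g p.1.2 i j)
  rw [evalAt_dirDer, ← (smoothFun.differentiableAt hO (S.G i j) p).lineDeriv_eq_fderiv, lineDeriv,
    ← line_deriv.deriv]
  refine Filter.EventuallyEq.deriv_eq ?_
  have continuous_line : Continuous fun t : ℝ =>
    (p : ℝ × (Fin m → ℝ)) + t • ((1 : ℝ), (0 : Fin m → ℝ)) := by fun_prop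
  filter_upwards [continuous_line.continuousAt.preimage_mem_nhds
    (hO.mem_nhds (show _ ∈ variedDom g h V by simp))] with t ht
  refine ((extZero_eq_evalAt (S.G i j) ht).trans
    (congrFun (congrFun (S.G_eval ⟨_, ht⟩) i) j).symm).trans ?_
  simp [varied]

variable {p : variedDom g h V} (hp : p.1.2 ∉ tsupport h)
include hp

theorem evalAt_derivation_varied_eq_zero (i j : Fin m) :
    evalAt p (dirDer hO (1, 0) (S.G i j)) = 0 := by
  rw [evalAt_derivation_varied, image_eq_zero_of_notMem_tsupport hp, Matrix.zero_apply]

theorem evalAt_derivation_varied_inv_eq_zero (i j : Fin m) :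
    evalAt p (dirDer hO (1, 0) (S.Gi i j)) = 0 := by
  rw [← matDer_apply, matDer_inverse _ S.mul_inv, Matrix.neg_apply, map_neg, neg_eq_zero,
    ← Matrix.map_apply (f := evalAt p), map_evalAt_mul, map_evalAt_mul,
    show (matDer (dirDer hO (1, 0)) S.G).map (evalAt p) = 0 from
      Matrix.ext fun a b => evalAt_derivation_varied_eq_zero S hO hp a b,
    mul_zero, zero_mul, Matrix.zero_apply]

theorem evalAt_derivation_coordDer_varied_eq_zero (μ i j : Fin m) :
    evalAt p (dirDer hO (1, 0) (coordDer hO (.inr ℝ ℝ (Fin m → ℝ)) μ (S.G i j))) = 0 := by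
  have eventually_zero : (fun x => h x i j) =ᶠ[nhds p.1.2] fun _ => 0 := by
    filter_upwards [(isClosed_tsupport h).isOpen_compl.mem_nhds hp] with x hx
    rw [image_eq_zero_of_notMem_tsupport hx, Matrix.zero_apply]
  rw [coordDer, dirDer_comm, ← coordDer]
  refine (pderiv_eq_evalAt hO (fun x => hasFDerivAt_prodMk_right p.1.1 x) μ
    (f := dirDer hO (1, 0) (S.G i j)) (F := fun x => h x i j)
    (fun x hx => (evalAt_derivation_varied S hO ⟨_, hx⟩ i j).symm) p.2).symm.trans ?_
  rw [pderiv, eventually_zero.fderiv_eq]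
  simp

theorem evalAt_derivation_connection_eq_zero (ν κ ρ : Fin m) :
    evalAt p (dirDer hO (1, 0) (S.connection hO (.inr ℝ ℝ (Fin m → ℝ)) ν κ ρ)) = 0 := by
  simp only [SmoothMetric.connection, christoffelMat, Matrix.of_apply, Derivation.leibniz,
    Derivation.map_algebraMap, map_sum, smul_eq_mul, map_add, map_mul, map_sub,
    evalAt_derivation_varied_inv_eq_zero S hO hp,
    evalAt_derivation_coordDer_varied_eq_zero S hO hp]
  simp

theorem evalAt_boundaryTerm_eq_zero (r : ℕ) (μ : Fin m) :
    evalAt p (S.boundaryTerm hO r μ) = 0 := by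
  have matDer_mul_eq_zero (ν : Fin m) :
      (matDer (dirDer hO (1, 0)) (S.connection hO (.inr ℝ ℝ (Fin m → ℝ)) ν) * S.Gi).map (evalAt p)
        = 0 := by
    rw [map_evalAt_mul, show (matDer (dirDer hO (1, 0))
        (S.connection hO (.inr ℝ ℝ (Fin m → ℝ)) ν)).map (evalAt p) = 0 from
      Matrix.ext fun a b => evalAt_derivation_connection_eq_zero S hO hp ν a b, zero_mul]
  simp only [SmoothMetric.boundaryTerm, boundaryField, krSum, map_sum, map_mul]
  refine Finset.sum_eq_zero fun k _ => Finset.sum_eq_zero fun A _ =>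
    Finset.sum_eq_zero fun B _ => ?_
  split_ifs
  · rw [blockProd_update, map_mul, map_mul, ← Matrix.map_apply (f := evalAt p),
      matDer_mul_eq_zero]
    simp
  · simp

end EvalAt

theorem evalAt_first_variation (S : SmoothMetric (variedDom g h V) (varied g h))
    (hO : IsOpen (variedDom g h V)) (r : ℕ) {y : Fin m → ℝ}
    (hy : ((0 : ℝ), y) ∈ variedDom g h V) :
    evalAt ⟨(0, y), hy⟩ (dirDer hO (1, 0) (S.lagrangian hO (.inr ℝ ℝ (Fin m → ℝ)) r))
      = 1 / 4 * (Real.sqrt |(g y).det| *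
          ∑ μ, ∑ ν, lovelockTensor r g (christoffel g) μ ν y * h y μ ν)
        + 2 * ∑ μ, pderiv μ
          (fun x => extZero (S.boundaryTerm hO r μ : variedDom g h V → ℝ) (0, x)) y := by
  have slice (x : Fin m → ℝ) := hasFDerivAt_prodMk_right (𝕜 := ℝ) (0 : ℝ) x
  have tensor_eq (μ ν : Fin m) : lovelockTensor r g (christoffel g) μ ν y
      = evalAt ⟨(0, y), hy⟩
        (lovTensor r (S.curvature hO (.inr ℝ ℝ (Fin m → ℝ))) S.Gi ν μ) := by
    rw [lovelockTensor_symm]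
    simpa only [varied_zero] using S.lovelockTensor_eq_evalAt hO slice r ν μ hy
  have density_eq : Real.sqrt |(g y).det| = evalAt ⟨(0, y), hy⟩ S.w := by
    rw [← S.w_eval, varied_zero]
  have first_variation := congrArg (evalAt ⟨(0, y), hy⟩)
    ((S.isLeviCivita hO (.inr ℝ ℝ (Fin m → ℝ))).first_variation S.pow_w (dirDer hO (1, 0))
      (fun _ _ => dirDer_comm hO _ _ _) r)
  simp only [map_mul, map_add, map_sum, map_ofNat, Matrix.trace, Matrix.diag_apply,
    Matrix.mul_apply, matDer_apply, evalAt_derivation_varied S hO] at first_variation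
  simp only [pderiv_eq_evalAt hO slice _ (fun _ hx => extZero_eq_evalAt _ hx) hy, density_eq,
    tensor_eq, mul_comm _ (h y _ _), SmoothMetric.lagrangian, SmoothMetric.curvature,
    SmoothMetric.boundaryTerm]
  linear_combination (1 / 4 : ℝ) * first_variation

theorem setIntegral_pderiv_boundaryTerm (S : SmoothMetric (variedDom g h V) (varied g h))
    (hV : IsOpen V) (hO : IsOpen (variedDom g h V)) (hd : ∀ y ∈ V, (g y).det ≠ 0)
    (hK : IsCompact K) (hKV : K ⊆ V) (hhK : tsupport h ⊆ K) (r : ℕ) (μ : Fin m) :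
    MeasureTheory.IntegrableOn (pderiv μ fun y =>
        extZero (S.boundaryTerm hO r μ : variedDom g h V → ℝ) (0, y)) K ∧
      ∫ y in K, pderiv μ (fun y =>
        extZero (S.boundaryTerm hO r μ : variedDom g h V → ℝ) (0, y)) y = 0 := by
  refine setIntegral_fderiv_eq_zero MeasureTheory.volume hV ?_ hK hKV (isClosed_tsupport h) hhK
    ?_ _
  · exact ((smoothFun.contDiffOn (S.boundaryTerm hO r μ)).comp (by fun_prop)
      fun y hy => mem_variedDom_zero hd hy).of_le (by exact_mod_cast le_top)
  · intro y hy
    by_cases hyO : ((0 : ℝ), y) ∈ variedDom g h V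
    · rw [extZero_eq_evalAt _ hyO]
      exact evalAt_boundaryTerm_eq_zero S hO hy r μ
    · exact extZero_of_notMem _ hyO

theorem hasDerivAt_action (hV : IsOpen V) (hg : ∀ i j, ContDiffOn ℝ ∞ (fun y => g y i j) V)
    (hd : ∀ y ∈ V, (g y).det ≠ 0) (hs : ∀ y ∈ V, (g y).IsSymm) (hK : IsCompact K)
    (hKV : K ⊆ V) (hh : ∀ i j, ContDiff ℝ ∞ fun y => h y i j) (hhs : ∀ y, (h y).IsSymm)
    (hhK : tsupport h ⊆ K) (r : ℕ) :
    HasDerivAt (fun t : ℝ => ∫ y in K, lovelockDensity r (fun x => g x + t • h x) y)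
      (∫ y in K, 1 / 4 * (Real.sqrt |(g y).det| *
        ∑ μ, ∑ ν, lovelockTensor r g (christoffel g) μ ν y * h y μ ν)) 0 := by
  have hO := isOpen_variedDom hV hg hh
  let S : SmoothMetric (variedDom g h V) (varied g h) := SmoothMetric.of _
    (fun i j => (contDiffOn_varied hg hh i j).mono fun p hp => hp.1) (fun p hp => hp.2)
    fun p hp => (hs _ hp.1).add ((hhs _).smul _)
  let L := S.lagrangian hO (.inr ℝ ℝ (Fin m → ℝ)) r
  obtain ⟨ε, hε, hεK⟩ := exists_closedBall_prod_subset hV hg hd hK hKV hh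
  obtain ⟨integrable_deriv, hasDerivAt_integral⟩ :=
    hasDerivAt_setIntegral hO L (μ := MeasureTheory.volume) hK hε hεK
  have boundary := setIntegral_pderiv_boundaryTerm S hV hO hd hK hKV hhK r
  have first_variation : ∫ y in K, 1 / 4 * (Real.sqrt |(g y).det| *
        ∑ μ, ∑ ν, lovelockTensor r g (christoffel g) μ ν y * h y μ ν)
      = ∫ y in K, extZero (dirDer hO (1, 0) L : variedDom g h V → ℝ) (0, y) := by
    rw [MeasureTheory.setIntegral_congr_fun hK.measurableSet fun y hy => eq_sub_of_add_eq
        (((extZero_eq_evalAt (dirDer hO (1, 0) L) (mem_variedDom_zero hd (hKV hy))).trans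
          (evalAt_first_variation S hO r (mem_variedDom_zero hd (hKV hy)))).symm),
      MeasureTheory.integral_sub integrable_deriv
        ((MeasureTheory.integrable_finsetSum _ fun μ _ => (boundary μ).1).const_mul 2),
      MeasureTheory.integral_const_mul,
      MeasureTheory.integral_finsetSum _ fun μ _ => (boundary μ).1]
    simp [boundary]
  rw [first_variation]
  refine hasDerivAt_integral.congr_of_eventuallyEq ?_
  filter_upwards [Metric.closedBall_mem_nhds 0 hε] with t ht
  refine MeasureTheory.setIntegral_congr_fun hK.measurableSet fun y hy => ?_
  exact (S.lovelockDensity_eq_evalAt hO (fun x => hasFDerivAt_prodMk_right t x) r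
    (hεK ⟨ht, hy⟩)).trans (extZero_eq_evalAt _ _).symm

theorem continuousOn_sqrt_mul_lovelockTensor (hV : IsOpen V)
    (hg : ∀ i j, ContDiffOn ℝ ∞ (fun y => g y i j) V) (hd : ∀ y ∈ V, (g y).det ≠ 0)
    (hs : ∀ y ∈ V, (g y).IsSymm) (r : ℕ) (μ ν : Fin m) :
    ContinuousOn (fun y => Real.sqrt |(g y).det| * lovelockTensor r g (christoffel g) μ ν y) V :=
  let S : SmoothMetric V g := SmoothMetric.of _ hg hd hs
  ((smoothFun.contDiffOn_of_eq S.w S.w_eval).mul (smoothFun.contDiffOn_of_eq _ fun p =>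
    S.lovelockTensor_eq_evalAt hV (fun x => hasFDerivAt_id x) r μ ν p.2)).continuousOn

/-- The variation of the components `g_{μν}` and `g_{νμ}` of the metric by the function `b`. -/
def componentVariation (b : (Fin m → ℝ) → ℝ) (μ ν : Fin m) (y : Fin m → ℝ) :
    Matrix (Fin m) (Fin m) ℝ :=
  b y • (Matrix.single μ ν 1 + Matrix.single ν μ 1)

theorem contDiff_componentVariation {b : (Fin m → ℝ) → ℝ} (hb : ContDiff ℝ ∞ b) (μ ν i j : Fin m) :
    ContDiff ℝ ∞ fun y => componentVariation b μ ν y i j := by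
  simp only [componentVariation, Matrix.smul_apply, smul_eq_mul]
  exact hb.mul contDiff_const

theorem isSymm_componentVariation (b : (Fin m → ℝ) → ℝ) (μ ν : Fin m) (y : Fin m → ℝ) :
    (componentVariation b μ ν y).IsSymm := by
  simp only [componentVariation, Matrix.IsSymm, Matrix.transpose_smul, Matrix.transpose_add,
    Matrix.transpose_single, add_comm]

theorem tsupport_componentVariation_subset (b : (Fin m → ℝ) → ℝ) (μ ν : Fin m) :
    tsupport (componentVariation b μ ν) ⊆ tsupport b :=
  closure_mono fun y hy hby => hy (by rw [componentVariation, hby, zero_smul])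

theorem sum_mul_componentVariation {A : Fin m → Fin m → ℝ} (hA : ∀ μ ν, A μ ν = A ν μ)
    (b : (Fin m → ℝ) → ℝ) (μ ν : Fin m) (y : Fin m → ℝ) :
    ∑ i, ∑ j, A i j * componentVariation b μ ν y i j = 2 * (b y * A μ ν) := by
  simp only [componentVariation, Matrix.smul_apply, Matrix.add_apply, smul_eq_mul,
    Matrix.single_apply, mul_add, Finset.sum_add_distrib]
  simp [ite_and, hA ν μ]
  ring

theorem IsLovelockExtremal.integral_mul_lovelockTensor_eq_zero {r : ℕ}
    (H : IsLovelockExtremal r g V) (hV : IsOpen V)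
    (hg : ∀ i j, ContDiffOn ℝ ∞ (fun y => g y i j) V) (hd : ∀ y ∈ V, (g y).det ≠ 0)
    (hs : ∀ y ∈ V, (g y).IsSymm) (μ ν : Fin m) {b : (Fin m → ℝ) → ℝ} (hb : ContDiff ℝ ∞ b)
    (hbc : HasCompactSupport b) (hbV : tsupport b ⊆ V) :
    ∫ y, b y * (Real.sqrt |(g y).det| * lovelockTensor r g (christoffel g) μ ν y) = 0 := by
  have smooth := contDiff_componentVariation hb μ ν
  have symm := isSymm_componentVariation b μ ν
  have support := tsupport_componentVariation_subset b μ ν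
  have first_variation := (hasDerivAt_action hV hg hd hs hbc hbV smooth symm support r).unique
    (H _ hbc hbV _ smooth symm support)
  simp only [sum_mul_componentVariation fun μ ν => lovelockTensor_symm r g _ μ ν _]
    at first_variation
  calc _ = ∫ y in tsupport b,
          b y * (Real.sqrt |(g y).det| * lovelockTensor r g (christoffel g) μ ν y) := by
        refine (MeasureTheory.setIntegral_eq_integral_of_forall_compl_eq_zero fun y hy => ?_).symm
        rw [image_eq_zero_of_notMem_tsupport hy, zero_mul]
    _ = 2 * ∫ y in tsupport b, 1 / 4 * (Real.sqrt |(g y).det| *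
          (2 * (b y * lovelockTensor r g (christoffel g) μ ν y))) := by
        rw [← MeasureTheory.integral_const_mul]
        congr 1
        ext y
        ring
    _ = 0 := by rw [first_variation, mul_zero]

theorem isLovelockExtremal_iff (hV : IsOpen V) (hg : ∀ i j, ContDiffOn ℝ ∞ (fun y => g y i j) V)
    (hd : ∀ y ∈ V, (g y).det ≠ 0) (hs : ∀ y ∈ V, (g y).IsSymm) (r : ℕ) :
    IsLovelockExtremal r g V ↔
      ∀ y ∈ V, ∀ μ ν, lovelockTensor r g (christoffel g) μ ν y = 0 := by
  constructor
  · intro H y hy μ ν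
    have density_mul_eq_zero := eq_zero_of_integral_contDiff_mul_eq_zero MeasureTheory.volume hV
      (continuousOn_sqrt_mul_lovelockTensor hV hg hd hs r μ ν) (fun _ hb hbc hbV =>
        H.integral_mul_lovelockTensor_eq_zero hV hg hd hs μ ν hb hbc hbV) y hy
    exact (mul_eq_zero.mp density_mul_eq_zero).resolve_left
      (Real.sqrt_pos.mpr (abs_pos.mpr (hd y hy))).ne'
  · intro H K hK hKV h hh hhs hhK
    have first_variation := hasDerivAt_action hV hg hd hs hK hKV hh hhs hhK r
    rwa [MeasureTheory.setIntegral_congr_fun hK.measurableSet (g := fun _ => (0 : ℝ))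
      (fun y hy => by simp [H y (hKV hy)]), MeasureTheory.integral_zero] at first_variation

end Variation

/-! ### Exterior products of coordinate differentials -/

section VolumeForm

variable {m : ℕ}

theorem leviCivita_mul_leviCivita (f h : Fin m → Fin m) :
    leviCivita f * leviCivita h = kronecker f h := by
  have deltaMat_mul : deltaMat ℝ f id * deltaMat ℝ id h = deltaMat ℝ f h := by
    ext a b
    simp [deltaMat, Matrix.mul_apply]
  calc leviCivita f * leviCivita h = kronecker f id * kronecker id h := by
        rw [kronecker_comm id h]
        rfl
    _ = (deltaMat ℝ f id * deltaMat ℝ id h).det := (Matrix.det_mul _ _).symm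
    _ = kronecker f h := by
        rw [deltaMat_mul]
        rfl

theorem leviCivita_perm (e : Equiv.Perm (Fin m)) :
    leviCivita e = ((Equiv.Perm.sign e : ℤ) : ℝ) := by
  rw [← Matrix.det_permutation, leviCivita]
  congr 1
  ext a b
  simp [PEquiv.toMatrix_apply, eq_comm]

theorem leviCivita_of_not_injective {f : Fin m → Fin m} (hf : ¬ f.Injective) :
    leviCivita f = 0 := by
  obtain ⟨a, b, hab, hne⟩ := Function.not_injective_iff.mp hf
  exact Matrix.det_zero_of_row_eq hne (by ext c; simp [hab])

/-- The coordinate differential `dx^μ` as a form. -/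
def dxForm (μ : Fin m) : Forms (Fin m → ℝ) := oneForm (ContinuousLinearMap.proj μ)

variable (m) in
/-- The form `dx^1 ∧ … ∧ dx^m`. -/
def volForm : Forms (Fin m → ℝ) :=
  ExteriorAlgebra.ιMulti ℝ m fun μ : Fin m =>
    (ContinuousLinearMap.proj μ : (Fin m → ℝ) →L[ℝ] ℝ)

theorem prod_dxForm (f : Fin m → Fin m) :
    (List.ofFn fun i => dxForm (f i)).prod = leviCivita f • volForm m := by
  let dx (μ : Fin m) : (Fin m → ℝ) →L[ℝ] ℝ := ContinuousLinearMap.proj μ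
  refine (ExteriorAlgebra.ιMulti_apply (R := ℝ) (dx ∘ f)).symm.trans ?_
  by_cases hf : f.Injective
  · let e : Equiv.Perm (Fin m) := Equiv.ofBijective f (Finite.injective_iff_bijective.mp hf)
    refine (AlternatingMap.map_perm _ dx e).trans ?_
    rw [show leviCivita f = _ from leviCivita_perm e, Units.smul_def, Int.cast_smul_eq_zsmul]
    rfl
  · rw [leviCivita_of_not_injective hf, zero_smul]
    exact AlternatingMap.map_eq_zero_of_not_injective _ _ fun h => hf h.of_comp

theorem volForm_ne_zero : volForm m ≠ 0 := by
  let dx (μ : Fin m) : (Fin m → ℝ) →L[ℝ] ℝ := ContinuousLinearMap.proj μ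
  let ev (μ : Fin m) : Module.Dual ℝ ((Fin m → ℝ) →L[ℝ] ℝ) :=
    (ContinuousLinearMap.apply ℝ ℝ (Pi.single μ 1)).toLinearMap
  have pairing_eq_one := exteriorPower.pairingDual_apply_apply_eq_one dx ev
    (by simp [dx, ev]) (fun i j hij => by simp [dx, ev, hij.symm]) m (RelEmbedding.refl _)
  intro vol_eq_zero
  rw [show exteriorPower.ιMulti ℝ m (dx ∘ RelEmbedding.refl (· ≤ ·)) = 0 from
    Subtype.ext vol_eq_zero, map_zero] at pairing_eq_one
  exact zero_ne_one pairing_eq_one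

end VolumeForm

section JoinIdx

variable {m p : ℕ}

/-- The concatenation of `I` and `L`, in the form in which it enters the Sparling forms. -/
def joinIdx (I : Fin p → Fin m) (L : Fin (m - p) → Fin m) (a : Fin m) : Fin m :=
  if h : (a : ℕ) < p then I ⟨a, h⟩ else L ⟨(a : ℕ) - p, by have := a.isLt; omega⟩

/-- The positions of the concatenation of sequences of lengths `p` and `m - p`. -/
def joinEquiv (hp : p ≤ m) : Fin p ⊕ Fin (m - p) ≃ Fin m :=
  finSumFinEquiv.trans (finCongr (by omega))

variable (hp : p ≤ m)
include hp

theorem joinIdx_comp (I : Fin p → Fin m) (L : Fin (m - p) → Fin m) :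
    joinIdx I L ∘ joinEquiv hp = Sum.elim I L := by
  ext x
  rcases x with x | x <;> simp [joinIdx, joinEquiv]

theorem prod_joinIdx {S : Type*} [CommMonoid S] (F : Fin m → Fin m → S) (I J : Fin p → Fin m)
    (L K : Fin (m - p) → Fin m) :
    ∏ a, F (joinIdx I L a) (joinIdx J K a) = (∏ i, F (I i) (J i)) * ∏ c, F (L c) (K c) := by
  rw [← Equiv.prod_comp (joinEquiv hp), Fintype.prod_sum_type]
  simp only [← Function.comp_apply (g := joinEquiv hp), joinIdx_comp hp, Sum.elim_inl,
    Sum.elim_inr]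

theorem sum_joinIdx {S : Type*} [AddCommMonoid S] (F : (Fin m → Fin m) → S) :
    ∑ I : Fin p → Fin m, ∑ L, F (joinIdx I L) = ∑ f, F f := by
  rw [← Equiv.sum_comp ((joinEquiv hp).arrowCongr (Equiv.refl (Fin m))),
    ← Equiv.sum_comp (Equiv.sumArrowEquivProdArrow _ _ _).symm, Fintype.sum_prod_type]
  refine Finset.sum_congr rfl fun I _ => Finset.sum_congr rfl fun L _ => congrArg F ?_
  rw [← Equiv.symm_apply_eq, Equiv.arrowCongr_symm]
  exact joinIdx_comp hp I L

theorem prod_ofFn_mul_prod_ofFn {Λ : Type*} [Monoid Λ] (θ : Fin m → Λ) (I : Fin p → Fin m)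
    (L : Fin (m - p) → Fin m) :
    (List.ofFn fun i => θ (I i)).prod * (List.ofFn fun c => θ (L c)).prod
      = (List.ofFn fun a => θ (joinIdx I L a)).prod := by
  rw [← List.prod_append, ← List.ofFn_fin_append, List.ofFn_congr (Nat.add_sub_of_le hp)]
  congr 2
  ext1 a
  obtain ⟨x, rfl⟩ := (joinEquiv hp).surjective a
  rw [← Function.comp_apply (f := joinIdx I L), joinIdx_comp]
  rcases x with x | x <;> simp [joinEquiv]

end JoinIdx

section SparlingOf

variable {m p : ℕ} {Λ : Type*} [Ring Λ] [Algebra ℝ Λ]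

/-- The Sparling forms of a family `θ` of forms of degree one. -/
def sparlingOf (θ : Fin m → Λ) (I : Fin p → Fin m) : Λ :=
  ((m - p).factorial : ℝ)⁻¹ • ∑ L : Fin (m - p) → Fin m,
    leviCivita (joinIdx I L) • (List.ofFn fun c => θ (L c)).prod

theorem prod_dxForm_mul_sparlingOf (hp : p ≤ m) (I J : Fin p → Fin m) :
    (List.ofFn fun i => dxForm (I i)).prod * sparlingOf dxForm J = kronecker I J • volForm m := by
  have leviCivita_mul (L : Fin (m - p) → Fin m) :
      leviCivita (joinIdx J L) * leviCivita (joinIdx I L)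
        = kronecker (Sum.elim I L) (Sum.elim J L) := by
    rw [leviCivita_mul_leviCivita, kronecker_comm, ← kronecker_comp_equiv (joinEquiv hp),
      joinIdx_comp, joinIdx_comp]
  simp only [sparlingOf, mul_smul_comm, Finset.mul_sum, prod_ofFn_mul_prod_ofFn hp dxForm,
    prod_dxForm, smul_smul, leviCivita_mul]
  rw [← Finset.sum_smul, sum_kronecker_sumElim _ _ _ (by simp [hp]), smul_smul,
    inv_mul_cancel_left₀ (by positivity)]

theorem prod_ofFn_sum_smul {ι : Type*} [Fintype ι] {n : ℕ} (c : Fin n → ι → ℝ)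
    (δ : Fin n → ι → Λ) :
    (List.ofFn fun i => ∑ x, c i x • δ i x).prod
      = ∑ f : Fin n → ι, (∏ i, c i (f i)) • (List.ofFn fun i => δ i (f i)).prod := by
  classical
  simpa only [MultilinearMap.map_smul_univ, MultilinearMap.mkPiAlgebraFin_apply] using
    (MultilinearMap.mkPiAlgebraFin ℝ n Λ).map_sum (g := fun i x => c i x • δ i x)

theorem sum_leviCivita_mul_prod (Q : Matrix (Fin m) (Fin m) ℝ) (h : Fin m → Fin m) :
    ∑ f : Fin m → Fin m, leviCivita f * ∏ a, Q (f a) (h a) = Q.det * leviCivita h := by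
  have expand_rows := (Matrix.detRowAlternating (R := ℝ) (n := Fin m)).toMultilinearMap.map_sum
    (g := fun a b => Q b (h a) • fun c => if b = c then (1 : ℝ) else 0)
  calc _ = ∑ f : Fin m → Fin m, (Matrix.detRowAlternating (R := ℝ) (n := Fin m))
          fun a => Q (f a) (h a) • fun c => if f a = c then (1 : ℝ) else 0 := by
        refine Finset.sum_congr rfl fun f _ => ?_
        rw [AlternatingMap.map_smul_univ, mul_comm]
        rfl
    _ = (deltaMat ℝ h id * Qᵀ).det := by
        refine expand_rows.symm.trans (congrArg Matrix.det ?_)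
        ext a b
        simp [deltaMat, Matrix.mul_apply, Finset.sum_apply]
    _ = Q.det * leviCivita h := by
        rw [Matrix.det_mul, Matrix.det_transpose, mul_comm]
        rfl

theorem sum_smul_sparlingOf (Q : Matrix (Fin m) (Fin m) ℝ) {θ δ : Fin m → Λ}
    (hθ : ∀ k, θ k = ∑ μ, Q k μ • δ μ) (hp : p ≤ m) (J : Fin p → Fin m) :
    ∑ I : Fin p → Fin m, (∏ i, Q (I i) (J i)) • sparlingOf θ I = Q.det • sparlingOf δ J := by
  have contract_leviCivita (K : Fin (m - p) → Fin m) :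
      ∑ I : Fin p → Fin m, ∑ L : Fin (m - p) → Fin m,
        (∏ i, Q (I i) (J i)) * (leviCivita (joinIdx I L) * ∏ c, Q (L c) (K c))
          = Q.det * leviCivita (joinIdx J K) := by
    rw [← sum_leviCivita_mul_prod, ← sum_joinIdx hp]
    simp only [prod_joinIdx hp Q, mul_left_comm]
  simp only [sparlingOf, hθ, prod_ofFn_sum_smul, smul_comm _ (((m - p).factorial : ℝ)⁻¹),
    ← Finset.smul_sum]
  congr 1
  simp only [Finset.smul_sum, smul_smul, ← contract_leviCivita, Finset.sum_smul]
  rw [Finset.sum_comm_cycle]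

end SparlingOf

section BlockOrder

variable {m n : ℕ}

/-- The order of the indices `(i₁, j₁, i₂, …, i_r, j₂, …, j_r)`, in which the `n + 1 = r` pairs
of indices enter the Sparling form in `Psi`. -/
def indexOrder (n : ℕ) : Fin (2 + (n + n)) ≃ Fin (n + 1) × Fin 2 :=
  finSumFinEquiv.symm.trans <| ((Equiv.refl _).sumCongr finSumFinEquiv.symm).trans
    { toFun := Sum.elim (fun c => (0, c)) (Sum.elim (fun k => (k.succ, 0)) fun k => (k.succ, 1))
      invFun := fun p => Fin.cases (Sum.inl p.2)
        (fun k => Sum.inr (if p.2 = 0 then Sum.inl k else Sum.inr k)) p.1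
      left_inv := by rintro (_ | _ | _) <;> simp
      right_inv := by
        rintro ⟨k, c⟩
        refine Fin.cases (by simp) (fun k => ?_) k
        fin_cases c <;> simp }

/-- The order of the indices `(i₁, j₁, i₂, j₂, …, i_r, j_r)`, in which the `n + 1 = r` pairs of
indices enter a product of curvature forms. -/
def pairOrder (n : ℕ) : Fin (2 + (n + n)) ≃ Fin (n + 1) × Fin 2 :=
  (finCongr (by omega)).trans finProdFinEquiv.symm

/-- The sign of the permutation which relates `pairOrder` and `indexOrder`. -/
def orderSign (n : ℕ) : ℝ :=
  ((Equiv.Perm.sign ((indexOrder n).symm.trans (pairOrder n)) : ℤ) : ℝ)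

theorem orderSign_ne_zero : orderSign n ≠ 0 :=
  Int.cast_ne_zero.mpr (Units.ne_zero _)

theorem kronecker_comp_pairOrder (A B : Fin (n + 1) × Fin 2 → Fin m) :
    kronecker (A ∘ pairOrder n) (B ∘ indexOrder n) = orderSign n * kronecker A B := by
  rw [← kronecker_comp_equiv (indexOrder n).symm, orderSign, ← kronecker_comp_perm]
  congr 1
  ext x
  simp

theorem append_indexOrder {α : Type*} (B : Fin (n + 1) × Fin 2 → α) :
    Fin.append ![B (0, 0), B (0, 1)]
        (Fin.append (fun k : Fin n => B (k.succ, 0)) fun k => B (k.succ, 1))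
      = B ∘ indexOrder n := by
  ext i
  refine Fin.addCases (fun c => ?_) (fun i => ?_) i
  · fin_cases c <;> simp [indexOrder]
  · refine Fin.addCases (fun k => ?_) (fun k => ?_) i <;> simp [indexOrder, -Fin.natAdd_eq_addNat]

/-- Splitting off the first pair of indices, and separating the others. -/
def splitIndices (n : ℕ) (α : Type*) :
    (Fin (n + 1) × Fin 2 → α) ≃ α × α × (Fin n → α) × (Fin n → α) where
  toFun B := (B (0, 0), B (0, 1), fun k => B (k.succ, 0), fun k => B (k.succ, 1))
  invFun q p := Fin.cases (if p.2 = 0 then q.1 else q.2.1)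
    (fun k => if p.2 = 0 then q.2.2.1 k else q.2.2.2 k) p.1
  left_inv B := by
    ext ⟨k, c⟩
    refine Fin.cases ?_ (fun k => ?_) k <;> fin_cases c <;> simp
  right_inv q := by simp

theorem sum_splitIndices {α S : Type*} [Fintype α] [AddCommMonoid S]
    (F : α → α → (Fin n → α) → (Fin n → α) → S) :
    ∑ c, ∑ t, ∑ I, ∑ J, F c t I J = ∑ B : Fin (n + 1) × Fin 2 → α,
      F (B (0, 0)) (B (0, 1)) (fun k => B (k.succ, 0)) fun k => B (k.succ, 1) := by
  have sum_comp := Equiv.sum_comp (splitIndices n α) fun q => F q.1 q.2.1 q.2.2.1 q.2.2.2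
  simp only [Fintype.sum_prod_type] at sum_comp
  exact sum_comp.symm

theorem prod_ofFn_pairs {Λ : Type*} [Monoid Λ] (θ : Fin n × Fin 2 → Λ) :
    (List.ofFn fun j => θ (j, 0) * θ (j, 1)).prod
      = (List.ofFn fun i : Fin (n * 2) => θ (finProdFinEquiv.symm i)).prod := by
  rw [List.ofFn_mul, List.prod_flatten, List.map_ofFn]
  congr 2
  ext j
  have position (c : Fin 2) (h : (j : ℕ) * 2 + c < n * 2) :
      finProdFinEquiv.symm (⟨(j : ℕ) * 2 + c, h⟩ : Fin (n * 2)) = (j, c) := by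
    rw [Equiv.symm_apply_eq]
    ext
    simp [finProdFinEquiv, mul_comm, add_comm]
  simp only [Function.comp_apply, position]
  simp [List.ofFn_succ]

theorem prod_pairs_dxForm_mul_sparlingOf (hp : 2 + (n + n) ≤ m)
    (A B : Fin (n + 1) × Fin 2 → Fin m) :
    (List.ofFn fun j => dxForm (A (j, 0)) * dxForm (A (j, 1))).prod
        * sparlingOf dxForm (B ∘ indexOrder n) = (orderSign n * kronecker A B) • volForm m := by
  rw [← kronecker_comp_pairOrder, ← prod_dxForm_mul_sparlingOf hp,
    prod_ofFn_pairs fun q => dxForm (A q),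
    List.ofFn_congr (show (n + 1) * 2 = 2 + (n + n) by omega)]
  rfl

/-- The form `Y_{αβ} dx^α ∧ dx^β` of degree two. -/
def twoForm (Y : Fin m → Fin m → ℝ) : Forms (Fin m → ℝ) :=
  ∑ α, ∑ β, Y α β • (dxForm α * dxForm β)

end BlockOrder

section ListBlockProd

variable {m n : ℕ} {Λ : Type*} [Ring Λ]

/-- The ordered product of the entries of the matrices `M j` at the pairs of indices given by `B`;
unlike `blockProd`, it makes sense over a noncommutative ring. -/
def listBlockProd {ι : Type*} (M : Fin n → Matrix ι ι Λ) (B : Fin n × Fin 2 → ι) : Λ :=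
  (List.ofFn fun j => M j (B (j, 0)) (B (j, 1))).prod

variable [Algebra ℝ Λ]

theorem prod_ofFn_sum_sum_smul {ι : Type*} [Fintype ι] (c : Fin n → ι → ι → ℝ)
    (δ : Fin n → ι → ι → Λ) :
    (List.ofFn fun j => ∑ x, ∑ y, c j x y • δ j x y).prod
      = ∑ C : Fin n × Fin 2 → ι, (∏ j, c j (C (j, 0)) (C (j, 1))) •
          (List.ofFn fun j => δ j (C (j, 0)) (C (j, 1))).prod := by
  let pairs : (Fin n × Fin 2 → ι) ≃ (Fin n → ι × ι) :=
    (Equiv.curry _ _ _).trans ((Equiv.refl _).arrowCongr (finTwoArrowEquiv ι))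
  simp only [← Fintype.sum_prod_type']
  rw [prod_ofFn_sum_smul, ← Equiv.sum_comp pairs]
  rfl

theorem sum_listBlockProd_mul_sparlingOf (Q : Matrix (Fin m) (Fin m) ℝ) {θ δ : Fin m → Λ}
    (hθ : ∀ k, θ k = ∑ μ, Q k μ • δ μ) (hp : 2 + (n + n) ≤ m)
    {M N : Fin (n + 1) → Matrix (Fin m) (Fin m) Λ}
    (hM : ∀ j a b, M j a b = ∑ x, ∑ y, (Q a x * Q b y) • N j x y) :
    ∑ B, listBlockProd M B * sparlingOf θ (B ∘ indexOrder n)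
      = Q.det • ∑ C, listBlockProd N C * sparlingOf δ (C ∘ indexOrder n) := by
  have prod_blocks (B C : Fin (n + 1) × Fin 2 → Fin m) :
      ∏ j, Q (B (j, 0)) (C (j, 0)) * Q (B (j, 1)) (C (j, 1))
        = ∏ i, Q ((B ∘ indexOrder n) i) ((C ∘ indexOrder n) i) := by
    simpa only [Function.comp_apply, Fintype.prod_prod_type, Fin.prod_univ_two] using
      (Equiv.prod_comp (indexOrder n) fun b => Q (B b) (C b)).symm
  have expand (B : Fin (n + 1) × Fin 2 → Fin m) :
      listBlockProd M B = ∑ C : Fin (n + 1) × Fin 2 → Fin m,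
        (∏ i, Q ((B ∘ indexOrder n) i) ((C ∘ indexOrder n) i)) • listBlockProd N C := by
    simp only [listBlockProd, hM, ← prod_blocks]
    exact prod_ofFn_sum_sum_smul (fun j x y => Q (B (j, 0)) x * Q (B (j, 1)) y)
      fun j x y => N j x y
  simp only [expand, Finset.sum_mul, Finset.smul_sum]
  rw [Finset.sum_comm]
  refine Finset.sum_congr rfl fun C _ => ?_
  rw [← mul_smul_comm, ← sum_smul_sparlingOf Q hθ hp, Finset.mul_sum,
    ← Equiv.sum_comp ((indexOrder n).symm.arrowCongr (Equiv.refl (Fin m)))]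
  refine Finset.sum_congr rfl fun B _ => ?_
  rw [smul_mul_assoc, ← mul_smul_comm]
  rfl

theorem sum_listBlockProd_mul_sparlingOf_dxForm (hp : 2 + (n + n) ≤ m)
    (Y : Fin (n + 1) → Fin m → Fin m → Matrix (Fin m) (Fin m) ℝ)
    {N : Fin (n + 1) → Matrix (Fin m) (Fin m) (Forms (Fin m → ℝ))}
    (hN : ∀ j a b, N j a b = twoForm fun α β => Y j α β a b) :
    ∑ C, listBlockProd N C * sparlingOf dxForm (C ∘ indexOrder n)
      = (orderSign n * krSum fun A C : Fin (n + 1) × Fin 2 → Fin m =>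
          blockProd (fun j => Y j (A (j, 0)) (A (j, 1))) C) • volForm m := by
  rw [krSum, Finset.sum_comm, Finset.mul_sum, Finset.sum_smul]
  refine Finset.sum_congr rfl fun C _ => ?_
  simp only [listBlockProd, hN, twoForm]
  rw [prod_ofFn_sum_sum_smul (fun j α β => Y j α β (C (j, 0)) (C (j, 1)))
    (fun _ α β => dxForm α * dxForm β), Finset.sum_mul, Finset.mul_sum, Finset.sum_smul]
  refine Finset.sum_congr rfl fun A _ => ?_
  rw [smul_mul_assoc, prod_pairs_dxForm_mul_sparlingOf hp, smul_smul]
  congr 1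
  simp only [blockProd, Algebra.algebraMap_self, RingHom.id_apply]
  ring

end ListBlockProd

/-! ### The forms `Ψ` and the Lovelock tensor -/

section TwoForm

variable {m : ℕ}

theorem oneForm_mul_oneForm_swap {E : Type*} [NormedAddCommGroup E] [NormedSpace ℝ E]
    (α β : E →L[ℝ] ℝ) : oneForm α * oneForm β = -(oneForm β * oneForm α) :=
  eq_neg_of_add_eq_zero_left (ExteriorAlgebra.ι_add_mul_swap α β)

theorem commute_oneForm_mul_oneForm {E : Type*} [NormedAddCommGroup E] [NormedSpace ℝ E]
    (α β : E →L[ℝ] ℝ) (x : Forms E) : Commute (oneForm α * oneForm β) x := by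
  induction x using ExteriorAlgebra.induction with
  | algebraMap r => exact Algebra.commute_algebraMap_right r _
  | ι c =>
    change oneForm α * oneForm β * oneForm c = oneForm c * (oneForm α * oneForm β)
    rw [mul_assoc, oneForm_mul_oneForm_swap β c, mul_neg, ← mul_assoc,
      oneForm_mul_oneForm_swap α c, neg_mul, neg_neg, mul_assoc]
  | mul a b ha hb => exact ha.mul_right hb
  | add a b ha hb => exact ha.add_right hb

theorem commute_twoForm (Y : Fin m → Fin m → ℝ) (x : Forms (Fin m → ℝ)) :
    Commute (twoForm Y) x :=
  Commute.sum_left _ _ _ fun _ _ => Commute.sum_left _ _ _ fun _ _ =>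
    (commute_oneForm_mul_oneForm _ _ x).smul_left _

theorem twoForm_sum {ι : Type*} [Fintype ι] (Y : ι → Fin m → Fin m → ℝ) :
    (twoForm fun α β => ∑ i, Y i α β) = ∑ i, twoForm (Y i) := by
  simp only [twoForm, Finset.sum_smul]
  rw [Finset.sum_comm_cycle]

theorem twoForm_add (Y Z : Fin m → Fin m → ℝ) :
    (twoForm fun α β => Y α β + Z α β) = twoForm Y + twoForm Z := by
  simp only [twoForm, add_smul, Finset.sum_add_distrib]

theorem twoForm_smul (c : ℝ) (Y : Fin m → Fin m → ℝ) :
    (twoForm fun α β => c * Y α β) = c • twoForm Y := by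
  simp only [twoForm, mul_smul, Finset.smul_sum]

theorem twoForm_conj (Q : Matrix (Fin m) (Fin m) ℝ) (Y : Fin m → Fin m → Matrix (Fin m) (Fin m) ℝ)
    (a b : Fin m) :
    (twoForm fun α β => (Q * Y α β * Qᵀ) a b)
      = ∑ x, ∑ y, (Q a x * Q b y) • twoForm fun α β => Y α β x y := by
  have conj_apply (α β : Fin m) :
      (Q * Y α β * Qᵀ) a b = ∑ x, ∑ y, Q a x * Q b y * Y α β x y := by
    simp only [Matrix.mul_apply, Matrix.transpose_apply, Finset.sum_mul]
    rw [Finset.sum_comm]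
    simp only [mul_right_comm]
  simp only [conj_apply, twoForm_sum, twoForm_smul]

theorem twoForm_flip (Y : Fin m → Fin m → ℝ) : (twoForm fun α β => Y β α) = -twoForm Y := by
  rw [twoForm, Finset.sum_comm, twoForm, ← Finset.sum_neg_distrib]
  refine Finset.sum_congr rfl fun α _ => ?_
  rw [← Finset.sum_neg_distrib]
  refine Finset.sum_congr rfl fun β _ => ?_
  rw [dxForm, dxForm, oneForm_mul_oneForm_swap, smul_neg]

theorem twoForm_antisymm (Y : Fin m → Fin m → ℝ) :
    (twoForm fun α β => (1 / 2 : ℝ) * (Y α β - Y β α)) = twoForm Y := by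
  calc (twoForm fun α β => (1 / 2 : ℝ) * (Y α β - Y β α))
      = twoForm fun α β => (1 / 2 : ℝ) * (Y α β + -1 * Y β α) := by
        simp only [neg_one_mul, sub_eq_add_neg]
    _ = (1 / 2 : ℝ) • (twoForm Y + (-1 : ℝ) • -twoForm Y) := by
        rw [twoForm_smul, twoForm_add, twoForm_smul, twoForm_flip Y]
    _ = twoForm Y := by module

theorem twoForm_eq_zero_of_symm {Y : Fin m → Fin m → ℝ} (hY : ∀ α β, Y α β = Y β α) :
    twoForm Y = 0 := by
  rw [← twoForm_antisymm Y]
  simp only [twoForm, hY _ _, sub_self, mul_zero, zero_smul, Finset.sum_const_zero]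

end TwoForm

section LovPartial

variable {m n : ℕ} {R : Type*} [CommRing R] [Algebra ℝ R]
  (X : Fin m → Fin m → Matrix (Fin m) (Fin m) R)

theorem lovPartial_eq_zero_block (k : Fin (n + 1)) :
    lovPartial X (k, 1) = lovPartial X ((0 : Fin (n + 1)), 1) := by
  ext μ ρ
  let e : Fin (n + 1) × Fin 2 ≃ Fin (n + 1) × Fin 2 :=
    (Equiv.swap k 0).prodCongr (Equiv.refl _)
  rw [lovPartial, lovPartial, Matrix.of_apply, Matrix.of_apply, ← krSum_comp_equiv e]
  congr 1
  ext A B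
  have moved_entry : (B ∘ e) (k, 1) = B (0, 1) := by simp [e]
  have moved_update : Function.update (B ∘ e) (k, 1) μ = Function.update B (0, 1) μ ∘ e := by
    rw [Function.update_comp_equiv]
    congr 1
    simp [e]
  rw [moved_entry, moved_update]
  split_ifs
  · rw [blockProd, blockProd, ← Equiv.prod_comp (Equiv.swap k 0)]
    exact Finset.prod_congr rfl fun j _ => by simp [blocks, e]
  · rfl

theorem trace_lovPartial (k : Fin n) : (lovPartial X (k, 1)).trace = lovScalar n X := by
  rw [← Matrix.trace_transpose, ← one_mul (lovPartial X (k, 1))ᵀ, ← krSum_blockProd_update_mul]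
  simp only [mul_one]
  congr 1
  ext A B
  exact congrArg (fun Q => blockProd Q B) (Function.update_eq_self k (blocks X A))

theorem lovMixed_succ (hX : ∀ α β, (X α β)ᵀ = -X α β) :
    lovMixed (n + 1) X = lovScalar (n + 1) X • 1
      - (2 * (n + 1) : R) • lovPartial X ((0 : Fin (n + 1)), 1) := by
  simp only [lovMixed_eq X hX, lovPartial_eq_zero_block X, Finset.sum_const, Finset.card_univ,
    Fintype.card_fin, ← Nat.cast_smul_eq_nsmul R, smul_smul]
  push_cast
  rfl

end LovPartial

section PsiBracket

variable {m n : ℕ}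

/-- The matrix with which the curvature has to be multiplied in order to obtain the first factor of
`Ψ^{ab}`, where `Q` is the coframe and `gi` the inverse metric. -/
def psiBracket (n : ℕ) (Q gi : Matrix (Fin m) (Fin m) ℝ) (a b : Fin m) :
    Matrix (Fin m) (Fin m) ℝ :=
  Matrix.vecMulVec (Q a) ((Q * gi) b) + Matrix.vecMulVec (Q b) ((Q * gi) a)
    - (1 / ((n + 1 : ℕ) : ℝ) * (Q * gi * Qᵀ) a b) • 1

variable {gi : Matrix (Fin m) (Fin m) ℝ} (Q : Matrix (Fin m) (Fin m) ℝ) (hgi : gi.IsSymm)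
include hgi

theorem conj_mul_psiBracket (Y : Matrix (Fin m) (Fin m) ℝ) (a b c t : Fin m) :
    (Q * (Y * psiBracket n Q gi a b) * Qᵀ) c t
      = (Q * gi * Qᵀ) t b * (Q * Y * Qᵀ) c a + (Q * gi * Qᵀ) t a * (Q * Y * Qᵀ) c b
        - (1 / ((n + 1 : ℕ) : ℝ) * (Q * gi * Qᵀ) a b) * (Q * Y * Qᵀ) c t := by
  have frame_symm (b : Fin m) : (Q * gi * Qᵀ) b t = (Q * gi * Qᵀ) t b :=
    Matrix.IsSymm.apply (A := Q * gi * Qᵀ)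
      (by simp only [Matrix.IsSymm, Matrix.transpose_mul, Matrix.transpose_transpose, hgi.eq,
        mul_assoc]) t b
  have conj_vecMulVec (a b : Fin m) :
      (Q * (Y * Matrix.vecMulVec (Q a) ((Q * gi) b)) * Qᵀ) c t
        = (Q * gi * Qᵀ) t b * (Q * Y * Qᵀ) c a := by
    rw [Matrix.mul_vecMulVec, Matrix.mul_vecMulVec, Matrix.vecMulVec_mul,
      Matrix.vecMulVec_apply, mul_comm, ← frame_symm, Matrix.mulVec_mulVec]
    rfl
  simp only [psiBracket, Matrix.mul_smul, Matrix.smul_mul, mul_sub, mul_add, sub_mul, add_mul,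
    Matrix.sub_apply, Matrix.add_apply, Matrix.smul_apply, smul_eq_mul, conj_vecMulVec, mul_one]

theorem trace_psiBracket_mul (X : Fin m → Fin m → Matrix (Fin m) (Fin m) ℝ)
    (hX : ∀ α β, (X α β)ᵀ = -X α β) (a b : Fin m) :
    (psiBracket n Q gi a b * (lovPartial X ((0 : Fin (n + 1)), 1))ᵀ).trace
      = -(1 / (2 * ((n + 1 : ℕ) : ℝ))) * (Q * lovTensor (n + 1) X gi * Qᵀ) a b := by
  set E := lovPartial X ((0 : Fin (n + 1)), 1) with hE
  have trace_vecMulVec (a b : Fin m) :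
      (Matrix.vecMulVec (Q a) ((Q * gi) b) * Eᵀ).trace = (Q * (E * gi) * Qᵀ) a b := by
    rw [Matrix.vecMulVec_mul, Matrix.trace_vecMulVec, Matrix.vecMul_transpose,
      show Q * (E * gi) * Qᵀ = Q * (E * (Q * gi)ᵀ) by
        rw [Matrix.transpose_mul, hgi.eq]; simp only [mul_assoc]]
    rfl
  have trace_transpose : Eᵀ.trace = lovScalar (n + 1) X := by
    rw [Matrix.trace_transpose, hE, trace_lovPartial]
  have trace_bracket : (psiBracket n Q gi a b * Eᵀ).trace
      = (Q * (E * gi) * Qᵀ) a b + (Q * (E * gi) * Qᵀ) b a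
        - 1 / ((n + 1 : ℕ) : ℝ) * (Q * gi * Qᵀ) a b * lovScalar (n + 1) X := by
    simp only [psiBracket, sub_mul, add_mul, Matrix.smul_mul, one_mul, Matrix.trace_sub,
      Matrix.trace_add, Matrix.trace_smul, trace_transpose, trace_vecMulVec, smul_eq_mul]
  have conj_transpose : (Q * (E * gi)ᵀ * Qᵀ) a b = (Q * (E * gi) * Qᵀ) b a := by
    rw [← Matrix.transpose_apply (Q * (E * gi) * Qᵀ)]
    simp only [Matrix.transpose_mul, Matrix.transpose_transpose, mul_assoc]
  have tensor_eq : lovTensor (n + 1) X gi = (2 * lovScalar (n + 1) X) • gi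
      - (2 * (n + 1) : ℝ) • (E * gi + (E * gi)ᵀ) := by
    rw [lovTensor, lovMixed_succ X hX, sub_mul, Matrix.smul_mul, Matrix.smul_mul, one_mul,
      Matrix.transpose_sub, Matrix.transpose_smul, Matrix.transpose_smul, hgi.eq]
    module
  rw [trace_bracket, tensor_eq]
  simp only [mul_sub, sub_mul, mul_add, add_mul, Matrix.mul_smul, Matrix.smul_mul,
    Matrix.sub_apply, Matrix.add_apply, Matrix.smul_apply, smul_eq_mul, conj_transpose]
  push_cast
  field_simp
  ring

end PsiBracket

section MapPsi

variable {m n : ℕ} {Λ : Type*} [Ring Λ] [Algebra ℝ Λ]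

/-- The factors of the products in `Psi`, for an arbitrary matrix `Ω` of forms in place of the
curvature: the bracket depending on `a` and `b`, followed by `n = r - 1` copies of `Ω`. -/
def psiFactors (n : ℕ) (η : Matrix (Fin m) (Fin m) ℝ) (Ω : Matrix (Fin m) (Fin m) Λ)
    (a b : Fin m) : Fin (n + 1) → Matrix (Fin m) (Fin m) Λ :=
  Fin.cons
    (Matrix.of fun c t =>
      η t b • Ω c a + η t a • Ω c b - ((1 / ((n + 1 : ℕ) : ℝ)) * η a b) • Ω c t)
    fun _ => Ω

theorem map_Psi_eq_sum (ψ : Forms (JetCoord m) →ₐ[ℝ] Λ) (s : Fin m → ℤˣ) (z : JetCoord m)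
    (hΩ : ∀ i j x, Commute (ψ (curvFormUp s i j z)) x) (a b : Fin m) :
    ψ (Psi s (n + 1) a b z) = ∑ B,
      listBlockProd (psiFactors n (eta s) (Matrix.of fun i j => ψ (curvFormUp s i j z)) a b) B
        * sparlingOf (fun k => ψ (oneForm (theta k z))) (B ∘ indexOrder n) := by
  have map_sparling (I : Fin (2 + (n + n)) → Fin m) :
      ψ (sparling I z) = sparlingOf (fun k => ψ (oneForm (theta k z))) I := by
    simp only [sparling, sparlingOf, map_smul, map_sum, map_list_prod, List.map_ofFn]
    rfl
  have map_curvFormProd (I J : Fin n → Fin m) :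
      ψ (curvFormProd s I J z) = (List.ofFn fun k => ψ (curvFormUp s (I k) (J k) z)).prod := by
    rw [curvFormProd, map_list_prod, List.map_ofFn]
    rfl
  have prod_commute (I J : Fin n → Fin m) (x : Λ) :
      Commute (List.ofFn fun k => ψ (curvFormUp s (I k) (J k) z)).prod x := by
    refine Commute.list_prod_left _ _ fun y hy => ?_
    obtain ⟨k, rfl⟩ := (List.mem_ofFn' _ _).mp hy
    exact hΩ _ _ _
  rw [Psi]
  simp only [map_sum, map_mul, map_sub, map_add, map_smul]
  refine (sum_splitIndices fun c t I J =>
    (eta s t b • ψ (curvFormUp s c a z) + eta s t a • ψ (curvFormUp s c b z)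
        - ((1 / ((n + 1 : ℕ) : ℝ)) * eta s a b) • ψ (curvFormUp s c t z))
      * ψ (sparling (Fin.append ![c, t] (Fin.append I J)) z) * ψ (curvFormProd s I J z)).trans ?_
  refine Finset.sum_congr rfl fun B _ => ?_
  rw [append_indexOrder, map_sparling, map_curvFormProd, listBlockProd, List.ofFn_succ,
    List.prod_cons, mul_assoc, mul_assoc, ← (prod_commute _ _ _).eq]
  rfl

theorem krSum_psiBracket {gi : Matrix (Fin m) (Fin m) ℝ} (Q : Matrix (Fin m) (Fin m) ℝ)
    (hgi : gi.IsSymm) (X : Fin m → Fin m → Matrix (Fin m) (Fin m) ℝ)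
    (hX : ∀ α β, (X α β)ᵀ = -X α β) (c : ℝ) (a b : Fin m) :
    (krSum fun A B : Fin (n + 1) × Fin 2 → Fin m => blockProd (fun j =>
        (Fin.cons (fun α β => c • X α β * psiBracket n Q gi a b) fun _ α β => c • X α β :
          Fin (n + 1) → Fin m → Fin m → Matrix (Fin m) (Fin m) ℝ) j (A (j, 0)) (A (j, 1))) B)
      = c ^ (n + 1) * (-(1 / (2 * ((n + 1 : ℕ) : ℝ)))
          * (Q * lovTensor (n + 1) X gi * Qᵀ) a b) := by
  rw [← trace_psiBracket_mul Q hgi X hX, ← krSum_blockProd_update_mul, ← krSum_mul_left]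
  congr 1
  ext A B
  rw [blockProd, blockProd, Fin.prod_univ_succ, Fin.prod_univ_succ]
  simp only [Fin.cons_zero, Fin.cons_succ, Function.update_self, Matrix.smul_mul,
    Matrix.smul_apply, smul_eq_mul, Finset.prod_mul_distrib, Finset.prod_const, Finset.card_univ,
    Fintype.card_fin, ne_eq, Fin.succ_ne_zero, not_false_eq_true, Function.update_of_ne, blocks]
  ring

theorem exists_map_Psi_eq_smul_volForm (ψ : Forms (JetCoord m) →ₐ[ℝ] Forms (Fin m → ℝ))
    (s : Fin m → ℤˣ) (z : JetCoord m) (hp : 2 + (n + n) ≤ m)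
    {gi Q : Matrix (Fin m) (Fin m) ℝ} (hgi : gi.IsSymm) (hQ : Q.det ≠ 0)
    (hη : eta s = Q * gi * Qᵀ)
    (X : Fin m → Fin m → Matrix (Fin m) (Fin m) ℝ) (hX : ∀ α β, (X α β)ᵀ = -X α β)
    (hθ : ∀ k, ψ (oneForm (theta k z)) = ∑ μ, Q k μ • dxForm μ)
    (hΩ : ∀ a b, ψ (curvFormUp s a b z)
      = twoForm fun α β => (Q * ((1 / 2 : ℝ) • X α β) * Qᵀ) a b) :
    ∃ c : ℝ, c ≠ 0 ∧ ∀ a b,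
      ψ (Psi s (n + 1) a b z) = (c * (Q * lovTensor (n + 1) X gi * Qᵀ) a b) • volForm m := by
  refine ⟨Q.det * (orderSign n * ((1 / 2) ^ (n + 1) * -(1 / (2 * ((n + 1 : ℕ) : ℝ))))),
    mul_ne_zero hQ (mul_ne_zero orderSign_ne_zero ?_), fun a b => ?_⟩
  · exact mul_ne_zero (by positivity) (neg_ne_zero.mpr (by positivity))
  let Y : Fin (n + 1) → Fin m → Fin m → Matrix (Fin m) (Fin m) ℝ :=
    Fin.cons (fun α β => (1 / 2 : ℝ) • X α β * psiBracket n Q gi a b)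
      fun _ α β => (1 / 2 : ℝ) • X α β
  let N (j : Fin (n + 1)) : Matrix (Fin m) (Fin m) (Forms (Fin m → ℝ)) :=
    Matrix.of fun x y => twoForm fun α β => Y j α β x y
  have factors_eq (j : Fin (n + 1)) (c t : Fin m) :
      psiFactors n (eta s) (Matrix.of fun i j => ψ (curvFormUp s i j z)) a b j c t
        = twoForm fun α β => (Q * Y j α β * Qᵀ) c t := by
    refine Fin.cases ?_ (fun _ => ?_) j
    · simp only [psiFactors, Y, Fin.cons_zero, Matrix.of_apply, hΩ, conj_mul_psiBracket Q hgi, hη,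
        twoForm, sub_smul, add_smul, mul_smul, Finset.sum_sub_distrib, Finset.sum_add_distrib,
        Finset.smul_sum]
    · exact hΩ c t
  rw [map_Psi_eq_sum ψ s z (fun i j x => hΩ i j ▸ commute_twoForm _ x),
    sum_listBlockProd_mul_sparlingOf Q hθ hp (N := N)
      (fun j c t => (factors_eq j c t).trans (twoForm_conj Q (Y j) c t)),
    sum_listBlockProd_mul_sparlingOf_dxForm hp Y (N := N) fun _ _ _ => rfl,
    krSum_psiBracket Q hgi X hX, smul_smul]
  congr 1
  ring

end MapPsi

/-! ### Connections in a moving frame -/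

section MovingFrame

variable {k R ι : Type*} [CommRing k] [CommRing R] [Algebra k R] [Fintype ι]
  {d : ι → Derivation k R R} {F Q : Matrix ι ι R} {Γ : ι → Matrix ι ι R}

/-- The connection `Γ` in the frame `F` with dual coframe `Q`. -/
def frameConnection (d : ι → Derivation k R R) (F Q : Matrix ι ι R) (Γ : ι → Matrix ι ι R)
    (ν : ι) : Matrix ι ι R :=
  Q * (matDer (d ν) F + Γ ν * F)

variable [DecidableEq ι]

theorem curvatureMat_frameConnection (hd : ∀ i j f, d i (d j f) = d j (d i f)) (hFQ : F * Q = 1)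
    (μ ν : ι) :
    curvatureMat d (frameConnection d F Q Γ) μ ν = Q * curvatureMat d Γ μ ν * F := by
  have second_deriv_comm : matDer (d μ) (matDer (d ν) F) = matDer (d ν) (matDer (d μ) F) :=
    Matrix.ext fun _ _ => hd _ _ _
  have product (μ ν : ι) : frameConnection d F Q Γ μ * frameConnection d F Q Γ ν
      = Q * matDer (d μ) F * Q * (matDer (d ν) F + Γ ν * F)
        + Q * Γ μ * (matDer (d ν) F + Γ ν * F) :=
    calc Q * (matDer (d μ) F + Γ μ * F) * (Q * (matDer (d ν) F + Γ ν * F))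
        = Q * matDer (d μ) F * Q * (matDer (d ν) F + Γ ν * F)
          + Q * Γ μ * (F * Q) * (matDer (d ν) F + Γ ν * F) := by noncomm_ring
      _ = _ := by rw [hFQ, mul_one]
  rw [curvatureMat, product, product]
  simp only [frameConnection, matDer_mul, matDer_add, matDer_inverse _ hFQ, curvatureMat]
  rw [second_deriv_comm]
  noncomm_ring

theorem matDer_frame_eq (hFQ : F * Q = 1) (ν : ι) :
    matDer (d ν) F = F * frameConnection d F Q Γ ν - Γ ν * F := by
  rw [frameConnection, ← mul_assoc, hFQ, one_mul, add_sub_cancel_right]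

theorem matDer_coframe_eq (hFQ : F * Q = 1) (ν : ι) :
    matDer (d ν) Q = Q * Γ ν - frameConnection d F Q Γ ν * Q := by
  have hQF : Q * F = 1 := mul_eq_one_comm.mp hFQ
  rw [matDer_inverse _ hFQ, matDer_frame_eq (Γ := Γ) hFQ]
  calc -(Q * (F * frameConnection d F Q Γ ν - Γ ν * F) * Q)
      = Q * Γ ν * (F * Q) - Q * F * frameConnection d F Q Γ ν * Q := by noncomm_ring
    _ = _ := by rw [hFQ, hQF, mul_one, one_mul]

theorem matDer_metric_of_frameConnection_skew {H : Matrix ι ι R} (hFQ : F * Q = 1)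
    (hH : H * H = 1) {ν : ι} (hdH : matDer (d ν) H = 0)
    (hskew : frameConnection d F Q Γ ν + H * (frameConnection d F Q Γ ν)ᵀ * H = 0) :
    matDer (d ν) (Qᵀ * H * Q) = (Γ ν)ᵀ * (Qᵀ * H * Q) + Qᵀ * H * Q * Γ ν := by
  set W := frameConnection d F Q Γ ν with hW
  have lowered_skew : Wᵀ * H + H * W = 0 :=
    calc Wᵀ * H + H * W = H * H * Wᵀ * H + H * W := by rw [hH, one_mul]
      _ = H * (W + H * Wᵀ * H) := by noncomm_ring
      _ = 0 := by rw [hskew, mul_zero]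
  rw [matDer_mul, matDer_mul, matDer_transpose, hdH, matDer_coframe_eq (Γ := Γ) hFQ, ← hW,
    Matrix.transpose_sub, Matrix.transpose_mul, Matrix.transpose_mul, mul_zero, add_zero]
  calc ((Γ ν)ᵀ * Qᵀ - Qᵀ * Wᵀ) * H * Q + Qᵀ * H * (Q * Γ ν - W * Q)
      = (Γ ν)ᵀ * (Qᵀ * H * Q) + Qᵀ * H * Q * Γ ν - Qᵀ * (Wᵀ * H + H * W) * Q := by noncomm_ring
    _ = _ := by rw [lowered_skew, mul_zero, zero_mul, sub_zero]

end MovingFrame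

/-! ### Pullbacks of one-forms and of their exterior derivatives -/

section Pullback

variable {E F : Type*} [NormedAddCommGroup E] [NormedSpace ℝ E] [NormedAddCommGroup F]
  [NormedSpace ℝ F] {m : ℕ}

/-- The pullback of forms along `f` at the point `y`, as an algebra homomorphism. -/
def pullbackHom (f : E → F) (y : E) : Forms F →ₐ[ℝ] Forms E :=
  ExteriorAlgebra.map (ContinuousLinearMap.precomp ℝ (fderiv ℝ f y)).toLinearMap

theorem pullbackHom_oneForm (f : E → F) (y : E) (α : F →L[ℝ] ℝ) :
    pullbackHom f y (oneForm α) = oneForm (α.comp (fderiv ℝ f y)) :=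
  ExteriorAlgebra.map_apply_ι _ _

theorem oneForm_eq_sum (β : (Fin m → ℝ) →L[ℝ] ℝ) :
    oneForm β = ∑ μ, β (Pi.single μ 1) • dxForm μ := by
  have expansion :
      β = ∑ μ, β (Pi.single μ 1) • (ContinuousLinearMap.proj μ : (Fin m → ℝ) →L[ℝ] ℝ) :=
    ContinuousLinearMap.ext fun v => by
      conv_lhs => rw [pi_eq_sum_univ' v]
      simp only [map_sum, map_smul, sum_apply, smul_apply, ContinuousLinearMap.proj_apply,
        smul_eq_mul, mul_comm, Pi.single]
  conv_lhs => rw [expansion]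
  simp only [oneForm, map_sum, map_smul, dxForm]

theorem oneForm_mul_oneForm (β γ : (Fin m → ℝ) →L[ℝ] ℝ) :
    oneForm β * oneForm γ = twoForm fun μ ν => β (Pi.single μ 1) * γ (Pi.single ν 1) := by
  rw [oneForm_eq_sum β, oneForm_eq_sum γ, Finset.sum_mul_sum]
  simp only [twoForm, smul_mul_smul_comm]

variable {κ : Type*} [Fintype κ] {f : (Fin m → ℝ) → κ → ℝ} {y : Fin m → ℝ}
  {α : (κ → ℝ) → ((κ → ℝ) →L[ℝ] ℝ)}

theorem pderiv_pullback_oneForm (hf : ContDiffAt ℝ ∞ f y) (hα : DifferentiableAt ℝ α (f y))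
    (μ ν : Fin m) :
    pderiv μ (fun x => α (f x) (fderiv ℝ f x (Pi.single ν 1))) y
      = fderiv ℝ α (f y) (fderiv ℝ f y (Pi.single μ 1)) (fderiv ℝ f y (Pi.single ν 1))
        + α (f y) (fderiv ℝ (fderiv ℝ f) y (Pi.single μ 1) (Pi.single ν 1)) := by
  have deriv_f : HasFDerivAt f (fderiv ℝ f y) y := (hf.differentiableAt (by simp)).hasFDerivAt
  have deriv_f' : HasFDerivAt (fderiv ℝ f) (fderiv ℝ (fderiv ℝ f) y) y :=
    ((hf.fderiv_right (m := ∞) (by simp)).differentiableAt (by simp)).hasFDerivAt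
  have product_rule := (hα.hasFDerivAt.comp y deriv_f).clm_apply
    (deriv_f'.clm_apply (hasFDerivAt_const (Pi.single ν (1 : ℝ)) y))
  have deriv_eq : fderiv ℝ (fun x => α (f x) (fderiv ℝ f x (Pi.single ν 1))) y = _ :=
    product_rule.fderiv
  rw [pderiv, deriv_eq]
  simp [add_comm]

variable [DecidableEq κ]

theorem pullbackHom_dOne_eq_twoForm :
    pullbackHom f y (dOne α (f y)) = twoForm fun μ ν =>
      fderiv ℝ α (f y) (fderiv ℝ f y (Pi.single μ 1)) (fderiv ℝ f y (Pi.single ν 1)) := by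
  have expand (v : κ → ℝ) :
      fderiv ℝ α (f y) v = ∑ A, v A • fderiv ℝ α (f y) (Pi.single A 1) := by
    conv_lhs => rw [pi_eq_sum_univ' v]
    simp only [map_sum, map_smul]
  simp only [dOne, map_sum, map_mul, pullbackHom_oneForm, oneForm_mul_oneForm, ← twoForm_sum]
  congr 1
  ext μ ν
  rw [expand, sum_apply]
  rfl

theorem pullbackHom_dOne (hf : ContDiffAt ℝ ∞ f y) (hα : DifferentiableAt ℝ α (f y)) :
    pullbackHom f y (dOne α (f y))
      = twoForm fun μ ν => pderiv μ (fun x => α (f x) (fderiv ℝ f x (Pi.single ν 1))) y := by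
  -- The second derivatives of `f` are symmetric, so they do not contribute to a form.
  have hsymm : IsSymmSndFDerivAt ℝ f y :=
    hf.isSymmSndFDerivAt (by simpa using ENat.LEInfty.out)
  simp only [pderiv_pullback_oneForm hf hα, twoForm_add]
  rw [twoForm_eq_zero_of_symm fun μ ν => congrArg (α (f y)) (hsymm _ _), add_zero,
    pullbackHom_dOne_eq_twoForm]

end Pullback

/-! ### Sections of the jet bundle in coordinates -/

section JetField

variable {m : ℕ}

theorem eta_mul_eta (s : Fin m → ℤˣ) : eta s * eta s = 1 := by
  rw [eta, Matrix.diagonal_mul_diagonal, ← Matrix.diagonal_one]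
  congr 1
  ext a
  rw [← Int.cast_mul, ← Units.val_mul, Int.units_mul_self]
  simp

theorem isSymm_eta (s : Fin m → ℤˣ) : (eta s).IsSymm :=
  Matrix.isSymm_diagonal _

/-- The matrix `η`, over the algebra of smooth functions on `V`. -/
def etaMat (V : Set (Fin m → ℝ)) (s : Fin m → ℤˣ) : Matrix (Fin m) (Fin m) (smoothFun V) :=
  (eta s).map (algebraMap ℝ (smoothFun V))

theorem etaMat_mul_etaMat (V : Set (Fin m → ℝ)) (s : Fin m → ℤˣ) : etaMat V s * etaMat V s = 1 := by
  rw [etaMat, ← Matrix.map_mul, eta_mul_eta, Matrix.map_one _ (map_zero _) (map_one _)]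

theorem isSymm_etaMat (V : Set (Fin m → ℝ)) (s : Fin m → ℤˣ) : (etaMat V s).IsSymm :=
  (isSymm_eta s).map _

theorem etaMat_eval {V : Set (Fin m → ℝ)} (s : Fin m → ℤˣ) (p : V) :
    (etaMat V s).map (evalAt p) = eta s := rfl

/-- A smooth section of the jet bundle over an open subset `V` of the coordinate space, in fibered
coordinates. -/
structure JetField (V : Set (Fin m → ℝ)) where
  toFun : (Fin m → ℝ) → JetCoord m
  isOpen : IsOpen V
  contDiffOn : ContDiffOn ℝ ∞ toFun V
  base : ∀ y μ, toFun y (.inl μ) = y μ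
  det_ne_zero : ∀ y ∈ V, (frameMat (toFun y)).det ≠ 0

namespace JetField

variable {V : Set (Fin m → ℝ)} (J : JetField V)

theorem contDiffOn_apply (A : JetIdx m) : ContDiffOn ℝ ∞ (fun y => J.toFun y A) V :=
  contDiffOn_pi.mp J.contDiffOn A

/-- The partial derivatives as derivations of the algebra of smooth functions on `V`. -/
def der : Fin m → Derivation ℝ (smoothFun V) (smoothFun V) :=
  coordDer J.isOpen (ContinuousLinearMap.id ℝ (Fin m → ℝ))

theorem der_comm (i j : Fin m) (f : smoothFun V) : J.der i (J.der j f) = J.der j (J.der i f) :=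
  dirDer_comm J.isOpen _ _ _

/-- The matrix `e^ν_k`, as a matrix of smooth functions. -/
def frame : Matrix (Fin m) (Fin m) (smoothFun V) :=
  smoothMat (fun y => frameMat (J.toFun y)) fun ν k => J.contDiffOn_apply (.inr (.inl (ν, k)))

/-- The inverse matrix `e^k_μ`, as a matrix of smooth functions. -/
def coframe : Matrix (Fin m) (Fin m) (smoothFun V) :=
  smoothMat (fun y => coframeMat (J.toFun y)) (contDiffOn_matrix_inv
    (fun ν k => J.contDiffOn_apply (.inr (.inl (ν, k)))) J.det_ne_zero)

/-- The matrix `(e^ν_{kσ})_{νk}` of smooth functions. -/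
def frameDeriv (σ : Fin m) : Matrix (Fin m) (Fin m) (smoothFun V) :=
  smoothMat (fun y => Matrix.of fun ν k => frameDer (J.toFun y) ν k σ)
    fun ν k => J.contDiffOn_apply (.inr (.inr (ν, k, σ)))

/-- The linear connection `Γ^μ_{νσ} = - e^k_ν e^μ_{kσ}`. -/
def conn (σ : Fin m) : Matrix (Fin m) (Fin m) (smoothFun V) :=
  -(J.frameDeriv σ * J.coframe)

/-- The metric `g_{μν}`. -/
def metricMat (s : Fin m → ℤˣ) : Matrix (Fin m) (Fin m) (smoothFun V) :=
  J.coframeᵀ * etaMat V s * J.coframe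

/-- The inverse metric `g^{μν}`. -/
def metricInv (s : Fin m → ℤˣ) : Matrix (Fin m) (Fin m) (smoothFun V) :=
  J.frame * etaMat V s * J.frameᵀ

theorem coframe_eval (p : V) : J.coframe.map (evalAt p) = coframeMat (J.toFun p) := rfl

theorem frame_mul_coframe : J.frame * J.coframe = 1 :=
  evalAt_matrix_ext fun p => by
    rw [map_evalAt_mul, Matrix.map_one _ (map_zero _) (map_one _)]
    exact Matrix.mul_nonsing_inv _ (isUnit_iff_ne_zero.mpr (J.det_ne_zero p p.2))

theorem coframe_mul_frame : J.coframe * J.frame = 1 := mul_eq_one_comm.mp J.frame_mul_coframe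

theorem matDer_etaMat (s : Fin m → ℤˣ) (μ : Fin m) : matDer (J.der μ) (etaMat V s) = 0 := by
  ext1 i j
  exact Derivation.map_algebraMap (J.der μ) (eta s i j)

theorem isSymm_metricMat (s : Fin m → ℤˣ) : (J.metricMat s).IsSymm := by
  rw [Matrix.IsSymm, metricMat, Matrix.transpose_mul, Matrix.transpose_mul,
    Matrix.transpose_transpose, (isSymm_etaMat V s).eq, mul_assoc]

theorem metricMat_mul_metricInv (s : Fin m → ℤˣ) : J.metricMat s * J.metricInv s = 1 :=
  calc J.metricMat s * J.metricInv s
      = J.coframeᵀ * (etaMat V s * (J.coframe * J.frame) * etaMat V s) * J.frameᵀ := by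
        simp only [metricMat, metricInv, mul_assoc]
    _ = J.coframeᵀ * J.frameᵀ := by rw [coframe_mul_frame, mul_one, etaMat_mul_etaMat, mul_one]
    _ = 1 := by rw [← Matrix.transpose_mul, frame_mul_coframe, Matrix.transpose_one]

theorem metricInv_mul_coframe_transpose (s : Fin m → ℤˣ) :
    J.metricInv s * J.coframeᵀ = J.frame * etaMat V s := by
  rw [metricInv, mul_assoc _ _ J.coframeᵀ, ← Matrix.transpose_mul, coframe_mul_frame,
    Matrix.transpose_one, mul_one]

theorem coframe_mul_metricInv_mul (s : Fin m → ℤˣ) :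
    J.coframe * J.metricInv s * J.coframeᵀ = etaMat V s := by
  rw [mul_assoc, metricInv_mul_coframe_transpose, ← mul_assoc, coframe_mul_frame, one_mul]

theorem contDiffAt {y : Fin m → ℝ} (hy : y ∈ V) : ContDiffAt ℝ ∞ J.toFun y :=
  J.contDiffOn.contDiffAt (J.isOpen.mem_nhds hy)

theorem fderiv_toFun_apply {y : Fin m → ℝ} (hy : y ∈ V) (v : Fin m → ℝ) (A : JetIdx m) :
    fderiv ℝ J.toFun y v A = fderiv ℝ (fun x => J.toFun x A) y v := by
  rw [fderiv_pi (differentiableAt_pi.mp ((J.contDiffAt hy).differentiableAt (by simp)))]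
  rfl

theorem fderiv_base {y : Fin m → ℝ} (hy : y ∈ V) (ν σ : Fin m) :
    fderiv ℝ J.toFun y (Pi.single ν 1) (.inl σ) = if ν = σ then 1 else 0 := by
  have base_eq : (fun x => J.toFun x (.inl σ)) = fun x => x σ := funext fun x => J.base x σ
  rw [J.fderiv_toFun_apply hy, base_eq, (hasFDerivAt_apply σ y).fderiv]
  simp [Pi.single_apply, eq_comm]

theorem fderiv_frame {y : Fin m → ℝ} (hy : y ∈ V) (ν μ j : Fin m) :
    fderiv ℝ J.toFun y (Pi.single ν 1) (.inr (.inl (μ, j)))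
      = evalAt ⟨y, hy⟩ (J.der ν (J.frame μ j)) := by
  rw [J.fderiv_toFun_apply hy]
  exact (evalAt_dirDer_of_eq J.isOpen (Pi.single ν 1) (J.frame μ j)
    (F := fun x => J.toFun x (.inr (.inl (μ, j)))) (fun _ => rfl) ⟨y, hy⟩).symm

theorem frameConnection_conn (ν : Fin m) :
    frameConnection J.der J.frame J.coframe J.conn ν
      = J.coframe * (matDer (J.der ν) J.frame - J.frameDeriv ν) := by
  rw [frameConnection, conn, Matrix.neg_mul, mul_assoc, coframe_mul_frame, mul_one,
    sub_eq_add_neg]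

theorem omega_fderiv (ν i j : Fin m) {y : Fin m → ℝ} (hy : y ∈ V) :
    omega i j (J.toFun y) (fderiv ℝ J.toFun y (Pi.single ν 1))
      = evalAt ⟨y, hy⟩ (frameConnection J.der J.frame J.coframe J.conn ν i j) := by
  rw [frameConnection_conn, omega, sum_apply, Matrix.mul_apply, map_sum]
  refine Finset.sum_congr rfl fun μ _ => ?_
  rw [smul_apply, smul_eq_mul, map_mul, Matrix.sub_apply, map_sub, sub_apply, sum_apply]
  simp only [smul_apply, smul_eq_mul, dx, de, ContinuousLinearMap.proj_apply, J.fderiv_base hy,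
    J.fderiv_frame hy, mul_ite, mul_one, mul_zero, Finset.sum_ite_eq, Finset.mem_univ, if_true]
  rfl

theorem omegaP_fderiv (s : Fin m → ℤˣ) (ν i j : Fin m) {y : Fin m → ℝ} (hy : y ∈ V) :
    omegaP s i j (J.toFun y) (fderiv ℝ J.toFun y (Pi.single ν 1))
      = (1 / 2 : ℝ) * evalAt ⟨y, hy⟩ ((frameConnection J.der J.frame J.coframe J.conn ν
        + etaMat V s * (frameConnection J.der J.frame J.coframe J.conn ν)ᵀ * etaMat V s) i j) := by
  simp only [omegaP, smul_apply, add_apply, sum_apply, J.omega_fderiv ν _ _ hy, smul_eq_mul,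
    Matrix.add_apply, Matrix.mul_apply, Matrix.transpose_apply, map_add, map_sum, map_mul,
    Finset.sum_mul]
  congr 2
  refine Finset.sum_congr rfl fun p _ => Finset.sum_congr rfl fun q _ => ?_
  rw [(isSymm_eta s).apply p j, (isSymm_eta s).apply i q]
  change _ = eta s i q * _ * eta s p j
  ring

theorem frameConnection_skew {s : Fin m → ℤˣ}
    (hω : ∀ y ∈ V, ∀ i j, pullback J.toFun (fun z => oneForm (omegaP s i j z)) y = 0) (ν : Fin m) :
    frameConnection J.der J.frame J.coframe J.conn ν
      + etaMat V s * (frameConnection J.der J.frame J.coframe J.conn ν)ᵀ * etaMat V s = 0 := by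
  ext1 i j
  refine smoothFun.ext_eval fun p => ?_
  have pullback_eq_zero : pullbackHom J.toFun p (oneForm (omegaP s i j (J.toFun p))) = 0 :=
    hω p p.2 i j
  rw [pullbackHom_oneForm, oneForm, ExteriorAlgebra.ι_eq_zero_iff] at pullback_eq_zero
  have omegaP_eq_zero := congrArg (fun α => α (Pi.single ν (1 : ℝ))) pullback_eq_zero
  rw [ContinuousLinearMap.comp_apply, J.omegaP_fderiv s ν i j p.2] at omegaP_eq_zero
  exact (mul_eq_zero.mp omegaP_eq_zero).resolve_left (by norm_num)

theorem isLeviCivita {s : Fin m → ℤˣ}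
    (hT : ∀ y ∈ V, ∀ μ ν ρ, ∑ i, frameDer (J.toFun y) μ i ν * coframeMat (J.toFun y) i ρ
      = ∑ i, frameDer (J.toFun y) μ i ρ * coframeMat (J.toFun y) i ν)
    (hω : ∀ y ∈ V, ∀ i j, pullback J.toFun (fun z => oneForm (omegaP s i j z)) y = 0) :
    IsLeviCivita J.der (J.metricMat s) (J.metricInv s) J.conn where
  comm := J.der_comm
  symm := J.isSymm_metricMat s
  mul_inv := J.metricMat_mul_metricInv s
  torsion μ κ ρ := smoothFun.ext_eval fun p => by
    simp only [conn, Matrix.neg_apply, map_neg, Matrix.mul_apply, map_sum, map_mul]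
    exact congrArg Neg.neg (hT p p.2 κ μ ρ)
  compat ν := matDer_metric_of_frameConnection_skew J.frame_mul_coframe (etaMat_mul_etaMat V s)
    (J.matDer_etaMat s ν) (J.frameConnection_skew hω ν)

theorem differentiableAt_omega {y : Fin m → ℝ} (hy : y ∈ V) (i j : Fin m) :
    DifferentiableAt ℝ (omega i j) (J.toFun y) := by
  have frameMat_smooth (O : Set (JetCoord m)) (ν k : Fin m) :
      ContDiffOn ℝ ∞ (fun z => frameMat z ν k) O := (contDiff_apply ℝ ℝ _).contDiffOn
  have isOpen_frames : IsOpen {z : JetCoord m | (frameMat z).det ≠ 0} :=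
    isOpen_ne.preimage
      (contDiffOn_univ.mp (contDiffOn_det (frameMat_smooth Set.univ))).continuous
  have coframe_diff (μ : Fin m) :
      DifferentiableAt ℝ (fun z : JetCoord m => coframeMat z i μ) (J.toFun y) :=
    ((contDiffOn_matrix_inv (frameMat_smooth _) (fun _ hz => hz) i μ).contDiffAt
      (isOpen_frames.mem_nhds (J.det_ne_zero y hy))).differentiableAt (by simp)
  have frameDer_diff (μ σ : Fin m) :
      DifferentiableAt ℝ (fun z : JetCoord m => frameDer z μ j σ) (J.toFun y) :=
    differentiableAt_apply _ _
  unfold omega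
  refine DifferentiableAt.fun_sum fun μ _ => (coframe_diff μ).fun_smul ?_
  refine (differentiableAt_const _).fun_sub (DifferentiableAt.fun_sum fun σ _ => ?_)
  exact (frameDer_diff μ σ).fun_smul (differentiableAt_const _)

theorem pullbackHom_dOne_omega (p : V) (i j : Fin m) :
    pullbackHom J.toFun p (dOne (omega i j) (J.toFun p)) = twoForm fun μ ν => evalAt p
      (matDer (J.der μ) (frameConnection J.der J.frame J.coframe J.conn ν) i j) := by
  rw [pullbackHom_dOne (J.contDiffAt p.2) (J.differentiableAt_omega p.2 i j)]
  congr 1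
  ext μ ν
  exact pderiv_eq_evalAt (T := fun x => x) J.isOpen (fun x => hasFDerivAt_id x) μ
    (fun x hx => J.omega_fderiv ν i j hx) p.2

theorem pullbackHom_curvForm (p : V) (i j : Fin m) :
    pullbackHom J.toFun p (curvForm i j (J.toFun p)) = twoForm fun μ ν =>
      (1 / 2 : ℝ) * evalAt p ((J.coframe * curvatureMat J.der J.conn μ ν * J.frame) i j) := by
  set W := frameConnection J.der J.frame J.coframe J.conn with hW
  have structure_equation : pullbackHom J.toFun p (curvForm i j (J.toFun p))
      = twoForm fun μ ν => evalAt p ((matDer (J.der μ) (W ν) + W μ * W ν) i j) := by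
    simp only [curvForm, map_add, pullbackHom_dOne_omega, map_sum, map_mul, pullbackHom_oneForm,
      oneForm_mul_oneForm, ContinuousLinearMap.comp_apply, J.omega_fderiv _ _ _ p.2,
      Matrix.add_apply, twoForm_add, Matrix.mul_apply, twoForm_sum, hW]
  rw [structure_equation, ← twoForm_antisymm]
  congr 1
  ext μ ν
  rw [← curvatureMat_frameConnection J.der_comm J.frame_mul_coframe, ← map_sub, ← hW,
    curvatureMat, ← Matrix.sub_apply, add_sub_add_comm]

theorem coframe_conj_curvatureUpMat (s : Fin m → ℤˣ) (α β : Fin m) :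
    J.coframe * curvatureUpMat J.der (J.metricInv s) J.conn α β * J.coframeᵀ
      = J.coframe * curvatureMat J.der J.conn α β * J.frame * etaMat V s := by
  simp only [curvatureUpMat, mul_assoc, metricInv_mul_coframe_transpose]

theorem pullbackHom_curvFormUp (s : Fin m → ℤˣ) (p : V) (a b : Fin m) :
    pullbackHom J.toFun p (curvFormUp s a b (J.toFun p)) = twoForm fun α β =>
      (coframeMat (J.toFun p)
        * ((1 / 2 : ℝ) • (curvatureUpMat J.der (J.metricInv s) J.conn α β).map (evalAt p))
        * (coframeMat (J.toFun p))ᵀ) a b := by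
  have raised (α β : Fin m) : (coframeMat (J.toFun p)
        * ((1 / 2 : ℝ) • (curvatureUpMat J.der (J.metricInv s) J.conn α β).map (evalAt p))
        * (coframeMat (J.toFun p))ᵀ) a b
      = ∑ q, eta s b q * ((1 / 2 : ℝ)
        * evalAt p ((J.coframe * curvatureMat J.der J.conn α β * J.frame) a q)) := by
    rw [Matrix.mul_smul, Matrix.smul_mul, ← J.coframe_eval, ← Matrix.transpose_map,
      ← map_evalAt_mul, ← map_evalAt_mul, coframe_conj_curvatureUpMat, map_evalAt_mul,
      etaMat_eval, Matrix.smul_apply, Matrix.mul_apply, smul_eq_mul, Finset.mul_sum]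
    refine Finset.sum_congr rfl fun q _ => ?_
    rw [(isSymm_eta s).apply b q, Matrix.map_apply]
    ring
  simp only [curvFormUp, map_sum, map_smul, pullbackHom_curvForm, raised, twoForm_sum,
    twoForm_smul]

theorem pullbackHom_theta (p : V) (k : Fin m) :
    pullbackHom J.toFun p (oneForm (theta k (J.toFun p)))
      = ∑ μ, coframeMat (J.toFun p) k μ • dxForm μ := by
  rw [pullbackHom_oneForm, oneForm_eq_sum]
  refine Finset.sum_congr rfl fun ν _ => ?_
  congr 1
  simp only [ContinuousLinearMap.comp_apply, theta, sum_apply, smul_apply, smul_eq_mul, dx,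
    ContinuousLinearMap.proj_apply, J.fderiv_base p.2, mul_ite, mul_one, mul_zero,
    Finset.sum_ite_eq, Finset.mem_univ, if_true]

theorem map_evalAt_lovTensor (r : ℕ) (X : Fin m → Fin m → Matrix (Fin m) (Fin m) (smoothFun V))
    (gi : Matrix (Fin m) (Fin m) (smoothFun V)) (p : V) :
    (lovTensor r X gi).map (evalAt p)
      = lovTensor r (fun α β => (X α β).map (evalAt p)) (gi.map (evalAt p)) := by
  ext μ ν
  simp only [lovTensor, lovMixed, Matrix.map_apply, Matrix.add_apply, Matrix.transpose_apply,
    Matrix.mul_apply, Matrix.of_apply, map_add, map_sum, map_mul, AlgHom.commutes, blockProd,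
    map_prod, blocks, Algebra.algebraMap_self, RingHom.id_apply]

theorem isUnit_coframeMat (p : V) : IsUnit (coframeMat (J.toFun p)) :=
  Matrix.isUnit_nonsing_inv_iff.mpr
    ((Matrix.isUnit_iff_isUnit_det _).mpr (isUnit_iff_ne_zero.mpr (J.det_ne_zero p p.2)))

theorem pullback_Psi_eq_zero_iff {s : Fin m → ℤˣ} {n : ℕ} (hn : 2 * (n + 1) ≤ m)
    (hLC : IsLeviCivita J.der (J.metricMat s) (J.metricInv s) J.conn) (p : V) :
    (∀ a b, pullback J.toFun (Psi s (n + 1) a b) p = 0) ↔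
      (lovTensor (n + 1) (curvatureUpMat J.der (J.metricInv s) J.conn)
        (J.metricInv s)).map (evalAt p) = 0 := by
  have hQ := J.isUnit_coframeMat p
  have eta_eq : eta s = coframeMat (J.toFun p) * (J.metricInv s).map (evalAt p)
      * (coframeMat (J.toFun p))ᵀ := by
    rw [← etaMat_eval s p, ← coframe_mul_metricInv_mul, map_evalAt_mul, map_evalAt_mul,
      Matrix.transpose_map, coframe_eval]
  have curvature_skew (α β : Fin m) :
      ((curvatureUpMat J.der (J.metricInv s) J.conn α β).map (evalAt p))ᵀ
        = -(curvatureUpMat J.der (J.metricInv s) J.conn α β).map (evalAt p) := by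
    rw [← Matrix.transpose_map, hLC.transpose_curvatureUpMat]
    ext i j
    exact map_neg (evalAt p) _
  obtain ⟨c, hc, pullback_Psi_eq⟩ := exists_map_Psi_eq_smul_volForm (pullbackHom J.toFun p) s
    (J.toFun p) (by omega : 2 + (n + n) ≤ m) (hLC.inv_symm.map (evalAt p))
    ((Matrix.isUnit_iff_isUnit_det _).mp hQ).ne_zero eta_eq _ curvature_skew
    (J.pullbackHom_theta p) (J.pullbackHom_curvFormUp s p)
  rw [map_evalAt_lovTensor, ← hQ.mul_right_eq_zero,
    ← ((Matrix.isUnit_transpose _).mpr hQ).mul_left_eq_zero, ← Matrix.ext_iff]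
  refine forall₂_congr fun a b => ?_
  change pullbackHom J.toFun p (Psi s (n + 1) a b (J.toFun p)) = 0 ↔ _
  rw [pullback_Psi_eq, smul_eq_zero, or_iff_left volForm_ne_zero, mul_eq_zero, or_iff_right hc,
    Matrix.zero_apply]

end JetField

end JetField

namespace JetSection

variable {m : ℕ} {M : Type*} [TopologicalSpace M] [ChartedSpace (Fin m → ℝ) M]
  [IsManifold 𝓘(ℝ, Fin m → ℝ) ∞ M] {U : Set M} (σ : JetSection m M U)
  {φ : OpenPartialHomeomorph M (Fin m → ℝ)}

theorem isOpen_dom (hU : IsOpen U) : IsOpen (σ.dom φ) :=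
  φ.symm.isOpen_inter_preimage hU

theorem det_frameMat_coord_ne_zero (hφ : φ ∈ IsManifold.maximalAtlas 𝓘(ℝ, Fin m → ℝ) ∞ M)
    {y : Fin m → ℝ} (hy : y ∈ σ.dom φ) : (frameMat (σ.coord φ y)).det ≠ 0 := by
  have hφ_C1 : φ ∈ IsManifold.maximalAtlas 𝓘(ℝ, Fin m → ℝ) 1 M :=
    IsManifold.maximalAtlas_subset_of_le (by simp) hφ
  have mdifferentiable_φ : φ.MDifferentiable 𝓘(ℝ, Fin m → ℝ) 𝓘(ℝ, Fin m → ℝ) :=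
    ⟨fun x hx => (mdifferentiableAt_of_mem_maximalAtlas hφ_C1 hx).mdifferentiableWithinAt,
      fun x hx => (mdifferentiableAt_symm_of_mem_maximalAtlas hφ_C1 hx).mdifferentiableWithinAt⟩
  have linearIndependent_col : LinearIndependent ℝ (frameMat (σ.coord φ y)).col :=
    (σ.linearIndependent_S (φ.symm y) hy.2).map'
      (mfderiv 𝓘(ℝ, Fin m → ℝ) 𝓘(ℝ, Fin m → ℝ) φ (φ.symm y)).toLinearMap
      (LinearMap.ker_eq_bot.mpr (mdifferentiable_φ.mfderiv_injective (φ.map_target hy.1)))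
  rw [Matrix.linearIndependent_cols_iff_isUnit, Matrix.isUnit_iff_isUnit_det]
    at linearIndependent_col
  exact linearIndependent_col.ne_zero

/-- The section `σ` in fibered coordinates over the chart `φ`, with its regularity. -/
def toJetField (hU : IsOpen U) (hφ : φ ∈ IsManifold.maximalAtlas 𝓘(ℝ, Fin m → ℝ) ∞ M) :
    JetField (σ.dom φ) where
  toFun := σ.coord φ
  isOpen := σ.isOpen_dom hU
  contDiffOn := σ.smooth φ hφ
  base _ _ := rfl
  det_ne_zero _ hy := σ.det_frameMat_coord_ne_zero hφ hy

variable {σ}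

theorem metric_eq_evalAt (hU : IsOpen U)
    (hφ : φ ∈ IsManifold.maximalAtlas 𝓘(ℝ, Fin m → ℝ) ∞ M) (s : Fin m → ℤˣ) (p : σ.dom φ) :
    σ.metric s φ p = ((σ.toJetField hU hφ).metricMat s).map (evalAt p) := by
  rw [JetField.metricMat, map_evalAt_mul, map_evalAt_mul, Matrix.transpose_map,
    JetField.coframe_eval, etaMat_eval]
  ext μ ν
  simp only [metric, Matrix.of_apply, Matrix.mul_apply, Matrix.transpose_apply, Finset.sum_mul]
  exact Finset.sum_comm

theorem metric_inv_eq_evalAt (hU : IsOpen U)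
    (hφ : φ ∈ IsManifold.maximalAtlas 𝓘(ℝ, Fin m → ℝ) ∞ M) (s : Fin m → ℤˣ) (p : σ.dom φ) :
    (σ.metric s φ p)⁻¹ = ((σ.toJetField hU hφ).metricInv s).map (evalAt p) := by
  refine Matrix.inv_eq_right_inv ?_
  rw [metric_eq_evalAt hU hφ, ← map_evalAt_mul, JetField.metricMat_mul_metricInv,
    Matrix.map_one _ (map_zero _) (map_one _)]

theorem connection_eq_evalAt (hU : IsOpen U)
    (hφ : φ ∈ IsManifold.maximalAtlas 𝓘(ℝ, Fin m → ℝ) ∞ M) (μ ν ρ : Fin m) (p : σ.dom φ) :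
    σ.connection φ μ ν ρ p = evalAt p ((σ.toJetField hU hφ).conn ρ μ ν) := by
  rw [connection, JetField.conn, Matrix.neg_apply, map_neg, Matrix.mul_apply, map_sum]
  congr 1
  refine Finset.sum_congr rfl fun k _ => ?_
  rw [map_mul, mul_comm]
  rfl

theorem isLeviCivita (hU : IsOpen U)
    (hφ : φ ∈ IsManifold.maximalAtlas 𝓘(ℝ, Fin m → ℝ) ∞ M) {s : Fin m → ℤˣ}
    (hT : σ.Torsionless) (hω : σ.Metricity s) :
    IsLeviCivita (σ.toJetField hU hφ).der ((σ.toJetField hU hφ).metricMat s)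
      ((σ.toJetField hU hφ).metricInv s) (σ.toJetField hU hφ).conn :=
  (σ.toJetField hU hφ).isLeviCivita (hT φ hφ) (hω φ hφ)

theorem pullback_Psi_eq_zero_iff_lovelockTensor (hU : IsOpen U)
    (hφ : φ ∈ IsManifold.maximalAtlas 𝓘(ℝ, Fin m → ℝ) ∞ M) {s : Fin m → ℤˣ} (hT : σ.Torsionless)
    (hω : σ.Metricity s) {r : ℕ} (hr : 1 ≤ r) (hrm : 2 * r ≤ m) {y : Fin m → ℝ}
    (hy : y ∈ σ.dom φ) :
    (∀ a b, pullback (σ.coord φ) (Psi s r a b) y = 0) ↔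
      ∀ μ ν, lovelockTensor r (σ.metric s φ) (σ.connection φ) μ ν y = 0 := by
  obtain ⟨n, rfl⟩ := Nat.exists_eq_add_of_le' hr
  refine ((σ.toJetField hU hφ).pullback_Psi_eq_zero_iff hrm (isLeviCivita hU hφ hT hω)
    ⟨y, hy⟩).trans (Matrix.ext_iff.symm.trans (forall₂_congr fun μ ν => ?_))
  rw [lovelockTensor_eq_evalAt (T := fun x => x) (σ.isOpen_dom hU) (fun x => hasFDerivAt_id x)
    (fun x hx => metric_inv_eq_evalAt hU hφ s ⟨x, hx⟩)
    (fun μ ν ρ x hx => connection_eq_evalAt hU hφ μ ν ρ ⟨x, hx⟩) (n + 1) μ ν hy]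
  rfl

theorem lovelockTensor_connection (hU : IsOpen U)
    (hφ : φ ∈ IsManifold.maximalAtlas 𝓘(ℝ, Fin m → ℝ) ∞ M) {s : Fin m → ℤˣ} (hT : σ.Torsionless)
    (hω : σ.Metricity s) (r : ℕ) (μ ν : Fin m) {y : Fin m → ℝ} (hy : y ∈ σ.dom φ) :
    lovelockTensor r (σ.metric s φ) (σ.connection φ) μ ν y
      = lovelockTensor r (σ.metric s φ) (christoffel (σ.metric s φ)) μ ν y := by
  have inv_eq := fun x (hx : x ∈ σ.dom φ) => metric_inv_eq_evalAt hU hφ s ⟨x, hx⟩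
  have hasFDerivAt_id' (x : Fin m → ℝ) :
      HasFDerivAt (fun x => x) (ContinuousLinearMap.id ℝ _) x := hasFDerivAt_id x
  rw [lovelockTensor_eq_evalAt (T := fun x => x) (σ.isOpen_dom hU) hasFDerivAt_id' inv_eq
      (fun μ ν ρ x hx => connection_eq_evalAt hU hφ μ ν ρ ⟨x, hx⟩) r μ ν hy,
    lovelockTensor_eq_evalAt (T := fun x => x) (σ.isOpen_dom hU) hasFDerivAt_id' inv_eq
      (fun μ ν ρ x hx => christoffel_eq_evalAt (σ.isOpen_dom hU) hasFDerivAt_id'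
        (fun x hx => metric_eq_evalAt hU hφ s ⟨x, hx⟩) inv_eq μ ν ρ hx) r μ ν hy,
    (isLeviCivita hU hφ hT hω).eq_christoffelMat]
  rfl

theorem lovelockTensor_eq_zero_iff_extremal (hU : IsOpen U)
    (hφ : φ ∈ IsManifold.maximalAtlas 𝓘(ℝ, Fin m → ℝ) ∞ M) {s : Fin m → ℤˣ} (hT : σ.Torsionless)
    (hω : σ.Metricity s) (r : ℕ) :
    (∀ y ∈ σ.dom φ, ∀ μ ν, lovelockTensor r (σ.metric s φ) (σ.connection φ) μ ν y = 0) ↔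
      IsLovelockExtremal r (σ.metric s φ) (σ.dom φ) := by
  rw [isLovelockExtremal_iff (σ.isOpen_dom hU) ?_ ?_ ?_ r]
  · exact forall₂_congr fun y hy => forall₂_congr fun μ ν => by
      rw [lovelockTensor_connection hU hφ hT hω r μ ν hy]
  · intro i j
    exact smoothFun.contDiffOn_of_eq ((σ.toJetField hU hφ).metricMat s i j) fun p => by
      rw [metric_eq_evalAt hU hφ s p, Matrix.map_apply]
  · intro y hy
    have mul_inv := congrArg (Matrix.map · (evalAt (⟨y, hy⟩ : σ.dom φ)))
      ((σ.toJetField hU hφ).metricMat_mul_metricInv s)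
    simp only [map_evalAt_mul, Matrix.map_one _ (map_zero _) (map_one _)] at mul_inv
    rw [metric_eq_evalAt hU hφ s ⟨y, hy⟩]
    exact Matrix.det_ne_zero_of_right_inverse mul_inv
  · intro y hy
    rw [metric_eq_evalAt hU hφ s ⟨y, hy⟩]
    exact (JetField.isSymm_metricMat _ s).map _

end JetSection

end Lovelock

end

open Lovelock in
theorem mainTheorem3 {m : ℕ} {M : Type*} [TopologicalSpace M] [ChartedSpace (Fin m → ℝ) M]
    [IsManifold 𝓘(ℝ, Fin m → ℝ) ∞ M] (s : Fin m → ℤˣ) (r : ℕ) (hr : 1 ≤ r) (hrm : 2 * r ≤ m)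
    (U : Set M) (hU : IsOpen U) (σ : JetSection m M U)
    (hT : σ.Torsionless) (hω : σ.Metricity s) :
    List.TFAE [
      ∀ φ ∈ IsManifold.maximalAtlas 𝓘(ℝ, Fin m → ℝ) ∞ M, ∀ y ∈ σ.dom φ, ∀ a b : Fin m,
        pullback (σ.coord φ) (Psi s r a b) y = 0,
      ∀ φ ∈ IsManifold.maximalAtlas 𝓘(ℝ, Fin m → ℝ) ∞ M, ∀ y ∈ σ.dom φ, ∀ μ ν : Fin m,
        lovelockTensor r (σ.metric s φ) (σ.connection φ) μ ν y = 0,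
      ∀ φ ∈ IsManifold.maximalAtlas 𝓘(ℝ, Fin m → ℝ) ∞ M,
        IsLovelockExtremal r (σ.metric s φ) (σ.dom φ)] := by
  tfae_have 1 ↔ 2 := forall₂_congr fun φ hφ => forall₂_congr fun y hy =>
    JetSection.pullback_Psi_eq_zero_iff_lovelockTensor hU hφ hT hω hr hrm hy
  tfae_have 2 ↔ 3 := forall₂_congr fun φ hφ =>
    JetSection.lovelockTensor_eq_zero_iff_extremal hU hφ hT hω r
  tfae_finish
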